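/- Let $F\subset \mathrm{Sym}(\mathbf R^n)$ be a convex ST-invariant cone subequation. That is, $F$ is a closed convex set of symmetric $n\times n$ matrices, $\emptyset\ne F\ne \mathrm{Sym}(\mathbf R^n)$, such that $A+P\in F$ whenever $A\in F$ and $P\ge 0$; $tF\subset F$ for all $t\ge 0$; and $gFg^{t}\subset F$ for all $g$ in some subgroup $G\subset \mathrm O(n)$ acting transitively on the unit sphere. Let $$p=p_F=\sup\{q\in\mathbf R:\ (I-P_e)-(q-1)P_e\in F\}\qquad(|e|=1,\ P_e=e\,e^{t})$$ be its Riesz characteristic (this is independent of $e$ and finite). Let $u$ be $F$-subharmonic on an open neighborhood $X$ of $0\in\mathbf R^n$, i.e. $u$ is upper semicontinuous on $X$ with values in $[-\infty,\infty)$, and $D^2_x\varphi\in F$ whenever $x\in X$ and $\varphi$ is $C^2$ near $x$ with $u\le\varphi$ near $x$ and $u(x)=\varphi(x)$. Assume that $u$ is not identically $-\infty$ in a neighborhood of $0$. For $r>0$ the tangential $p$-flow is $$u_r(x)=\begin{cases} r^{p-2}u(rx), & p>2,\\ r^{p-2}\,[u(rx)-u(0)], & 1\le p<2,\\ u(rx)-\sup_{|y|\le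 r}u(y), & p=2.\end{cases}$$ Write $B_R=\{x:|x|\le R\}$ and $B_r(x)=\{y:|y-x|\le r\}$. A class $\overline U\in L^1_{\rm loc}(\mathbf R^n)$ is an $L^1_{\rm loc}$-tangent to $u$ at $0$ if $u_{r_j}\to\overline U$ in $L^1(B_R)$ for every $R>0$, for some sequence of positive numbers $r_j\to 0$; the tangent set $T_0(u)$ is the set of the functions $U(x)=\lim_{r\to0}\operatorname{ess\,sup}_{B_r(x)}\overline U$, where $\overline U$ runs over the $L^1_{\rm loc}$-tangents. (A) For each $R>0$ there is $\delta>0$ such that the functions $u_r$, $0<r\le\delta$, are defined on $B_R$ and belong to $L^1(B_R)$, the family $\{u_r\}_{0<r\le\delta}$ is uniformly bounded above on $B_R$ and bounded in norm in $L^1(B_R)$, and it is precompact in $L^1(B_R)$. (B) Each $U\in T_0(u)$ lies in the class $\overline U$ that defines it, so that $T_0(u)$ is a subset of $L^1_{\rm loc}(\mathbf R^n)$, and (1) $T_0(u)$ is non-empty; (2) $T_0(u)$ is a compact subset of $L^1_{\rm loc}(\mathbf R^n)$; (3) $T_0(u)$ is invariant under the tangential $p$-flow: $U\in T_0(u)$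 and $r>0$ imply $U_r\in T_0(u)$; (4) $T_0(u)$ is a connected subset of $L^1_{\rm loc}(\mathbf R^n)$. -/

import Mathlib

open MeasureTheory Filter Topology Metric Set

noncomputable section

/-- Euclidean space `ℝⁿ`. -/
abbrev Eucl (n : ℕ) : Type := EuclideanSpace ℝ (Fin n)

/-- A (proper, pure second-order, constant coefficient) subequation: a closed set `F` of symmetric
matrices, non-empty and not all of `Sym(ℝⁿ)`, with `F + 𝒫 ⊆ F`. -/
structure IsSubequation {n : ℕ} (F : Set (Matrix (Fin n) (Fin n) ℝ)) : Prop where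
  isSymm : ∀ A ∈ F, A.IsSymm
  nonempty : F.Nonempty
  proper : ∃ A : Matrix (Fin n) (Fin n) ℝ, A.IsSymm ∧ A ∉ F
  isClosed : IsClosed F
  positivity : ∀ A ∈ F, ∀ P : Matrix (Fin n) (Fin n) ℝ, P.PosSemidef → A + P ∈ F

/-- The cone property: `t F ⊆ F` for all `t ≥ 0`. -/
def HasConeProperty {n : ℕ} (F : Set (Matrix (Fin n) (Fin n) ℝ)) : Prop :=
  ∀ t : ℝ, 0 ≤ t → ∀ A ∈ F, t • A ∈ F

/-- Spherical transitivity: `F` is invariant under `A ↦ g A gᵀ` for all `g` in some subgroup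
`G ⊆ O(n)` which acts transitively on the unit sphere. -/
def IsSTInvariant {n : ℕ} (F : Set (Matrix (Fin n) (Fin n) ℝ)) : Prop :=
  ∃ G : Subgroup (Matrix.orthogonalGroup (Fin n) ℝ),
    (∀ x y : Eucl n, ‖x‖ = 1 → ‖y‖ = 1 →
      ∃ g ∈ G, Matrix.toEuclideanLin (g : Matrix (Fin n) (Fin n) ℝ) x = y) ∧
    ∀ g ∈ G, ∀ A ∈ F,
      (g : Matrix (Fin n) (Fin n) ℝ) * A * (g : Matrix (Fin n) (Fin n) ℝ).transpose ∈ F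

/-- The orthogonal projection `P_e = e eᵀ` onto the line through the unit vector `e`. -/
def lineProj {n : ℕ} (e : Eucl n) : Matrix (Fin n) (Fin n) ℝ :=
  Matrix.of fun i j => e i * e j

/-- The (increasing) Riesz characteristic `p_F = sup {q : P_{e^⊥} - (q - 1) P_e ∈ F}`.
For an ST-invariant `F` the condition does not depend on the unit vector `e`. For a convex
ST-invariant cone subequation the set contains `1` and is bounded above by `n`, so the real
supremum is the true one. -/
def rieszChar {n : ℕ} (F : Set (Matrix (Fin n) (Fin n) ℝ)) : ℝ :=
  sSup {q : ℝ | ∀ e : Eucl n, ‖e‖ = 1 → (1 - lineProj e) - (q - 1) • lineProj e ∈ F}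

/-- The Hessian matrix `D²_x φ`. -/
def hessian {n : ℕ} (φ : Eucl n → ℝ) (x : Eucl n) : Matrix (Fin n) (Fin n) ℝ :=
  Matrix.of fun i j =>
    fderiv ℝ (fderiv ℝ φ) x (EuclideanSpace.single i 1) (EuclideanSpace.single j 1)

/-- `u` is `F`-subharmonic on the open set `X` in the viscosity sense: `u` is upper semicontinuous
on `X` with values in `[-∞, ∞)`, and every `C²` test function touching `u` from above at a point
of `X` has its Hessian there in `F`. The values of `u` off `X` play no role. -/
structure IsSubharmonicOn {n : ℕ} (F : Set (Matrix (Fin n) (Fin n) ℝ)) (u : Eucl n → EReal)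
    (X : Set (Eucl n)) : Prop where
  usc : UpperSemicontinuousOn u X
  lt_top : ∀ x ∈ X, u x < ⊤
  viscosity : ∀ x ∈ X, ∀ φ : Eucl n → ℝ, ContDiffAt ℝ 2 φ x →
    (∀ᶠ y in 𝓝 x, u y ≤ (φ y : EReal)) → u x = (φ x : EReal) → hessian φ x ∈ F

/-- `M(u, r) = sup_{|x| ≤ r} u`. -/
def maxBall {n : ℕ} (u : Eucl n → EReal) (r : ℝ) : EReal :=
  ⨆ x ∈ closedBall (0 : Eucl n) r, u x

/-- The tangential `p`-flow (`p`-homothety) `u ↦ u_r`: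
`r^(p-2) u(rx)` if `p > 2`, `r^(p-2) (u(rx) - u(0))` if `p < 2`, `u(rx) - M(u, r)` if `p = 2`. -/
def tangentialFlow {n : ℕ} (p : ℝ) (u : Eucl n → EReal) (r : ℝ) (x : Eucl n) : EReal :=
  if p = 2 then u (r • x) - maxBall u r
  else if p < 2 then ((r ^ (p - 2) : ℝ) : EReal) * (u (r • x) - u 0)
  else ((r ^ (p - 2) : ℝ) : EReal) * u (r • x)

/-- The space `L¹_loc(ℝⁿ)` of classes of locally integrable functions. -/
def L1loc (n : ℕ) : Type :=
  {f : Eucl n →ₘ[(volume : Measure (Eucl n))] ℝ // LocallyIntegrable f volume}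

/-- Restriction `L¹_loc(ℝⁿ) → L¹(B_R)`, with `B_R` the closed ball. -/
def L1loc.restrict {n : ℕ} (R : ℝ) (f : L1loc n) :
    Lp ℝ 1 ((volume : Measure (Eucl n)).restrict (closedBall 0 R)) :=
  Integrable.toL1 (fun x => f.1 x)
    (f.2.integrableOn_isCompact (isCompact_closedBall (0 : Eucl n) R))

/-- The topology of `L¹`-convergence on every ball `B_R`. -/
instance L1loc.instTopologicalSpace (n : ℕ) : TopologicalSpace (L1loc n) :=
  ⨅ R : ℝ, TopologicalSpace.induced (L1loc.restrict R) inferInstance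

/-- The extended-real-valued function `U` belongs to the class `f ∈ L¹_loc(ℝⁿ)`. -/
def L1loc.Represents {n : ℕ} (f : L1loc n) (U : Eucl n → EReal) : Prop :=
  ∀ᵐ x ∂(volume : Measure (Eucl n)), U x = ((f.1 x : ℝ) : EReal)

/-- `f ∈ L¹_loc(ℝⁿ)` is an `L¹_loc`-tangent to `u` at `0` (for the `p`-flow): for some
`r_j → 0`, `r_j > 0`, one has `∫_{B_R} |u_{r_j} - f| → 0` for every `R`. -/
def IsL1locTangent {n : ℕ} (p : ℝ) (u : Eucl n → EReal) (f : L1loc n) : Prop :=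
  ∃ r : ℕ → ℝ, (∀ j, 0 < r j) ∧ Tendsto r atTop (𝓝 0) ∧
    ∀ R : ℝ, 0 < R →
      Tendsto (fun j => ∫⁻ x in closedBall (0 : Eucl n) R,
        (tangentialFlow p u (r j) x - ((f.1 x : ℝ) : EReal)).abs) atTop (𝓝 0)

/-- The pointwise representative `x ↦ lim_{r → 0} ess sup_{B_r(x)} f`; the essential supremum is
monotone in `r`, so the limit is an infimum. -/
def L1loc.upperRep {n : ℕ} (f : L1loc n) (x : Eucl n) : EReal :=
  ⨅ r : ℝ, ⨅ _ : 0 < r,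
    essSup (fun y => ((f.1 y : ℝ) : EReal)) ((volume : Measure (Eucl n)).restrict (closedBall x r))

/-- The tangent set `T_0(u)`, as a set of pointwise defined functions. -/
def tangentSet {n : ℕ} (p : ℝ) (u : Eucl n → EReal) : Set (Eucl n → EReal) :=
  {U | ∃ f : L1loc n, IsL1locTangent p u f ∧ U = f.upperRep}

/-- The set of classes in `L¹_loc(ℝⁿ)` of the functions in `T`. -/
def classesL1loc {n : ℕ} (T : Set (Eucl n → EReal)) : Set (L1loc n) :=
  {f | ∃ U ∈ T, f.Represents U}

/-- The set of elements of `L¹(B_R)` given by the functions `u_r`, `0 < r ≤ δ`. -/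
def flowFamily {n : ℕ} (p : ℝ) (u : Eucl n → EReal) (R δ : ℝ) :
    Set (Lp ℝ 1 ((volume : Measure (Eucl n)).restrict (closedBall 0 R))) :=
  {f | ∃ r : ℝ, 0 < r ∧ r ≤ δ ∧
    ∀ᵐ x ∂((volume : Measure (Eucl n)).restrict (closedBall 0 R)),
      tangentialFlow p u r x = ((f x : ℝ) : EReal)}

end

/-! ### Linear algebra of subequations -/

noncomputable section

/-! Two consequences of the hypotheses on `F` carry the theorem. First, `F` lies in the half-space
of nonnegative trace (`IsSubequation.trace_nonneg`): an element of negative trace could be replaced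
by a `G`-invariant one, whose quadratic form is constant on the sphere, and then `-I` would lie in
`F`. So `u` obeys the maximum principle against harmonic polynomials, and from this a sub-mean value
inequality for a radial kernel (`IsSubharmonicOn.lintegral_kern_le`). Secondly, for `q > p` the
radial Riesz kernel of exponent `q` has its Hessian outside `F`. Comparing `u` with it on annuli and
letting `q` decrease to `p` shows that `M(u, r)` is a convex function of the Riesz profile of `r`
(`three_point_rieszChar`). Hence the increments of `M(u, ·)` near `0` are at most `Λ` times those of
the profile.

`FlowGerm` bundles what is kept of `u`: an integrable representative, the sub-mean inequality,
semicontinuity and the growth bound. The growth bound makes `u_r` bounded above on balls and bounded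
below at some point of the unit ball; the sub-mean inequality at that point then bounds `u_r` in
`L¹`. For precompactness, averages of an `L¹`-bounded family are equicontinuous, so Arzelà–Ascoli
applies to them. By the sub-mean inequality "average minus function" is nonnegative, so its `L¹`
norm is an integral without absolute value; moving the average onto a Lipschitz cutoff bounds it by
`s / R` times the `L¹` norm (`integral_abs_kernAvg_sub_le`). Averages are thus uniformly close to
the functions themselves.

The map `r ↦ u_r` is a continuous curve in `L¹_loc`, and the tangents are its cluster points as `r →
0`. They form a decreasing intersection of closures of images of intervals, which are compact and
connected, so this set is non-empty, compact and connected. Tangents inherit the sub-mean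
inequality, whence their pointwise representative is the infimum of their averages and lies in the
class. For flow invariance, dilating a convergent sequence `u_{a_j}` by `r` gives `u_{r a_j}` up to
an additive constant. The constant is identified by `U(0) = 0` when `p < 2`, and by the convergence
of maxima over balls when `p = 2`. -/

theorem posSemidef_of_dotProduct_nonneg {n : ℕ} {A : Matrix (Fin n) (Fin n) ℝ} (hs : A.IsSymm)
    (h : ∀ x : Fin n → ℝ, 0 ≤ x ⬝ᵥ A.mulVec x) : A.PosSemidef := by
  refine Matrix.PosSemidef.of_dotProduct_mulVec_nonneg ?_ (fun x => by simpa using h x)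
  rw [Matrix.IsHermitian, Matrix.conjTranspose_eq_transpose_of_trivial]
  exact hs

theorem lineProj_eq_vecMulVec {n : ℕ} (e : Eucl n) :
    lineProj e = Matrix.vecMulVec (e : Fin n → ℝ) (e : Fin n → ℝ) := by
  ext i j
  simp [lineProj, Matrix.vecMulVec]

theorem dotProduct_self_eq_norm_sq {n : ℕ} (x : Eucl n) :
    (x : Fin n → ℝ) ⬝ᵥ (x : Fin n → ℝ) = ‖x‖ ^ 2 := by
  rw [EuclideanSpace.norm_sq_eq]
  simp [dotProduct, sq]

namespace IsSubequation

variable {n : ℕ} {F : Set (Matrix (Fin n) (Fin n) ℝ)}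

/-- Every symmetric `A` is `c(-I) + (A + cI)`, with `A + cI ≥ 0` once `c` is the sum of the absolute
values of the entries. So `-I ∈ F` would give `F = Sym`. -/
theorem neg_one_notMem (hF : IsSubequation F) (hcone : HasConeProperty F) :
    (-1 : Matrix (Fin n) (Fin n) ℝ) ∉ F := by
  intro h
  obtain ⟨A, hAs, hA⟩ := hF.proper
  apply hA
  set c : ℝ := ∑ i, ∑ j, |A i j| with hc
  have hc0 : 0 ≤ c := by positivity
  have hpsd : (A + c • (1 : Matrix (Fin n) (Fin n) ℝ)).PosSemidef := by
    refine posSemidef_of_dotProduct_nonneg (hAs.add (Matrix.isSymm_one.smul c)) fun x => ?_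
    have hsq : ∀ i, x i ^ 2 ≤ x ⬝ᵥ x := fun i => by
      have := Finset.single_le_sum (f := fun i => x i * x i) (fun i _ => mul_self_nonneg _)
        (Finset.mem_univ i)
      simpa [dotProduct, sq] using this
    have hb : ∀ i j, -(|A i j| * (x ⬝ᵥ x)) ≤ x i * (A i j * x j) := fun i j => by
      have h1 : |x i * x j| ≤ x ⬝ᵥ x := by
        rw [abs_le]
        constructor <;> nlinarith [hsq i, hsq j, sq_nonneg (x i + x j), sq_nonneg (x i - x j)]
      have h2 : |x i * (A i j * x j)| ≤ |A i j| * (x ⬝ᵥ x) := by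
        rw [show x i * (A i j * x j) = A i j * (x i * x j) by ring, abs_mul]
        exact mul_le_mul_of_nonneg_left h1 (abs_nonneg _)
      exact (abs_le.1 h2).1
    have h3 : x ⬝ᵥ A.mulVec x = ∑ i, ∑ j, x i * (A i j * x j) := by
      simp [dotProduct, Matrix.mulVec, Finset.mul_sum]
    rw [Matrix.add_mulVec, dotProduct_add, Matrix.smul_mulVec, Matrix.one_mulVec, dotProduct_smul,
      smul_eq_mul, h3, hc, Finset.sum_mul, ← Finset.sum_add_distrib]
    refine Finset.sum_nonneg fun i _ => ?_
    rw [Finset.sum_mul, ← Finset.sum_add_distrib]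
    exact Finset.sum_nonneg fun j _ => by linarith [hb i j]
  have := hF.positivity _ (hcone c hc0 _ h) _ hpsd
  convert this using 1
  simp

theorem dim_ne_zero (hF : IsSubequation F) : n ≠ 0 := by
  rintro rfl
  obtain ⟨A, -, hA⟩ := hF.proper
  obtain ⟨B, hB⟩ := hF.nonempty
  exact hA (Subsingleton.elim B A ▸ hB)

end IsSubequation

/-! ### A `G`-invariant element and the trace inequality -/

section InvariantElement

variable {n : ℕ} {F : Set (Matrix (Fin n) (Fin n) ℝ)}

theorem sum_sq_eq_trace (B : Matrix (Fin n) (Fin n) ℝ) :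
    ∑ i, ∑ j, B i j ^ 2 = (B * B.transpose).trace := by
  simp [Matrix.trace, Matrix.mul_apply, sq]

theorem sum_sq_conj {g : Matrix (Fin n) (Fin n) ℝ} (hg : g.transpose * g = 1)
    (B : Matrix (Fin n) (Fin n) ℝ) :
    ∑ i, ∑ j, (g * B * g.transpose) i j ^ 2 = ∑ i, ∑ j, B i j ^ 2 := by
  rw [sum_sq_eq_trace, sum_sq_eq_trace]
  have : g * B * g.transpose * (g * B * g.transpose).transpose
      = g * (B * B.transpose * g.transpose) := by
    simp only [Matrix.transpose_mul, Matrix.transpose_transpose]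
    calc _ = g * B * (g.transpose * g) * (B.transpose * g.transpose) := by
          simp only [Matrix.mul_assoc]
      _ = _ := by rw [hg]; simp only [Matrix.mul_assoc, Matrix.one_mul]
  rw [this, Matrix.trace_mul_comm, Matrix.mul_assoc, hg, Matrix.mul_one]

theorem exists_sum_sq_minimizer {K : Set (Matrix (Fin n) (Fin n) ℝ)} (hK : IsClosed K)
    (hne : K.Nonempty) :
    ∃ B ∈ K, ∀ C ∈ K, ∑ i, ∑ j, B i j ^ 2 ≤ ∑ i, ∑ j, C i j ^ 2 := by
  obtain ⟨A, hA⟩ := hne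
  set f : Matrix (Fin n) (Fin n) ℝ → ℝ := fun B => ∑ i, ∑ j, B i j ^ 2 with hf
  have hfc : Continuous f := by
    refine continuous_finsetSum _ fun i _ => continuous_finsetSum _ fun j _ => ?_
    exact (continuous_id.matrix_elem i j).pow 2
  set c : ℝ := f A + 1 with hc
  have hcomp : IsCompact {B : Matrix (Fin n) (Fin n) ℝ | ∀ i ∈ (univ : Set (Fin n)),
      B i ∈ {b : Fin n → ℝ | ∀ j ∈ (univ : Set (Fin n)), b j ∈ Icc (-c) c}} :=
    isCompact_univ_pi fun i => isCompact_univ_pi fun j => isCompact_Icc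
  have hcl : IsClosed (K ∩ {B | f B ≤ f A}) := hK.inter (isClosed_le hfc continuous_const)
  have hsub : K ∩ {B | f B ≤ f A} ⊆ {B : Matrix (Fin n) (Fin n) ℝ | ∀ i ∈ (univ : Set (Fin n)),
      B i ∈ {b : Fin n → ℝ | ∀ j ∈ (univ : Set (Fin n)), b j ∈ Icc (-c) c}} := by
    rintro B ⟨-, hB⟩ i - j -
    have h1 : B i j ^ 2 ≤ f B := by
      calc B i j ^ 2 ≤ ∑ j, B i j ^ 2 :=
            Finset.single_le_sum (f := fun j => B i j ^ 2) (fun _ _ => sq_nonneg _)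
              (Finset.mem_univ j)
        _ ≤ f B := Finset.single_le_sum (f := fun i => ∑ j, B i j ^ 2)
            (fun _ _ => Finset.sum_nonneg fun _ _ => sq_nonneg _) (Finset.mem_univ i)
    have h2 : B i j ^ 2 ≤ f A := h1.trans hB
    have h3 : 0 ≤ f A := (sq_nonneg _).trans h2
    exact ⟨by nlinarith, by nlinarith⟩
  obtain ⟨B, ⟨hBK, hBA⟩, hB⟩ := (hcomp.of_isClosed_subset hcl hsub).exists_isMinOn
    ⟨A, hA, le_refl (f A)⟩ hfc.continuousOn
  refine ⟨B, hBK, fun C hC => ?_⟩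
  by_cases hCA : f C ≤ f A
  · exact hB ⟨hC, hCA⟩
  · exact (hBA.trans (not_le.1 hCA).le)

/-- Strict convexity, through the parallelogram identity at the midpoint. Uniqueness forces the
minimizer to be fixed by every norm-preserving symmetry of `K`; this replaces averaging over `G`,
which need not be closed. -/
theorem sum_sq_minimizer_unique {K : Set (Matrix (Fin n) (Fin n) ℝ)} (hK : Convex ℝ K)
    {B B' : Matrix (Fin n) (Fin n) ℝ} (hB : B ∈ K) (hB' : B' ∈ K)
    (hmin : ∀ C ∈ K, ∑ i, ∑ j, B i j ^ 2 ≤ ∑ i, ∑ j, C i j ^ 2)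
    (heq : ∑ i, ∑ j, B' i j ^ 2 = ∑ i, ∑ j, B i j ^ 2) : B' = B := by
  have hmid := hmin _ (hK hB hB' (by norm_num : (0 : ℝ) ≤ 1 / 2)
    (by norm_num : (0 : ℝ) ≤ 1 / 2) (by norm_num))
  have hid : ∑ i, ∑ j, ((1 / 2 : ℝ) • B + (1 / 2 : ℝ) • B') i j ^ 2
      = (∑ i, ∑ j, B i j ^ 2) / 2 + (∑ i, ∑ j, B' i j ^ 2) / 2
        - (∑ i, ∑ j, (B' i j - B i j) ^ 2) / 4 := by
    simp only [Finset.sum_div, ← Finset.sum_add_distrib, ← Finset.sum_sub_distrib]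
    refine Finset.sum_congr rfl fun i _ => Finset.sum_congr rfl fun j _ => ?_
    simp only [Matrix.add_apply, Matrix.smul_apply, smul_eq_mul]
    ring
  have hz : ∑ i, ∑ j, (B' i j - B i j) ^ 2 ≤ 0 := by linarith
  ext i j
  have h1 : (B' i j - B i j) ^ 2 ≤ ∑ i, ∑ j, (B' i j - B i j) ^ 2 :=
    (Finset.single_le_sum (f := fun j => (B' i j - B i j) ^ 2) (fun _ _ => sq_nonneg _)
      (Finset.mem_univ j)).trans
    (Finset.single_le_sum (f := fun i => ∑ j, (B' i j - B i j) ^ 2)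
      (fun _ _ => Finset.sum_nonneg fun _ _ => sq_nonneg _) (Finset.mem_univ i))
  have h2 : (B' i j - B i j) ^ 2 = 0 := le_antisymm (h1.trans hz) (sq_nonneg _)
  exact sub_eq_zero.1 (pow_eq_zero_iff two_ne_zero |>.1 h2)

theorem orthogonalGroup_transpose_mul_self (g : Matrix.orthogonalGroup (Fin n) ℝ) :
    (g : Matrix (Fin n) (Fin n) ℝ).transpose * g = 1 := by
  have := (Matrix.mem_orthogonalGroup_iff' (Fin n) ℝ).1 g.2
  simpa [Matrix.star_eq_conjTranspose] using this

/-- A convex spherically transitive cone subequation lies in the Laplacian half-space. -/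
theorem IsSubequation.trace_nonneg (hF : IsSubequation F) (hcone : HasConeProperty F)
    (hST : IsSTInvariant F) (hconv : Convex ℝ F) {A : Matrix (Fin n) (Fin n) ℝ} (hA : A ∈ F) :
    0 ≤ A.trace := by
  obtain ⟨G, hG, hGF⟩ := hST
  have hn : 0 < n := Nat.pos_of_ne_zero hF.dim_ne_zero
  by_contra hneg
  -- Fixing the trace keeps the minimizer away from `0`; conjugation by `G` preserves this slice.
  set K : Set (Matrix (Fin n) (Fin n) ℝ) := F ∩ {B | B.trace = A.trace} with hKdef
  have hKcl : IsClosed K := hF.isClosed.inter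
    (isClosed_eq (continuous_id.matrix_trace) continuous_const)
  have hKconv : Convex ℝ K := by
    refine hconv.inter ?_
    intro B hB C hC a b ha hb hab
    simp only [mem_ofPred_eq] at hB hC ⊢
    rw [Matrix.trace_add, Matrix.trace_smul, Matrix.trace_smul, hB, hC, ← add_smul, hab, one_smul]
  obtain ⟨B, hBK, hBmin⟩ := exists_sum_sq_minimizer hKcl ⟨A, hA, rfl⟩
  have hinv : ∀ g ∈ G, (g : Matrix (Fin n) (Fin n) ℝ) * B *
      (g : Matrix (Fin n) (Fin n) ℝ).transpose = B := by
    intro g hg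
    have hgg := orthogonalGroup_transpose_mul_self g
    refine sum_sq_minimizer_unique hKconv hBK ⟨hGF g hg B hBK.1, ?_⟩ hBmin (sum_sq_conj hgg B)
    simp only [mem_ofPred_eq]
    rw [Matrix.mul_assoc, Matrix.trace_mul_comm, Matrix.mul_assoc, hgg, Matrix.mul_one]
    exact hBK.2
  -- Since `gᵀ B g = B` and `G` is transitive, the quadratic form of `B` is constant on the unit
  -- sphere.
  have hquad : ∀ x y : Eucl n, ‖x‖ = 1 → ‖y‖ = 1 →
      (y : Fin n → ℝ) ⬝ᵥ B.mulVec y = (x : Fin n → ℝ) ⬝ᵥ B.mulVec x := by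
    intro x y hx hy
    obtain ⟨g, hg, hgx⟩ := hG x y hx hy
    have hgx' : (y : Fin n → ℝ) = (g : Matrix (Fin n) (Fin n) ℝ).mulVec x := by
      rw [← hgx]; rfl
    have hgg := orthogonalGroup_transpose_mul_self g
    have h2 : (g : Matrix (Fin n) (Fin n) ℝ).transpose * B * g = B := by
      conv_lhs => rw [← hinv g hg]
      calc _ = (g : Matrix (Fin n) (Fin n) ℝ).transpose * g * B *
            ((g : Matrix (Fin n) (Fin n) ℝ).transpose * g) := by
              simp only [Matrix.mul_assoc]
        _ = B := by rw [hgg]; simp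
    rw [hgx', Matrix.mulVec_mulVec, ← Matrix.vecMul_transpose, ← Matrix.dotProduct_mulVec,
      Matrix.mulVec_mulVec, ← Matrix.mul_assoc, h2]
  set i₀ : Fin n := ⟨0, hn⟩
  set c := B i₀ i₀ with hc
  have hdiag : ∀ i, B i i = c := by
    intro i
    have := hquad (EuclideanSpace.single i₀ 1) (EuclideanSpace.single i 1) (by simp) (by simp)
    simpa using this
  have htr : B.trace = n * c := by
    simp [Matrix.trace, hdiag]
  have hcneg : c < 0 := by
    have : (n : ℝ) * c < 0 := by rw [← htr, hBK.2]; exact not_le.1 hneg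
    have hn' : (0 : ℝ) < n := by exact_mod_cast hn
    by_contra h
    exact absurd this (not_lt.2 (mul_nonneg hn'.le (not_lt.1 h)))
  have hpsd : (c • (1 : Matrix (Fin n) (Fin n) ℝ) - B).PosSemidef := by
    refine posSemidef_of_dotProduct_nonneg ((Matrix.isSymm_one.smul c).sub (hF.isSymm B hBK.1))
      fun x => ?_
    rw [Matrix.sub_mulVec, Matrix.smul_mulVec, Matrix.one_mulVec, dotProduct_sub, dotProduct_smul]
    by_cases hx : x = 0
    · simp [hx]
    set X : Eucl n := WithLp.toLp 2 x with hXdef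
    have hX0 : X ≠ 0 := by
      intro h; apply hx
      have := congrArg WithLp.ofLp h
      simpa [hXdef] using this
    have hXn : ‖X‖ ≠ 0 := norm_ne_zero_iff.2 hX0
    have h1 := hquad (EuclideanSpace.single i₀ 1) (‖X‖⁻¹ • X) (by simp)
      (by rw [norm_smul, norm_inv, norm_norm, inv_mul_cancel₀ hXn])
    have h2 : (EuclideanSpace.single i₀ (1 : ℝ) : Fin n → ℝ) ⬝ᵥ
        B.mulVec (EuclideanSpace.single i₀ (1 : ℝ) : Eucl n) = c := by simp [hc]
    rw [h2] at h1
    have h3 : x ⬝ᵥ x = ‖X‖ ^ 2 := dotProduct_self_eq_norm_sq X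
    have h4 : ((‖X‖⁻¹ • X : Eucl n) : Fin n → ℝ) = ‖X‖⁻¹ • x := rfl
    rw [h4, Matrix.mulVec_smul, dotProduct_smul, smul_dotProduct] at h1
    simp only [smul_eq_mul] at h1 ⊢
    rw [h3, ← h1]
    field_simp
    simp
  -- Positivity moves `B` up to `cI`; as `c < 0`, rescaling by the cone property gives `-I ∈ F`.
  have hcI : c • (1 : Matrix (Fin n) (Fin n) ℝ) ∈ F := by
    have := hF.positivity B hBK.1 _ hpsd
    simpa using this
  have h1 := hcone (-c)⁻¹ (inv_nonneg.2 (by linarith)) _ hcI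
  rw [smul_smul, inv_neg, neg_mul, inv_mul_cancel₀ hcneg.ne, neg_one_smul] at h1
  exact hF.neg_one_notMem hcone h1

end InvariantElement

/-! ### The Riesz characteristic -/

section RieszCharacteristic

variable {n : ℕ} {F : Set (Matrix (Fin n) (Fin n) ℝ)}

theorem lineProj_trace {e : Eucl n} (he : ‖e‖ = 1) : (lineProj e).trace = 1 := by
  have := dotProduct_self_eq_norm_sq e
  rw [he, one_pow] at this
  simpa [Matrix.trace, lineProj, dotProduct] using this

/-- The matrices in question have trace `n - q`, which must be nonnegative. Boundedness makes the
real `sSup` in `rieszChar` meaningful. -/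
theorem bddAbove_rieszSet (hF : IsSubequation F) (hcone : HasConeProperty F)
    (hST : IsSTInvariant F) (hconv : Convex ℝ F) :
    BddAbove {q : ℝ | ∀ e : Eucl n, ‖e‖ = 1 → (1 - lineProj e) - (q - 1) • lineProj e ∈ F} := by
  refine ⟨n, fun q hq => ?_⟩
  have hn : 0 < n := Nat.pos_of_ne_zero hF.dim_ne_zero
  have he : ‖(EuclideanSpace.single (⟨0, hn⟩ : Fin n) (1 : ℝ) : Eucl n)‖ = 1 := by simp
  have := hF.trace_nonneg hcone hST hconv (hq _ he)
  rw [Matrix.trace_sub, Matrix.trace_sub, Matrix.trace_smul, lineProj_trace he, Matrix.trace_one,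
    Fintype.card_fin] at this
  simp only [smul_eq_mul, mul_one] at this
  linarith

theorem lineProj_conj {g : Matrix (Fin n) (Fin n) ℝ} {e e' : Eucl n}
    (h : Matrix.toEuclideanLin g e = e') : g * lineProj e * g.transpose = lineProj e' := by
  have h' : (e' : Fin n → ℝ) = g.mulVec e := by rw [← h]; rfl
  rw [lineProj_eq_vecMulVec, lineProj_eq_vecMulVec, h', Matrix.mul_vecMulVec,
    Matrix.vecMulVec_mul, Matrix.vecMul_transpose]

/-- Transitivity spreads membership at a single direction to all directions, so exclusion from the
supremum set yields exclusion at each `e` separately. -/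
theorem notMem_of_rieszChar_lt (hF : IsSubequation F) (hcone : HasConeProperty F)
    (hST : IsSTInvariant F) (hconv : Convex ℝ F) {q : ℝ} (hq : rieszChar F < q)
    {e : Eucl n} (he : ‖e‖ = 1) : (1 - lineProj e) - (q - 1) • lineProj e ∉ F := by
  intro hmem
  have h1 := notMem_of_csSup_lt hq (bddAbove_rieszSet hF hcone hST hconv)
  apply h1
  intro e' he'
  obtain ⟨G, hG, hGF⟩ := hST
  obtain ⟨g, hg, hge⟩ := hG e e' he he'
  have h2 := hGF g hg _ hmem
  have hgg : (g : Matrix (Fin n) (Fin n) ℝ) * (g : Matrix (Fin n) (Fin n) ℝ).transpose = 1 := by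
    have := (Matrix.mem_orthogonalGroup_iff (Fin n) ℝ).1 g.2
    simpa [Matrix.star_eq_conjTranspose] using this
  rw [Matrix.mul_sub, Matrix.mul_sub, Matrix.sub_mul, Matrix.sub_mul, Matrix.mul_one, hgg,
    lineProj_conj hge, Matrix.mul_smul, Matrix.smul_mul, lineProj_conj hge] at h2
  exact h2

end RieszCharacteristic
end

/-! ### Comparison with strict test functions -/

noncomputable section

section Comparison

variable {n : ℕ} {F : Set (Matrix (Fin n) (Fin n) ℝ)} {u : Eucl n → EReal} {X : Set (Eucl n)}

theorem hessian_add_const (φ : Eucl n → ℝ) (c : ℝ) (x : Eucl n) :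
    hessian (fun y => φ y + c) x = hessian φ x := by
  have : fderiv ℝ (fun y => φ y + c) = fderiv ℝ φ := by
    funext y
    exact fderiv_add_const c
  simp only [hessian, this]

theorem UpperSemicontinuousOn.sub_coe {α : Type*} [TopologicalSpace α] {f : α → EReal}
    {K : Set α} {φ : α → ℝ} (hf : UpperSemicontinuousOn f K) (hφ : ContinuousOn φ K) :
    UpperSemicontinuousOn (fun x => f x - (φ x : EReal)) K := by
  have h : UpperSemicontinuousOn (fun x => ((-φ x : ℝ) : EReal)) K :=
    ContinuousOn.upperSemicontinuousOn
      (continuous_coe_real_ereal.comp_continuousOn hφ.neg)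
  have := UpperSemicontinuousOn.add' hf h (fun x _ => EReal.continuousAt_add
    (Or.inr (EReal.coe_ne_bot _)) (Or.inr (EReal.coe_ne_top _)))
  simpa [sub_eq_add_neg] using this

/-- A strict (that is, nowhere subharmonic) `C²` function which dominates a subharmonic function
on the boundary dominates it inside. -/
theorem IsSubharmonicOn.le_of_hessian_notMem (hu : IsSubharmonicOn F u X) {K D : Set (Eucl n)}
    (hK : IsCompact K) (hKX : K ⊆ X) (hD : IsOpen D) (hDK : D ⊆ K) {φ : Eucl n → ℝ}
    (hφ : ContinuousOn φ K) (hC2 : ∀ x ∈ D, ContDiffAt ℝ 2 φ x)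
    (hess : ∀ x ∈ D, hessian φ x ∉ F) (hbd : ∀ x ∈ K, x ∉ D → u x ≤ (φ x : EReal))
    {x : Eucl n} (hx : x ∈ K) : u x ≤ (φ x : EReal) := by
  by_contra hlt
  rw [not_le] at hlt
  obtain ⟨x₀, hx₀, hmax⟩ := UpperSemicontinuousOn.exists_isMaxOn ⟨x, hx⟩ hK
    ((hu.usc.mono hKX).sub_coe hφ)
  have hpos : 0 < u x₀ - (φ x₀ : EReal) := by
    refine lt_of_lt_of_le ?_ (hmax hx)
    exact EReal.sub_pos.2 hlt
  have hlt₀ : (φ x₀ : EReal) < u x₀ := EReal.sub_pos.1 hpos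
  have hx₀D : x₀ ∈ D := by
    by_contra h
    exact absurd (hbd x₀ hx₀ h) (not_le.2 hlt₀)
  have hutop : u x₀ ≠ ⊤ := (hu.lt_top x₀ (hKX hx₀)).ne
  have hubot : u x₀ ≠ ⊥ := (bot_le.trans_lt hlt₀).ne'
  -- At a positive maximum `x₀` of `u - φ`, which cannot lie on the boundary, the shifted function
  -- `φ + c` touches `u` from above.
  set c : ℝ := (u x₀).toReal - φ x₀ with hc
  have hux₀ : u x₀ = ((φ x₀ + c : ℝ) : EReal) := by
    rw [hc, add_sub_cancel, EReal.coe_toReal hutop hubot]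
  refine hess x₀ hx₀D ?_
  rw [← hessian_add_const φ c]
  refine hu.viscosity x₀ (hKX hx₀) _ ((hC2 x₀ hx₀D).add contDiffAt_const) ?_ hux₀
  filter_upwards [hD.mem_nhds hx₀D] with y hy
  have h1 : u y - (φ y : EReal) ≤ u x₀ - (φ x₀ : EReal) := hmax (hDK hy)
  rw [hux₀, ← EReal.coe_sub, add_sub_cancel_left] at h1
  have h2 := EReal.sub_le_iff_le_add (Or.inl (EReal.coe_ne_bot (φ y)))
    (Or.inl (EReal.coe_ne_top (φ y))) |>.1 h1
  rwa [add_comm, ← EReal.coe_add] at h2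

end Comparison

/-! ### Radial functions and the Riesz profile -/

section Radial

variable {n : ℕ}

/-- Radial powers are written through `‖y‖ ^ 2`, which is smooth with a linear derivative, so that
two differentiations are the chain rule. -/
theorem hasFDerivAt_norm_sq_rpow (m : ℝ) {x : Eucl n} (hx : x ≠ 0) :
    HasFDerivAt (fun y : Eucl n => (‖y‖ ^ 2) ^ m)
      ((m * (‖x‖ ^ 2) ^ (m - 1) * 2) • innerSL ℝ x) x := by
  have h := (hasStrictFDerivAt_norm_sq x).hasFDerivAt
  have hpos : (‖x‖ ^ 2 : ℝ) ≠ 0 := pow_ne_zero _ (norm_ne_zero_iff.2 hx)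
  have := h.rpow_const (p := m) (Or.inl hpos)
  rwa [← Nat.cast_smul_eq_nsmul ℝ, smul_smul, Nat.cast_ofNat] at this

theorem hessian_norm_sq_rpow (a m : ℝ) {x : Eucl n} (hx : x ≠ 0) (i j : Fin n) :
    hessian (fun y : Eucl n => a * (‖y‖ ^ 2) ^ m) x i j =
      2 * a * m * (‖x‖ ^ 2) ^ (m - 1) *
        ((1 : Matrix (Fin n) (Fin n) ℝ) i j + 2 * (m - 1) * (x i * x j / ‖x‖ ^ 2)) := by
  have hn : (0 : ℝ) < ‖x‖ ^ 2 := by positivity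
  have hev : fderiv ℝ (fun y : Eucl n => a * (‖y‖ ^ 2) ^ m) =ᶠ[𝓝 x]
      fun y => (2 * a * m * (‖y‖ ^ 2) ^ (m - 1)) • innerSL ℝ y := by
    filter_upwards [isOpen_ne.mem_nhds hx] with y hy
    rw [((hasFDerivAt_norm_sq_rpow m hy).const_mul a).fderiv, smul_smul]
    congr 1
    ring
  let B : Eucl n →L[ℝ] Eucl n →L[ℝ] ℝ :=
    (isBoundedBilinearMap_inner (𝕜 := ℝ) (E := Eucl n)).toContinuousLinearMap
  have hB : ∀ y : Eucl n, innerSL ℝ y = B y := fun y => rfl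
  have h2 : HasFDerivAt (fun y : Eucl n => (2 * a * m * (‖y‖ ^ 2) ^ (m - 1)) • innerSL ℝ y)
      ((2 * a * m * (‖x‖ ^ 2) ^ (m - 1)) • B +
        ((2 * a * m) • (((m - 1) * (‖x‖ ^ 2) ^ (m - 1 - 1) * 2) • innerSL ℝ x)).smulRight
          (innerSL ℝ x)) x := by
    have hc := (hasFDerivAt_norm_sq_rpow (m - 1) hx).const_mul (2 * a * m)
    exact hc.smul B.hasFDerivAt
  have hpow : (‖x‖ ^ 2) ^ (m - 1 - 1) = (‖x‖ ^ 2) ^ (m - 1) / ‖x‖ ^ 2 :=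
    Real.rpow_sub_one hn.ne' (m - 1)
  simp only [hessian, Matrix.of_apply]
  rw [hev.fderiv_eq, h2.fderiv, hpow]
  have hone : inner ℝ (EuclideanSpace.single i (1 : ℝ) : Eucl n) (EuclideanSpace.single j 1) =
      (1 : Matrix (Fin n) (Fin n) ℝ) i j := by
    simp [Matrix.one_apply, EuclideanSpace.inner_single_left]
  simp only [add_apply, smul_apply,
    ContinuousLinearMap.smulRight_apply, ← hB, innerSL_apply_apply, hone, smul_eq_mul,
    EuclideanSpace.inner_single_right]
  simp
  field_simp

theorem contDiffAt_norm_sq_rpow (a m : ℝ) {x : Eucl n} (hx : x ≠ 0) :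
    ContDiffAt ℝ 2 (fun y : Eucl n => a * (‖y‖ ^ 2) ^ m) x :=
  contDiffAt_const.mul ((contDiff_norm_sq ℝ).contDiffAt.rpow_const_of_ne
    (pow_ne_zero _ (norm_ne_zero_iff.2 hx)))

/-- With `e = x / ‖x‖`, the Hessian is a positive multiple of `I - q P_e = P_{e^⊥} - (q - 1) P_e`.
The cone property removes the factor. -/
theorem hessian_norm_sq_rpow_notMem {F : Set (Matrix (Fin n) (Fin n) ℝ)} (hF : IsSubequation F)
    (hcone : HasConeProperty F) (hST : IsSTInvariant F) (hconv : Convex ℝ F) {q : ℝ}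
    (hq : rieszChar F < q) (hq2 : q ≠ 2) {α : ℝ} (hα : 0 < α) {x : Eucl n} (hx : x ≠ 0) :
    hessian (fun y : Eucl n => α / (2 - q) * (‖y‖ ^ 2) ^ ((2 - q) / 2)) x ∉ F := by
  have hx' : ‖x‖ ≠ 0 := norm_ne_zero_iff.2 hx
  have he : ‖(‖x‖⁻¹ • x : Eucl n)‖ = 1 := by
    rw [norm_smul, norm_inv, norm_norm, inv_mul_cancel₀ hx']
  intro hmem
  apply notMem_of_rieszChar_lt hF hcone hST hconv hq he
  set c : ℝ := α * (‖x‖ ^ 2) ^ ((2 - q) / 2 - 1) with hc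
  have hcpos : 0 < c := by positivity
  have := hcone c⁻¹ (inv_nonneg.2 hcpos.le) _ hmem
  convert this using 1
  have hq' : (2 - q) ≠ 0 := sub_ne_zero.2 (Ne.symm hq2)
  ext i j
  rw [Matrix.smul_apply, hessian_norm_sq_rpow _ _ hx]
  have h1 : 2 * (α / (2 - q)) * ((2 - q) / 2) * (‖x‖ ^ 2) ^ ((2 - q) / 2 - 1) = c := by
    rw [hc]; field_simp
  rw [h1, smul_eq_mul, ← mul_assoc, inv_mul_cancel₀ hcpos.ne', one_mul]
  simp only [Matrix.sub_apply, Matrix.smul_apply, lineProj, Matrix.of_apply, smul_eq_mul,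
    PiLp.smul_apply]
  field_simp
  ring

end Radial

/-- The increasing radial profile of the Riesz kernel. -/
def rieszProfile (p t : ℝ) : ℝ := if p = 2 then Real.log t else t ^ (2 - p) / (2 - p)

theorem rieszProfile_strictMono (p : ℝ) {a b : ℝ} (ha : 0 < a) (hab : a < b) :
    rieszProfile p a < rieszProfile p b := by
  unfold rieszProfile
  split_ifs with h
  · exact Real.log_lt_log ha hab
  · rcases lt_or_gt_of_ne h with h | h
    · exact div_lt_div_of_pos_right (Real.rpow_lt_rpow ha.le hab (by linarith)) (by linarith)
    · exact div_lt_div_of_neg_of_lt (by linarith) (Real.rpow_lt_rpow_of_neg ha hab (by linarith))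

/-- Only differences of profiles converge: at `p = 2` each profile blows up, but `(t^(2-q) -
1)/(2-q)` is a difference quotient of `h ↦ t^h` at `0` and tends to `log t`. The logarithmic case
thus follows from the power case by a limit. -/
theorem tendsto_rieszProfile_sub (p : ℝ) {a b : ℝ} (ha : 0 < a) (hb : 0 < b) :
    Tendsto (fun q => rieszProfile q b - rieszProfile q a) (𝓝[>] p)
      (𝓝 (rieszProfile p b - rieszProfile p a)) := by
  by_cases hp : p = 2
  · subst hp
    have key : ∀ t : ℝ, 0 < t → Tendsto (fun q : ℝ => (t ^ (2 - q) - 1) / (2 - q)) (𝓝[>] 2)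
        (𝓝 (Real.log t)) := by
      intro t ht
      have h1 : HasDerivAt (fun h : ℝ => t ^ h) (Real.log t) 0 := by
        simpa using Real.hasStrictDerivAt_const_rpow ht 0 |>.hasDerivAt
      have h2 := h1.tendsto_slope
      have h3 : Tendsto (fun q : ℝ => 2 - q) (𝓝[>] 2) (𝓝[≠] 0) := by
        refine tendsto_nhdsWithin_iff.2 ⟨?_, ?_⟩
        · have : Tendsto (fun q : ℝ => 2 - q) (𝓝 2) (𝓝 (2 - 2)) :=
            (continuous_const.sub continuous_id).tendsto 2
          rw [sub_self] at this
          exact this.mono_left nhdsWithin_le_nhds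
        · filter_upwards [self_mem_nhdsWithin] with q hq
          exact sub_ne_zero.2 (ne_of_lt hq)
      refine (h2.comp h3).congr fun q => ?_
      simp [slope_def_field]
    have := (key b hb).sub (key a ha)
    simp only [rieszProfile, if_true]
    refine this.congr' ?_
    filter_upwards [self_mem_nhdsWithin] with q hq
    rw [if_neg (ne_of_gt hq), if_neg (ne_of_gt hq)]
    ring
  · have hcont : ∀ t : ℝ, 0 < t → ContinuousAt (fun q : ℝ => t ^ (2 - q) / (2 - q)) p := by
      intro t ht
      refine ContinuousAt.div ?_ (by fun_prop) (sub_ne_zero.2 (Ne.symm hp))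
      exact ContinuousAt.rpow continuousAt_const (by fun_prop) (Or.inl ht.ne')
    have h1 : Tendsto (fun q : ℝ => b ^ (2 - q) / (2 - q) - a ^ (2 - q) / (2 - q)) (𝓝[>] p)
        (𝓝 (b ^ (2 - p) / (2 - p) - a ^ (2 - p) / (2 - p))) :=
      ((hcont b hb).sub (hcont a ha)).tendsto.mono_left nhdsWithin_le_nhds
    simp only [rieszProfile, if_neg hp]
    refine h1.congr' ?_
    filter_upwards [nhdsWithin_le_nhds (isOpen_ne.mem_nhds hp)] with q hq
    rw [if_neg hq, if_neg hq]

/-! ### Convexity of the maximum over balls in the Riesz profile -/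

section MaxBall

variable {n : ℕ} {F : Set (Matrix (Fin n) (Fin n) ℝ)} {u : Eucl n → EReal} {X : Set (Eucl n)}

theorem le_maxBall {r : ℝ} {x : Eucl n} (hx : ‖x‖ ≤ r) : u x ≤ maxBall u r :=
  le_iSup₂_of_le x (mem_closedBall_zero_iff.2 hx) le_rfl

theorem maxBall_le {r : ℝ} {c : EReal} (h : ∀ x : Eucl n, ‖x‖ ≤ r → u x ≤ c) : maxBall u r ≤ c :=
  iSup₂_le fun x hx => h x (mem_closedBall_zero_iff.1 hx)

theorem maxBall_mono {r s : ℝ} (h : r ≤ s) : maxBall u r ≤ maxBall u s :=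
  maxBall_le fun _ hx => le_maxBall (hx.trans h)

/-- On the annulus `a ≤ ‖y‖ ≤ c`, `u` is compared with the radial function equal to `ma` on the
inner sphere and `mc` on the outer one. Because `q` exceeds the characteristic, that function is
strict. -/
theorem three_point_of_rieszChar_lt (hF : IsSubequation F) (hcone : HasConeProperty F)
    (hST : IsSTInvariant F) (hconv : Convex ℝ F) (hu : IsSubharmonicOn F u X) {q : ℝ}
    (hq : rieszChar F < q) (hq2 : q ≠ 2) {a b c ma mb mc : ℝ} (ha : 0 < a) (hab : a < b)
    (hbc : b < c) (hX : closedBall 0 c ⊆ X) (hma : maxBall u a = ma) (hmb : maxBall u b = mb)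
    (hmc : maxBall u c = mc) :
    (mb - ma) * (rieszProfile q c - rieszProfile q a) ≤
      (mc - ma) * (rieszProfile q b - rieszProfile q a) := by
  have hac : ma ≤ mc := by
    rw [← EReal.coe_le_coe_iff, ← hma, ← hmc]; exact maxBall_mono (hab.trans hbc).le
  have hbc' : mb ≤ mc := by
    rw [← EReal.coe_le_coe_iff, ← hmb, ← hmc]; exact maxBall_mono hbc.le
  have hkab := rieszProfile_strictMono q ha hab
  have hkac := rieszProfile_strictMono q ha (hab.trans hbc)
  -- When `ma = mc` the comparison function would be constant, hence not strict; monotonicity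
  -- settles this case.
  rcases hac.eq_or_lt with hEq | hlt
  · rw [hEq, sub_self, zero_mul]
    exact mul_nonpos_of_nonpos_of_nonneg (by linarith) (by linarith)
  set α : ℝ := (mc - ma) / (rieszProfile q c - rieszProfile q a) with hα
  have hαpos : 0 < α := div_pos (by linarith) (by linarith)
  set φ : Eucl n → ℝ := fun y => α / (2 - q) * (‖y‖ ^ 2) ^ ((2 - q) / 2) +
    (ma - α * rieszProfile q a) with hφ
  have hφval : ∀ y : Eucl n, φ y = α * rieszProfile q ‖y‖ + (ma - α * rieszProfile q a) := by
    intro y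
    simp only [hφ, rieszProfile, if_neg hq2]
    rw [← Real.rpow_natCast, ← Real.rpow_mul (norm_nonneg y)]
    rw [show ((2 : ℕ) : ℝ) * ((2 - q) / 2) = 2 - q by push_cast; ring]
    ring
  set K : Set (Eucl n) := {y | a ≤ ‖y‖ ∧ ‖y‖ ≤ c} with hKdef
  set D : Set (Eucl n) := {y | a < ‖y‖ ∧ ‖y‖ < c} with hDdef
  have hKcl : IsClosed K :=
    (isClosed_le continuous_const continuous_norm).inter
      (isClosed_le continuous_norm continuous_const)
  have hKball : K ⊆ closedBall 0 c := fun y hy => mem_closedBall_zero_iff.2 hy.2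
  have hKc : IsCompact K := (isCompact_closedBall _ _).of_isClosed_subset hKcl hKball
  have hDo : IsOpen D :=
    (isOpen_lt continuous_const continuous_norm).inter
      (isOpen_lt continuous_norm continuous_const)
  have hne : ∀ y ∈ K, y ≠ 0 := by
    rintro y hy rfl
    have := hy.1
    rw [norm_zero] at this
    exact absurd this (not_le.2 ha)
  have hDK : D ⊆ K := fun y hy => ⟨hy.1.le, hy.2.le⟩
  have hC2 : ∀ y ∈ K, ContDiffAt ℝ 2 φ y := fun y hy =>
    (contDiffAt_norm_sq_rpow _ _ (hne y hy)).add contDiffAt_const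
  have hcomp : ∀ y ∈ K, u y ≤ (φ y : EReal) := by
    intro y hy
    refine hu.le_of_hessian_notMem hKc (hKball.trans hX) hDo hDK
      (fun z hz => (hC2 z hz).continuousAt.continuousWithinAt) (fun z hz => hC2 z (hDK hz)) ?_ ?_ hy
    · intro z hz
      rw [hφ, hessian_add_const]
      exact hessian_norm_sq_rpow_notMem hF hcone hST hconv hq hq2 hαpos (hne z (hDK hz))
    · intro z hz hzD
      rcases hz.1.eq_or_lt with h1 | h1
      · refine (le_maxBall h1.ge).trans ?_
        rw [hma, hφval, ← h1]
        simp
      · have h2 : ‖z‖ = c := le_antisymm hz.2 (not_lt.1 fun h => hzD ⟨h1, h⟩)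
        refine (le_maxBall hz.2).trans ?_
        rw [hmc, hφval, h2, EReal.coe_le_coe_iff]
        have : α * (rieszProfile q c - rieszProfile q a) = mc - ma := by
          rw [hα]; exact div_mul_cancel₀ _ (sub_pos.2 hkac).ne'
        linarith
  have hmbφ : mb ≤ α * (rieszProfile q b - rieszProfile q a) + ma := by
    rw [← EReal.coe_le_coe_iff, ← hmb]
    refine maxBall_le fun y hy => ?_
    -- `maxBall` is a supremum over the whole ball, so points inside the annulus's hole are bounded
    -- by `ma`.
    rcases le_or_gt a ‖y‖ with h | h
    · refine (hcomp y ⟨h, hy.trans hbc.le⟩).trans ?_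
      rw [hφval, EReal.coe_le_coe_iff]
      have : rieszProfile q ‖y‖ ≤ rieszProfile q b := by
        rcases hy.eq_or_lt with h' | h'
        · rw [h']
        · exact (rieszProfile_strictMono q (ha.trans_le h) h').le
      nlinarith
    · refine (le_maxBall h.le).trans ?_
      rw [hma, EReal.coe_le_coe_iff]
      nlinarith
  calc (mb - ma) * (rieszProfile q c - rieszProfile q a)
      ≤ (α * (rieszProfile q b - rieszProfile q a)) * (rieszProfile q c - rieszProfile q a) :=
        mul_le_mul_of_nonneg_right (by linarith) (by linarith)
    _ = (mc - ma) * (rieszProfile q b - rieszProfile q a) := by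
        rw [mul_right_comm, hα, div_mul_cancel₀ _ (sub_pos.2 hkac).ne']

/-- The maximum over balls is a convex function of the Riesz profile. -/
theorem three_point_rieszChar (hF : IsSubequation F) (hcone : HasConeProperty F)
    (hST : IsSTInvariant F) (hconv : Convex ℝ F) (hu : IsSubharmonicOn F u X)
    {a b c ma mb mc : ℝ} (ha : 0 < a) (hab : a < b)
    (hbc : b < c) (hX : closedBall 0 c ⊆ X) (hma : maxBall u a = ma) (hmb : maxBall u b = mb)
    (hmc : maxBall u c = mc) :
    (mb - ma) * (rieszProfile (rieszChar F) c - rieszProfile (rieszChar F) a) ≤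
      (mc - ma) * (rieszProfile (rieszChar F) b - rieszProfile (rieszChar F) a) := by
  have hc : 0 < c := (ha.trans hab).trans hbc
  refine le_of_tendsto_of_tendsto
    ((tendsto_rieszProfile_sub (rieszChar F) ha hc).const_mul (mb - ma))
    ((tendsto_rieszProfile_sub (rieszChar F) ha (ha.trans hab)).const_mul (mc - ma)) ?_
  have hne : ∀ᶠ q : ℝ in 𝓝[>] rieszChar F, q ≠ 2 := by
    rcases eq_or_ne (rieszChar F) 2 with h | h
    · filter_upwards [self_mem_nhdsWithin] with q hq
      rw [h] at hq
      exact ne_of_gt hq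
    · exact nhdsWithin_le_nhds (isOpen_ne.mem_nhds h)
  filter_upwards [self_mem_nhdsWithin, hne] with q hq hq2
  exact three_point_of_rieszChar_lt hF hcone hST hconv hu hq hq2 ha hab hbc hX hma hmb hmc

/-- The growth of the maximum over balls is controlled by the Riesz profile. -/
theorem exists_growth_bound (hF : IsSubequation F) (hcone : HasConeProperty F)
    (hST : IsSTInvariant F) (hconv : Convex ℝ F) (hu : IsSubharmonicOn F u X) {ρ : ℝ}
    (hρ : 0 < ρ) (hX : closedBall 0 (2 * ρ) ⊆ X) {m : ℝ → ℝ}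
    (hm : ∀ r, 0 < r → r ≤ 2 * ρ → maxBall u r = m r) :
    ∃ Λ : ℝ, 0 ≤ Λ ∧ ∀ a b, 0 < a → a ≤ b → b ≤ ρ →
      m b - m a ≤ Λ * (rieszProfile (rieszChar F) b - rieszProfile (rieszChar F) a) := by
  set p := rieszChar F with hp
  have hk := fun {s t : ℝ} => rieszProfile_strictMono (a := s) (b := t) p
  have slope : ∀ a b c, 0 < a → a < b → b < c → c ≤ 2 * ρ →
      (m b - m a) * (rieszProfile p c - rieszProfile p b) ≤
        (m c - m b) * (rieszProfile p b - rieszProfile p a) := by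
    intro a b c ha hab hbc hc
    have := three_point_rieszChar hF hcone hST hconv hu ha hab hbc
      ((closedBall_subset_closedBall hc).trans hX) (hm a ha (by linarith))
      (hm b (ha.trans hab) (by linarith)) (hm c (by linarith) hc)
    rw [← hp] at this
    linarith
  have hkρ := hk hρ (show ρ < 2 * ρ by linarith)
  -- The slope of the chord over `[ρ, 2ρ]`; by convexity every chord to its left has a smaller
  -- slope.
  set Λ : ℝ := (m (2 * ρ) - m ρ) / (rieszProfile p (2 * ρ) - rieszProfile p ρ) with hΛ
  have hmono : m ρ ≤ m (2 * ρ) := by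
    rw [← EReal.coe_le_coe_iff, ← hm ρ hρ (by linarith), ← hm (2 * ρ) (by linarith) le_rfl]
    exact maxBall_mono (by linarith)
  have hΛ0 : 0 ≤ Λ := div_nonneg (by linarith) (by linarith)
  have hΛmul : Λ * (rieszProfile p (2 * ρ) - rieszProfile p ρ) = m (2 * ρ) - m ρ := by
    rw [hΛ]; exact div_mul_cancel₀ _ (sub_pos.2 hkρ).ne'
  have hend : ∀ a, 0 < a → a < ρ →
      m ρ - m a ≤ Λ * (rieszProfile p ρ - rieszProfile p a) := by
    intro a ha haρ
    have h1 := slope a ρ (2 * ρ) ha haρ (by linarith) le_rfl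
    rw [← hΛmul] at h1
    refine le_of_mul_le_mul_right ?_ (sub_pos.2 hkρ)
    linarith
  refine ⟨Λ, hΛ0, fun a b ha hab hbρ => ?_⟩
  rcases hab.eq_or_lt with rfl | hab
  · simp
  rcases hbρ.eq_or_lt with rfl | hbρ
  · exact hend a ha hab
  have h1 := slope a b ρ ha hab hbρ (by linarith)
  have h2 := hend b (ha.trans hab) hbρ
  have hkb := hk (ha.trans hab) hbρ
  have hka := hk ha hab
  refine le_of_mul_le_mul_right ?_ (sub_pos.2 hkb)
  nlinarith

end MaxBall
end

/-! ### Harmonic polynomials and radial means -/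

noncomputable section

section Polynomials

open MvPolynomial

variable {n : ℕ}

/-- The Laplacian on polynomials. -/
def polyLaplacian (n : ℕ) : MvPolynomial (Fin n) ℝ →ₗ[ℝ] MvPolynomial (Fin n) ℝ :=
  ∑ i, (pderiv i).toLinearMap ∘ₗ (pderiv i).toLinearMap

theorem polyLaplacian_apply (q : MvPolynomial (Fin n) ℝ) :
    polyLaplacian n q = ∑ i, pderiv i (pderiv i q) := by
  simp [polyLaplacian, LinearMap.sum_apply]

/-- The polynomial `|x|²`. -/
def polyNormSq (n : ℕ) : MvPolynomial (Fin n) ℝ := ∑ i, X i ^ 2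

theorem pderiv_polyNormSq (i : Fin n) : pderiv i (polyNormSq n) = 2 * X i := by
  classical
  simp only [polyNormSq, map_sum, Derivation.leibniz_pow, pderiv_X, Nat.add_one_sub_one, pow_one,
    nsmul_eq_mul, smul_eq_mul]
  rw [Finset.sum_eq_single i]
  · simp
  · intro j _ hj
    simp [Pi.single_apply, Ne.symm hj]
  · simp

theorem isHomogeneous_polyNormSq : (polyNormSq n).IsHomogeneous 2 :=
  IsHomogeneous.sum _ _ _ fun i _ => isHomogeneous_X_pow i 2

/-- In the Leibniz rule the cross term `4 ∑ xᵢ ∂ᵢg` equals `4 m g` by Euler's identity. -/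
theorem polyLaplacian_polyNormSq_mul {g : MvPolynomial (Fin n) ℝ} {m : ℕ}
    (hg : g.IsHomogeneous m) :
    polyLaplacian n (polyNormSq n * g) =
      ((2 * n + 4 * m : ℕ) : ℝ) • g + polyNormSq n * polyLaplacian n g := by
  have h1 : ∀ i : Fin n, pderiv i (pderiv i (polyNormSq n * g)) =
      2 * g + 4 * (X i * pderiv i g) + polyNormSq n * pderiv i (pderiv i g) := by
    intro i
    have h2 : pderiv i (2 * X i : MvPolynomial (Fin n) ℝ) = 2 := by
      rw [show (2 : MvPolynomial (Fin n) ℝ) = C 2 from rfl, pderiv_C_mul, pderiv_X_self]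
      simp
    rw [Derivation.leibniz, pderiv_polyNormSq, map_add, smul_eq_mul, smul_eq_mul,
      Derivation.leibniz, Derivation.leibniz, h2, pderiv_polyNormSq]
    simp only [smul_eq_mul]
    ring
  rw [polyLaplacian_apply, polyLaplacian_apply]
  simp only [h1, Finset.sum_add_distrib, ← Finset.mul_sum, hg.sum_X_mul_pderiv]
  rw [MvPolynomial.smul_eq_C_mul, map_natCast]
  simp only [Finset.sum_const, Finset.card_univ, Fintype.card_fin, nsmul_eq_mul]
  push_cast
  ring

/-- Homogeneous harmonic polynomials times powers of `|x|²`, of total degree `m`. -/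
def almansiSet (n m : ℕ) : Set (MvPolynomial (Fin n) ℝ) :=
  {q | ∃ (j d : ℕ) (h : MvPolynomial (Fin n) ℝ), h.IsHomogeneous d ∧ polyLaplacian n h = 0 ∧
    2 * j + d = m ∧ q = polyNormSq n ^ j * h}

theorem almansiSet_isHomogeneous {m : ℕ} {q : MvPolynomial (Fin n) ℝ} (hq : q ∈ almansiSet n m) :
    q.IsHomogeneous m := by
  obtain ⟨j, d, h, hh, -, rfl, rfl⟩ := hq
  exact (isHomogeneous_polyNormSq.pow j).mul hh

/-- Induction on `j`, adding a positive constant each time. Positivity is what allows the Laplacian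
to be inverted on such products. -/
theorem exists_polyLaplacian_polyNormSq_pow_succ_mul (hn : n ≠ 0) {h : MvPolynomial (Fin n) ℝ}
    {d : ℕ} (hh : h.IsHomogeneous d) (hharm : polyLaplacian n h = 0) (j : ℕ) :
    ∃ c : ℝ, 0 < c ∧ polyLaplacian n (polyNormSq n ^ (j + 1) * h) =
      c • (polyNormSq n ^ j * h) := by
  have hn' : (0 : ℝ) < n := by exact_mod_cast Nat.pos_of_ne_zero hn
  induction j with
  | zero =>
    refine ⟨((2 * n + 4 * d : ℕ) : ℝ), by push_cast; positivity, ?_⟩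
    rw [zero_add, pow_one, polyLaplacian_polyNormSq_mul hh, hharm, pow_zero, one_mul]
    simp
  | succ j ih =>
    obtain ⟨c, hc, hcj⟩ := ih
    refine ⟨((2 * n + 4 * (2 * (j + 1) + d) : ℕ) : ℝ) + c, by positivity, ?_⟩
    rw [pow_succ' _ (j + 1), mul_assoc,
      polyLaplacian_polyNormSq_mul ((isHomogeneous_polyNormSq.pow (j + 1)).mul hh), hcj, add_smul,
      mul_smul_comm, ← mul_assoc, ← pow_succ']

/-- On a generator, the Laplacian is undone by one more factor `|x|²` and division by the constant
`c`. -/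
theorem exists_polyLaplacian_eq (hn : n ≠ 0) {m : ℕ} {w : MvPolynomial (Fin n) ℝ}
    (hw : w ∈ Submodule.span ℝ (almansiSet n m)) :
    ∃ r ∈ Submodule.span ℝ (almansiSet n (m + 2)), polyLaplacian n r = w := by
  induction hw using Submodule.span_induction with
  | mem w hw =>
    obtain ⟨j, d, h, hh, hharm, hm, rfl⟩ := hw
    obtain ⟨c, hc, hcj⟩ := exists_polyLaplacian_polyNormSq_pow_succ_mul hn hh hharm j
    refine ⟨c⁻¹ • (polyNormSq n ^ (j + 1) * h), Submodule.smul_mem _ _ (Submodule.subset_span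
      ⟨j + 1, d, h, hh, hharm, by lia, rfl⟩), ?_⟩
    rw [map_smul, hcj, smul_smul, inv_mul_cancel₀ hc.ne', one_smul]
  | zero => exact ⟨0, Submodule.zero_mem _, map_zero _⟩
  | add x y _ _ hx hy =>
    obtain ⟨r, hr, rfl⟩ := hx
    obtain ⟨s, hs, rfl⟩ := hy
    exact ⟨r + s, Submodule.add_mem _ hr hs, map_add _ _ _⟩
  | smul a x _ hx =>
    obtain ⟨r, hr, rfl⟩ := hx
    exact ⟨a • r, Submodule.smul_mem _ _ hr, map_smul _ _ _⟩

theorem pderiv_eq_zero_of_isHomogeneous_zero {g : MvPolynomial (Fin n) ℝ}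
    (hg : g.IsHomogeneous 0) (i : Fin n) : pderiv i g = 0 := by
  have := totalDegree_eq_zero_iff_eq_C.1 (Nat.le_zero.1 hg.totalDegree_le)
  rw [this, pderiv_C]

/-- Every homogeneous polynomial is a combination of harmonic ones with powers of `|x|²`. -/
theorem IsHomogeneous.mem_span_almansiSet (hn : n ≠ 0) : ∀ (m : ℕ)
    {g : MvPolynomial (Fin n) ℝ}, g.IsHomogeneous m → g ∈ Submodule.span ℝ (almansiSet n m) := by
  have hlow : ∀ m < 2, ∀ {g : MvPolynomial (Fin n) ℝ}, g.IsHomogeneous m →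
      g ∈ Submodule.span ℝ (almansiSet n m) := by
    intro m hm g hg
    refine Submodule.subset_span ⟨0, m, g, hg, ?_, by simp, by simp⟩
    rw [polyLaplacian_apply]
    refine Finset.sum_eq_zero fun i _ => pderiv_eq_zero_of_isHomogeneous_zero ?_ i
    have := hg.pderiv (i := i)
    rwa [show m - 1 = 0 by lia] at this
  intro m
  induction m using Nat.strong_induction_on with
  | _ m ih =>
    intro g hg
    rcases Nat.lt_or_ge m 2 with hm | hm
    · exact hlow m hm hg
    obtain ⟨k, rfl⟩ := Nat.exists_eq_add_of_le' hm
    have hlap : (polyLaplacian n g).IsHomogeneous k := by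
      rw [polyLaplacian_apply]
      exact IsHomogeneous.sum _ _ _ fun i _ => hg.pderiv.pderiv
    -- The Laplacian of `g` is decomposable by induction, hence equals that of some decomposable
    -- `r`; the remainder `g - r` is harmonic.
    obtain ⟨r, hr, hrg⟩ := exists_polyLaplacian_eq hn (ih k (by lia) hlap)
    have hrhom : r.IsHomogeneous (k + 2) := by
      have : Submodule.span ℝ (almansiSet n (k + 2)) ≤ homogeneousSubmodule (Fin n) ℝ (k + 2) :=
        Submodule.span_le.2 fun q hq => almansiSet_isHomogeneous hq
      exact this hr
    have hsub : g - r ∈ almansiSet n (k + 2) :=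
      ⟨0, k + 2, g - r, hg.sub hrhom, by rw [map_sub, hrg, sub_self], by simp, by simp⟩
    have := Submodule.add_mem _ (Submodule.subset_span hsub) hr
    simpa using this

/-- Evaluation of a polynomial on Euclidean space. -/
def polyFun (q : MvPolynomial (Fin n) ℝ) (x : Eucl n) : ℝ := eval (x : Fin n → ℝ) q

theorem hasFDerivAt_polyFun (q : MvPolynomial (Fin n) ℝ) (x : Eucl n) :
    HasFDerivAt (polyFun q)
      (∑ i, polyFun (pderiv i q) x • (EuclideanSpace.proj i : Eucl n →L[ℝ] ℝ)) x := by
  classical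
  induction q using MvPolynomial.induction_on with
  | C a =>
    have : polyFun (C a : MvPolynomial (Fin n) ℝ) = fun _ => a := by
      funext y; simp [polyFun]
    rw [this]
    simpa [polyFun] using hasFDerivAt_const a x
  | add p q hp hq =>
    have h : polyFun (p + q) = fun y => polyFun p y + polyFun q y := by
      funext y; simp [polyFun]
    rw [h]
    refine (hp.add hq).congr_fderiv ?_
    simp [polyFun, add_smul, Finset.sum_add_distrib]
  | mul_X p j hp =>
    have h : polyFun (p * X j) = fun y => polyFun p y * y j := by
      funext y; simp [polyFun]
    rw [h]
    have hX : HasFDerivAt (fun y : Eucl n => y j) (EuclideanSpace.proj j : Eucl n →L[ℝ] ℝ) x :=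
      (EuclideanSpace.proj j : Eucl n →L[ℝ] ℝ).hasFDerivAt
    refine (hp.mul hX).congr_fderiv (Eq.symm ?_)
    simp only [polyFun, Derivation.leibniz, pderiv_X, smul_eq_mul, map_add, map_mul, eval_X,
      add_smul, Finset.sum_add_distrib, Finset.smul_sum, smul_smul]
    congr 1
    rw [Finset.sum_eq_single j]
    · simp
    · intro i _ hi
      simp [Pi.single_apply, Ne.symm hi]
    · simp

theorem polyFun_add (p q : MvPolynomial (Fin n) ℝ) (x : Eucl n) :
    polyFun (p + q) x = polyFun p x + polyFun q x := by simp [polyFun]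

theorem polyFun_smul (a : ℝ) (q : MvPolynomial (Fin n) ℝ) (x : Eucl n) :
    polyFun (a • q) x = a * polyFun q x := by simp [polyFun]

theorem polyFun_mul (p q : MvPolynomial (Fin n) ℝ) (x : Eucl n) :
    polyFun (p * q) x = polyFun p x * polyFun q x := by simp [polyFun]

theorem polyFun_polyNormSq (x : Eucl n) : polyFun (polyNormSq n) x = ‖x‖ ^ 2 := by
  simp [polyFun, polyNormSq, EuclideanSpace.norm_sq_eq]

theorem contDiff_polyFun (q : MvPolynomial (Fin n) ℝ) (k : ℕ) : ContDiff ℝ k (polyFun q) := by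
  induction k generalizing q with
  | zero => 
    exact contDiff_zero.2 (continuous_iff_continuousAt.2 fun x =>
      (hasFDerivAt_polyFun q x).continuousAt)
  | succ k ih =>
    have : ((k + 1 : ℕ) : WithTop ℕ∞) = (k : WithTop ℕ∞) + 1 := by push_cast; rfl
    rw [this]
    refine (contDiff_succ_iff_hasFDerivAt (n := k)).2 
      ⟨fun x => ∑ i, polyFun (pderiv i q) x • (EuclideanSpace.proj i : Eucl n →L[ℝ] ℝ), ?_,
        hasFDerivAt_polyFun q⟩
    exact ContDiff.sum fun i _ => (ih _).smul contDiff_const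

theorem continuous_polyFun (q : MvPolynomial (Fin n) ℝ) : Continuous (polyFun q) :=
  (contDiff_polyFun q 0).continuous

theorem fderiv_polyFun_single (q : MvPolynomial (Fin n) ℝ) (x : Eucl n) (i : Fin n) :
    fderiv ℝ (polyFun q) x (EuclideanSpace.single i 1) = polyFun (pderiv i q) x := by
  rw [(hasFDerivAt_polyFun q x).fderiv]
  simp

theorem hessian_polyFun (q : MvPolynomial (Fin n) ℝ) (x : Eucl n) (i j : Fin n) :
    hessian (polyFun q) x i j = polyFun (pderiv i (pderiv j q)) x := by
  have h : fderiv ℝ (polyFun q) = fun y =>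
      ∑ k, polyFun (pderiv k q) y • (EuclideanSpace.proj k : Eucl n →L[ℝ] ℝ) := by
    funext y; exact (hasFDerivAt_polyFun q y).fderiv
  have h2 : HasFDerivAt (fun y => ∑ k, polyFun (pderiv k q) y •
      (EuclideanSpace.proj k : Eucl n →L[ℝ] ℝ))
      (∑ k, (fderiv ℝ (polyFun (pderiv k q)) x).smulRight
        (EuclideanSpace.proj k : Eucl n →L[ℝ] ℝ)) x := by
    refine HasFDerivAt.fun_sum fun k _ => ?_
    exact ((hasFDerivAt_polyFun (pderiv k q) x).differentiableAt.hasFDerivAt).smul_const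
      (EuclideanSpace.proj k : Eucl n →L[ℝ] ℝ)
  simp only [hessian, Matrix.of_apply]
  rw [h, h2.fderiv]
  simp [fderiv_polyFun_single]

theorem trace_hessian_polyFun (q : MvPolynomial (Fin n) ℝ) (x : Eucl n) :
    (hessian (polyFun q) x).trace = polyFun (polyLaplacian n q) x := by
  simp only [Matrix.trace, Matrix.diag_apply, hessian_polyFun, polyLaplacian_apply, polyFun,
    map_sum]

theorem integrable_comp_norm_sq_mul {g : ℝ → ℝ} (hg : Continuous g) {T : ℝ}
    (hgT : ∀ t, T ≤ t → g t = 0) {f : Eucl n → ℝ} (hf : Continuous f) :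
    Integrable (fun y : Eucl n => g (‖y‖ ^ 2) * f y) := by
  refine Continuous.integrable_of_hasCompactSupport (by fun_prop) ?_
  refine HasCompactSupport.intro (isCompact_closedBall (0 : Eucl n) (|T| + 1)) fun y hy => ?_
  rw [mem_closedBall_zero_iff, not_le] at hy
  rw [hgT, zero_mul]
  nlinarith [le_abs_self T, abs_nonneg T]

/-- A homogeneous harmonic polynomial of positive degree is orthogonal to radial functions. -/
theorem integral_radial_mul_harmonic {g : ℝ → ℝ} (hg : Continuous g) {T : ℝ}
    (hgT : ∀ t, T ≤ t → g t = 0) {h : MvPolynomial (Fin n) ℝ} {d : ℕ} (hd : d ≠ 0)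
    (hh : h.IsHomogeneous d) (hharm : polyLaplacian n h = 0) :
    ∫ y : Eucl n, g (‖y‖ ^ 2) * polyFun h y = 0 := by
  -- The primitive satisfies `∂ᵢ(G(|y|²)) = g(|y|²) yᵢ` and vanishes beyond `T`. By Euler's identity
  -- and integration by parts, `d ∫ g h = ∑ ∫ g yᵢ ∂ᵢh = -∫ G Δh = 0`.
  set G : ℝ → ℝ := fun t => ∫ τ in T..t, g τ / 2 with hGdef
  have hG : ∀ t, HasDerivAt G (g t / 2) t := fun t =>
    intervalIntegral.integral_hasDerivAt_right
      ((hg.div_const 2).intervalIntegrable _ _)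
      ((hg.div_const 2).stronglyMeasurableAtFilter _ _) (hg.div_const 2).continuousAt
  have hGc : Continuous G := continuous_iff_continuousAt.2 fun t => (hG t).continuousAt
  have hGT : ∀ t, T ≤ t → G t = 0 := by
    intro t ht
    simp only [hGdef]
    refine intervalIntegral.integral_zero_ae (ae_of_all _ fun τ hτ => ?_)
    rw [uIoc_of_le ht] at hτ
    rw [hgT τ hτ.1.le, zero_div]
  have hK : ∀ y : Eucl n, HasFDerivAt (fun z : Eucl n => G (‖z‖ ^ 2))
      (g (‖y‖ ^ 2) • innerSL ℝ y) y := by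
    intro y
    have := (hG (‖y‖ ^ 2)).comp_hasFDerivAt y (hasStrictFDerivAt_norm_sq y).hasFDerivAt
    rw [← Nat.cast_smul_eq_nsmul ℝ, smul_smul, Nat.cast_ofNat, div_mul_cancel₀ _ two_ne_zero]
      at this
    exact this
  have hKi : ∀ (i : Fin n) (y : Eucl n),
      fderiv ℝ (fun z : Eucl n => G (‖z‖ ^ 2)) y (EuclideanSpace.single i 1) =
        g (‖y‖ ^ 2) * y i := by
    intro i y
    rw [(hK y).fderiv]
    simp [EuclideanSpace.inner_single_right]
  have hparts : ∀ i : Fin n, ∫ y : Eucl n, g (‖y‖ ^ 2) * (y i * polyFun (pderiv i h) y) =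
      -∫ y : Eucl n, G (‖y‖ ^ 2) * polyFun (pderiv i (pderiv i h)) y := by
    intro i
    have hc := continuous_polyFun (pderiv i h)
    have hyi : Continuous fun y : Eucl n => y i := by fun_prop
    have := integral_mul_fderiv_eq_neg_fderiv_mul_of_integrable (μ := (volume : Measure (Eucl n)))
      (f := fun z : Eucl n => G (‖z‖ ^ 2)) (g := polyFun (pderiv i h))
      (v := EuclideanSpace.single i 1)
      (by
        simp only [hKi, mul_assoc]
        exact integrable_comp_norm_sq_mul hg hgT (hyi.mul hc))
      (by
        simp only [fderiv_polyFun_single]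
        exact integrable_comp_norm_sq_mul hGc hGT (continuous_polyFun _))
      (integrable_comp_norm_sq_mul hGc hGT hc)
      (fun y _ => (hK y).differentiableAt)
      (fun y _ => (hasFDerivAt_polyFun _ y).differentiableAt)
    simp only [fderiv_polyFun_single, hKi, mul_assoc] at this
    rw [this, neg_neg]
  have heuler : ∀ y : Eucl n, (d : ℝ) * polyFun h y = ∑ i, y i * polyFun (pderiv i h) y := by
    intro y
    have := congrArg (fun q => polyFun q y) hh.sum_X_mul_pderiv
    simp only [polyFun, map_sum, map_mul, eval_X, nsmul_eq_mul, map_natCast] at this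
    exact this.symm
  have hsum : (d : ℝ) * ∫ y : Eucl n, g (‖y‖ ^ 2) * polyFun h y = 0 := by
    calc (d : ℝ) * ∫ y : Eucl n, g (‖y‖ ^ 2) * polyFun h y
        = ∫ y : Eucl n, ∑ i, g (‖y‖ ^ 2) * (y i * polyFun (pderiv i h) y) := by
          rw [← integral_const_mul]
          refine integral_congr_ae (ae_of_all _ fun y => ?_)
          simp only
          rw [← Finset.mul_sum, ← heuler]
          ring
      _ = ∑ i, ∫ y : Eucl n, g (‖y‖ ^ 2) * (y i * polyFun (pderiv i h) y) :=
          integral_finsetSum _ fun i _ => integrable_comp_norm_sq_mul hg hgT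
            ((by fun_prop : Continuous fun y : Eucl n => y i).mul (continuous_polyFun _))
      _ = -∫ y : Eucl n, ∑ i, G (‖y‖ ^ 2) * polyFun (pderiv i (pderiv i h)) y := by
          rw [integral_finsetSum _ fun i _ => integrable_comp_norm_sq_mul hGc hGT
            (continuous_polyFun _), ← Finset.sum_neg_distrib]
          exact Finset.sum_congr rfl fun i _ => hparts i
      _ = 0 := by
          have : ∀ y : Eucl n, ∑ i, G (‖y‖ ^ 2) * polyFun (pderiv i (pderiv i h)) y = 0 := by
            intro y
            have h1 := congrArg (fun q => polyFun q y) hharm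
            simp only [polyLaplacian_apply, polyFun, map_sum, map_zero] at h1
            rw [← Finset.mul_sum]
            simp only [polyFun]
            rw [h1, mul_zero]
          simp [this]
  have hd' : (d : ℝ) ≠ 0 := by exact_mod_cast hd
  exact (mul_eq_zero.1 hsum).resolve_left hd'

/-- In positive degree `h` vanishes at the origin and both sides are `0`; in degree zero `h` is
constant. -/
theorem integral_radial_mul_harmonic_eq {g : ℝ → ℝ} (hg : Continuous g) {T : ℝ}
    (hgT : ∀ t, T ≤ t → g t = 0) {h : MvPolynomial (Fin n) ℝ} {d : ℕ}
    (hh : h.IsHomogeneous d) (hharm : polyLaplacian n h = 0) :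
    ∫ y : Eucl n, g (‖y‖ ^ 2) * polyFun h y = ∫ y : Eucl n, g (‖y‖ ^ 2) * polyFun h 0 := by
  rcases eq_or_ne d 0 with rfl | hd
  · have := totalDegree_eq_zero_iff_eq_C.1 (Nat.le_zero.1 hh.totalDegree_le)
    rw [this]
    simp [polyFun]
  · have h0 : polyFun h 0 = 0 := by
      have := congrArg (fun q => polyFun q (0 : Eucl n)) hh.sum_X_mul_pderiv
      simp only [polyFun, map_sum, map_mul, eval_X, nsmul_eq_mul, map_natCast] at this
      have h1 : (d : ℝ) * polyFun h 0 = 0 := by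
        rw [polyFun, ← this]; simp
      exact (mul_eq_zero.1 h1).resolve_left (by exact_mod_cast hd)
    rw [integral_radial_mul_harmonic hg hgT hd hh hharm, h0]
    simp

/-- A polynomial has harmonic polynomial extensions from all spheres about the origin, whose values
at the origin reproduce its radial means. -/
theorem exists_harmonic_extension (hn : n ≠ 0) (q : MvPolynomial (Fin n) ℝ) :
    ∃ T : ℝ → MvPolynomial (Fin n) ℝ, (∀ ρ, polyLaplacian n (T ρ) = 0) ∧
      (∀ x : Eucl n, polyFun (T ‖x‖) x = polyFun q x) ∧
      (Continuous fun ρ => polyFun (T ρ) 0) ∧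
      ∀ g : ℝ → ℝ, Continuous g → ∀ S : ℝ, (∀ t, S ≤ t → g t = 0) →
        ∫ y : Eucl n, g (‖y‖ ^ 2) * polyFun (T ‖y‖) 0 =
          ∫ y : Eucl n, g (‖y‖ ^ 2) * polyFun q y := by
  have hq : q ∈ Submodule.span ℝ (⋃ m, almansiSet n m) := by
    rw [← sum_homogeneousComponent q]
    refine Submodule.sum_mem _ fun m _ => ?_
    exact Submodule.span_mono (subset_iUnion _ m)
      (IsHomogeneous.mem_span_almansiSet hn m (homogeneousComponent_isHomogeneous m q))
  induction hq using Submodule.span_induction with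
  | mem q hq =>
    obtain ⟨m, j, d, h, hh, hharm, -, rfl⟩ := mem_iUnion.1 hq
    -- On the sphere of radius `ρ` the factor `|x|^(2j)` is the constant `ρ^(2j)`, and freezing it
    -- leaves a harmonic polynomial. In the integral identity it is absorbed into the radial weight.
    refine ⟨fun ρ => (ρ ^ 2) ^ j • h, fun ρ => by rw [map_smul, hharm, smul_zero], fun x => ?_,
      ?_, fun g hg S hgS => ?_⟩
    · have : polyFun (polyNormSq n ^ j) x = polyFun (polyNormSq n) x ^ j := by simp [polyFun]
      rw [polyFun_smul, polyFun_mul, this, polyFun_polyNormSq]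
    · simp only [polyFun_smul]
      fun_prop
    · have := integral_radial_mul_harmonic_eq (g := fun t => g t * t ^ j) (by fun_prop) (T := S)
        (fun t ht => by rw [hgS t ht, zero_mul]) hh hharm
      have h2 : ∀ y : Eucl n, polyFun (polyNormSq n ^ j) y = (‖y‖ ^ 2) ^ j := by
        intro y
        rw [← polyFun_polyNormSq]; simp [polyFun]
      simp only [polyFun_smul, polyFun_mul, h2, ← mul_assoc]
      exact this.symm
  | zero =>
    refine ⟨fun _ => 0, fun _ => map_zero _, fun _ => rfl, continuous_const, fun g _ S _ => ?_⟩
    simp [polyFun]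
  | add p q _ _ hp hq =>
    obtain ⟨T, h1, h2, h3, h4⟩ := hp
    obtain ⟨T', h1', h2', h3', h4'⟩ := hq
    refine ⟨fun ρ => T ρ + T' ρ, fun ρ => by rw [map_add, h1, h1', add_zero], fun x => ?_, ?_,
      fun g hg S hgS => ?_⟩
    · rw [polyFun_add, polyFun_add, h2, h2']
    · simp only [polyFun_add]; exact h3.add h3'
    · simp only [polyFun_add, mul_add]
      rw [integral_add, integral_add, h4 g hg S hgS, h4' g hg S hgS]
      · exact integrable_comp_norm_sq_mul hg hgS (continuous_polyFun _)
      · exact integrable_comp_norm_sq_mul hg hgS (continuous_polyFun _)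
      · exact integrable_comp_norm_sq_mul hg hgS (h3.comp continuous_norm)
      · exact integrable_comp_norm_sq_mul hg hgS (h3'.comp continuous_norm)
  | smul a q _ hq =>
    obtain ⟨T, h1, h2, h3, h4⟩ := hq
    refine ⟨fun ρ => a • T ρ, fun ρ => by rw [map_smul, h1, smul_zero], fun x => ?_, ?_,
      fun g hg S hgS => ?_⟩
    · rw [polyFun_smul, polyFun_smul, h2]
    · simp only [polyFun_smul]; exact continuous_const.mul h3
    · simp only [polyFun_smul, mul_left_comm _ a]
      rw [integral_const_mul, integral_const_mul, h4 g hg S hgS]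

end Polynomials
end

/-! ### The averaging kernel -/

noncomputable section

section Kernel

variable (n : ℕ)

/-- The mass of the unnormalized kernel `(1 - |y|²)₊`. -/
def kernMass : ℝ := ∫ y : Eucl n, max 0 (1 - ‖y‖ ^ 2)

/-- The averaging kernel of radius `s`, proportional to `(1 - |y|² / s²)₊`. -/
def kern (s : ℝ) (y : Eucl n) : ℝ :=
  (kernMass n)⁻¹ * (s ^ n)⁻¹ * max 0 (1 - ‖y‖ ^ 2 / s ^ 2)

variable {n}

theorem kernMass_pos : 0 < kernMass n := by
  have hc : Continuous fun y : Eucl n => max 0 (1 - ‖y‖ ^ 2) := by fun_prop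
  refine hc.integral_pos_of_hasCompactSupport_nonneg_nonzero (x := 0) ?_ (fun y => le_max_left _ _)
    (by simp)
  refine HasCompactSupport.intro (isCompact_closedBall (0 : Eucl n) 1) fun y hy => ?_
  rw [mem_closedBall_zero_iff, not_le] at hy
  exact max_eq_left (by nlinarith)

theorem continuous_kern (s : ℝ) : Continuous (kern n s) := by
  unfold kern
  fun_prop

theorem kern_nonneg {s : ℝ} (hs : 0 < s) (y : Eucl n) : 0 ≤ kern n s y := by
  have := kernMass_pos (n := n)
  unfold kern
  positivity

theorem kern_eq_zero {s : ℝ} (hs : 0 < s) {y : Eucl n} (hy : s ≤ ‖y‖) : kern n s y = 0 := by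
  unfold kern
  rw [max_eq_left, mul_zero]
  rw [sub_nonpos, one_le_div (by positivity)]
  exact pow_le_pow_left₀ hs.le hy 2

theorem kern_neg (s : ℝ) (y : Eucl n) : kern n s (-y) = kern n s y := by
  simp [kern]

theorem kern_sub_comm (s : ℝ) (x y : Eucl n) : kern n s (x - y) = kern n s (y - x) := by
  rw [← kern_neg, neg_sub]

theorem kern_le {s : ℝ} (hs : 0 < s) (y : Eucl n) :
    kern n s y ≤ (kernMass n)⁻¹ * (s ^ n)⁻¹ := by
  have := kernMass_pos (n := n)
  have h : max 0 (1 - ‖y‖ ^ 2 / s ^ 2) ≤ 1 :=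
    max_le zero_le_one (sub_le_self _ (by positivity))
  unfold kern
  exact mul_le_of_le_one_right (by positivity) h

/-- This lower bound lets a kernel average of a nonnegative function control its plain integral over
the ball of half the radius. -/
theorem le_kern {s : ℝ} (hs : 0 < s) {y : Eucl n} (hy : ‖y‖ ≤ s / 2) :
    (kernMass n)⁻¹ * (s ^ n)⁻¹ / 2 ≤ kern n s y := by
  have := kernMass_pos (n := n)
  have h : 1 / 2 ≤ max 0 (1 - ‖y‖ ^ 2 / s ^ 2) := by
    refine le_max_of_le_right ?_
    have : ‖y‖ ^ 2 / s ^ 2 ≤ 1 / 4 := by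
      rw [div_le_iff₀ (by positivity)]
      nlinarith [norm_nonneg y]
    linarith
  unfold kern
  have h2 : 0 ≤ (kernMass n)⁻¹ * (s ^ n)⁻¹ := by positivity
  nlinarith

theorem hasCompactSupport_kern {s : ℝ} (hs : 0 < s) : HasCompactSupport (kern n s) := by
  refine HasCompactSupport.intro (isCompact_closedBall (0 : Eucl n) s) fun y hy => ?_
  rw [mem_closedBall_zero_iff, not_le] at hy
  exact kern_eq_zero hs hy.le

theorem integrable_kern {s : ℝ} (hs : 0 < s) : Integrable (kern n s) :=
  (continuous_kern s).integrable_of_hasCompactSupport (hasCompactSupport_kern hs)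

theorem integral_kern {s : ℝ} (hs : 0 < s) : ∫ y, kern n s y = 1 := by
  have h := Measure.integral_comp_smul (volume : Measure (Eucl n))
    (fun y : Eucl n => max 0 (1 - ‖y‖ ^ 2)) s⁻¹
  have h2 : ∀ y : Eucl n, kern n s y =
      ((kernMass n)⁻¹ * (s ^ n)⁻¹) * max 0 (1 - ‖s⁻¹ • y‖ ^ 2) := by
    intro y
    rw [kern, norm_smul, norm_inv, Real.norm_eq_abs, abs_of_pos hs, mul_pow, inv_pow,
      div_eq_inv_mul]
  simp only [h2]
  rw [integral_const_mul, h, finrank_euclideanSpace_fin, inv_pow, inv_inv, abs_of_pos (by positivity)]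
  have := kernMass_pos (n := n)
  rw [← kernMass, smul_eq_mul]
  field_simp

theorem kern_smul {r s : ℝ} (hr : 0 < r) (y : Eucl n) :
    kern n (r * s) (r • y) = (r ^ n)⁻¹ * kern n s y := by
  unfold kern
  rw [norm_smul, Real.norm_eq_abs, abs_of_pos hr, mul_pow, mul_pow, mul_pow,
    mul_div_mul_left _ _ (by positivity), mul_inv]
  ring

end Kernel

/-! ### The sub-mean inequality against continuous majorants -/

section SubMean

variable {n : ℕ} {F : Set (Matrix (Fin n) (Fin n) ℝ)} {u : Eucl n → EReal} {X : Set (Eucl n)}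

open MvPolynomial in
/-- The maximum principle against harmonic polynomials. -/
theorem IsSubharmonicOn.le_polyFun_of_sphere (hF : IsSubequation F) (hcone : HasConeProperty F)
    (hST : IsSTInvariant F) (hconv : Convex ℝ F) (hu : IsSubharmonicOn F u X) {ρ : ℝ}
    (hX : closedBall 0 ρ ⊆ X) {q : MvPolynomial (Fin n) ℝ} (hq : polyLaplacian n q = 0)
    (hbd : ∀ x : Eucl n, ‖x‖ = ρ → u x ≤ (polyFun q x : EReal)) {x : Eucl n} (hx : ‖x‖ ≤ ρ) :
    u x ≤ (polyFun q x : EReal) := by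
  have hn : (0 : ℝ) < n := by exact_mod_cast Nat.pos_of_ne_zero hF.dim_ne_zero
  have key : ∀ ε : ℝ, 0 < ε → u x ≤ ((polyFun q x + ε * (ρ ^ 2 - ‖x‖ ^ 2) : ℝ) : EReal) := by
    intro ε hε
    -- The term `-ε|x|²` gives the Hessian trace `-2nε < 0`, so it leaves `F`; the constant `ερ²`
    -- restores the values on the sphere.
    set Q : MvPolynomial (Fin n) ℝ := q + (-ε) • polyNormSq n with hQ
    have hQval : ∀ y : Eucl n, polyFun Q y + ε * ρ ^ 2 =
        polyFun q y + ε * (ρ ^ 2 - ‖y‖ ^ 2) := by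
      intro y
      rw [hQ, polyFun_add, polyFun_smul, polyFun_polyNormSq]
      ring
    have hlapN : polyLaplacian n (polyNormSq n) = C ((2 * n : ℕ) : ℝ) := by
      have := polyLaplacian_polyNormSq_mul (isHomogeneous_one (Fin n) ℝ)
      rw [mul_one, polyLaplacian_apply 1] at this
      simp only [pderiv_one, map_zero, Finset.sum_const_zero, mul_zero, add_zero] at this
      rw [this, MvPolynomial.smul_eq_C_mul, mul_one]
    rw [← hQval]
    refine hu.le_of_hessian_notMem (φ := fun y => polyFun Q y + ε * ρ ^ 2)
      (isCompact_closedBall (0 : Eucl n) ρ) hX isOpen_ball ball_subset_closedBall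
      ((continuous_polyFun Q).add continuous_const).continuousOn ?_ ?_ ?_
      (mem_closedBall_zero_iff.2 hx)
    · intro y _
      exact ((contDiff_polyFun Q 2).contDiffAt).add contDiffAt_const
    · intro y _ hmem
      rw [hessian_add_const] at hmem
      have h1 := hF.trace_nonneg hcone hST hconv hmem
      rw [trace_hessian_polyFun, hQ, map_add, hq, zero_add, map_smul, hlapN, polyFun_smul] at h1
      simp only [polyFun, eval_C] at h1
      push_cast at h1
      nlinarith
    · intro y hy hyb
      have hyρ : ‖y‖ = ρ := le_antisymm (mem_closedBall_zero_iff.1 hy)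
        (not_lt.1 fun h => hyb (mem_ball_zero_iff.2 h))
      simp only [hQval, hyρ, sub_self, mul_zero, add_zero]
      exact hbd y hyρ
  have hlim : Tendsto (fun ε : ℝ => ((polyFun q x + ε * (ρ ^ 2 - ‖x‖ ^ 2) : ℝ) : EReal))
      (𝓝[>] 0) (𝓝 (polyFun q x : EReal)) := by
    have : Continuous fun ε : ℝ => polyFun q x + ε * (ρ ^ 2 - ‖x‖ ^ 2) := by fun_prop
    have h := (continuous_coe_real_ereal.comp this).tendsto 0
    simp only [Function.comp_def, zero_mul, add_zero] at h
    exact h.mono_left nhdsWithin_le_nhds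
  exact ge_of_tendsto hlim (by filter_upwards [self_mem_nhdsWithin] with ε hε using key ε hε)

/-- For each `ρ ≤ s` the maximum principle bounds `u 0` by the value at `0` of the harmonic
polynomial agreeing with `q` on the sphere of radius `ρ`. Integrating these bounds against the
kernel gives the radial mean of `q`, without surface measure. -/
theorem IsSubharmonicOn.le_integral_polyFun (hF : IsSubequation F) (hcone : HasConeProperty F)
    (hST : IsSTInvariant F) (hconv : Convex ℝ F) (hu : IsSubharmonicOn F u X) {s : ℝ}
    (hs : 0 < s) (hX : closedBall 0 s ⊆ X) {q : MvPolynomial (Fin n) ℝ}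
    (hq : ∀ x ∈ closedBall (0 : Eucl n) s, u x ≤ (polyFun q x : EReal)) :
    u 0 ≤ ((∫ y, kern n s y * polyFun q y : ℝ) : EReal) := by
  obtain ⟨T, hT1, hT2, hT3, hT4⟩ := exists_harmonic_extension hF.dim_ne_zero q
  rcases eq_or_ne (u 0) ⊥ with hbot | hbot
  · rw [hbot]; exact bot_le
  have htop : u 0 ≠ ⊤ := (hu.lt_top 0 (hX (mem_closedBall_self hs.le))).ne
  set b : ℝ := (u 0).toReal with hb
  have hub : u 0 = (b : EReal) := (EReal.coe_toReal htop hbot).symm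
  have hle : ∀ ρ, 0 ≤ ρ → ρ ≤ s → b ≤ polyFun (T ρ) 0 := by
    intro ρ hρ hρs
    rw [← EReal.coe_le_coe_iff, ← hub]
    refine hu.le_polyFun_of_sphere hF hcone hST hconv
      ((closedBall_subset_closedBall hρs).trans hX) (hT1 ρ) (fun x hx => ?_)
      (by rw [norm_zero]; exact hρ)
    rw [← hx, hT2 x]
    exact hq x (mem_closedBall_zero_iff.2 (hx.le.trans hρs))
  set g : ℝ → ℝ := fun t => (kernMass n)⁻¹ * (s ^ n)⁻¹ * max 0 (1 - t / s ^ 2) with hg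
  have hgc : Continuous g := by fun_prop
  have hgs : ∀ t, s ^ 2 ≤ t → g t = 0 := by
    intro t ht
    simp only [hg]
    rw [max_eq_left, mul_zero]
    rw [sub_nonpos, one_le_div (by positivity)]
    exact ht
  have hkg : ∀ y : Eucl n, kern n s y = g (‖y‖ ^ 2) := fun y => rfl
  have h4 := hT4 g hgc (s ^ 2) hgs
  simp only [← hkg] at h4
  rw [hub, EReal.coe_le_coe_iff, ← h4]
  calc b = ∫ y, kern n s y * b := by rw [integral_mul_const, integral_kern hs, one_mul]
    _ ≤ ∫ y, kern n s y * polyFun (T ‖y‖) 0 := by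
        refine integral_mono ((integrable_kern hs).mul_const b) ?_ fun y => ?_
        · simp only [hkg]
          exact integrable_comp_norm_sq_mul hgc hgs (hT3.comp continuous_norm)
        · rcases le_or_gt ‖y‖ s with h | h
          · exact mul_le_mul_of_nonneg_left (hle _ (norm_nonneg y) h) (kern_nonneg hs y)
          · simp [kern_eq_zero hs h.le]

/-- Stone–Weierstrass for the algebra generated by the coordinates. -/
theorem exists_polyFun_near {K : Set (Eucl n)} (hK : IsCompact K) {φ : Eucl n → ℝ}
    (hφ : Continuous φ) {ε : ℝ} (hε : 0 < ε) :
    ∃ q : MvPolynomial (Fin n) ℝ, ∀ x ∈ K, |polyFun q x - φ x| < ε := by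
  have : CompactSpace K := isCompact_iff_compactSpace.1 hK
  let ev : MvPolynomial (Fin n) ℝ →ₐ[ℝ] C(K, ℝ) :=
    MvPolynomial.aeval fun i => ⟨fun x : K => (x : Eucl n) i, by fun_prop⟩
  have hev : ∀ (q : MvPolynomial (Fin n) ℝ) (x : K), ev q x = polyFun q x := by
    intro q x
    have : (ContinuousMap.evalAlgHom ℝ ℝ x).comp ev =
        MvPolynomial.aeval (fun i => (x : Eucl n) i) := by
      refine MvPolynomial.algHom_ext fun i => ?_
      rw [AlgHom.comp_apply, MvPolynomial.aeval_X, MvPolynomial.aeval_X]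
      rfl
    have h2 := congrArg (fun f => f q) this
    simp only [AlgHom.comp_apply, MvPolynomial.aeval_eq_eval] at h2
    exact h2
  have hsep : ev.range.SeparatesPoints := by
    intro x y hxy
    have : ∃ i, (x : Eucl n) i ≠ (y : Eucl n) i := by
      by_contra h
      push Not at h
      exact hxy (Subtype.ext (PiLp.ext h))
    obtain ⟨i, hi⟩ := this
    refine ⟨ev (MvPolynomial.X i), ⟨ev (MvPolynomial.X i), ⟨_, rfl⟩, rfl⟩, ?_⟩
    rw [hev, hev]
    simpa [polyFun] using hi
  obtain ⟨⟨_, q, rfl⟩, hq⟩ := ContinuousMap.exists_mem_subalgebra_near_continuous_of_separatesPoints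
    ev.range hsep (fun x : K => φ x) (by fun_prop) ε hε
  refine ⟨q, fun x hx => ?_⟩
  have h1 : ‖ev q ⟨x, hx⟩ - φ x‖ < ε := hq ⟨x, hx⟩
  rwa [hev, Real.norm_eq_abs] at h1

theorem integrable_kern_mul {s : ℝ} (hs : 0 < s) {φ : Eucl n → ℝ} (hφ : Continuous φ) :
    Integrable fun y => kern n s y * φ y :=
  ((continuous_kern s).mul hφ).integrable_of_hasCompactSupport
    ((hasCompactSupport_kern hs).mul_right)

theorem IsSubharmonicOn.le_integral_of_continuous (hF : IsSubequation F)
    (hcone : HasConeProperty F) (hST : IsSTInvariant F) (hconv : Convex ℝ F)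
    (hu : IsSubharmonicOn F u X) {s : ℝ} (hs : 0 < s) (hX : closedBall 0 s ⊆ X)
    {φ : Eucl n → ℝ} (hφ : Continuous φ)
    (hle : ∀ x ∈ closedBall (0 : Eucl n) s, u x ≤ (φ x : EReal)) :
    u 0 ≤ ((∫ y, kern n s y * φ y : ℝ) : EReal) := by
  have key : ∀ ε : ℝ, 0 < ε → u 0 ≤ (((∫ y, kern n s y * φ y) + 2 * ε : ℝ) : EReal) := by
    intro ε hε
    obtain ⟨q, hq⟩ := exists_polyFun_near (isCompact_closedBall (0 : Eucl n) s) hφ hε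
    have hqC : ∀ x : Eucl n, polyFun (q + MvPolynomial.C ε) x = polyFun q x + ε := by
      intro x; simp [polyFun]
    -- Raising the approximating polynomial by `ε` keeps it above `u` and below `φ + 2ε`.
    refine (hu.le_integral_polyFun hF hcone hST hconv hs hX (q := q + MvPolynomial.C ε)
      fun x hx => (hle x hx).trans ?_).trans ?_
    · rw [EReal.coe_le_coe_iff, hqC]
      linarith [(abs_lt.1 (hq x hx)).1]
    · rw [EReal.coe_le_coe_iff]
      calc ∫ y, kern n s y * polyFun (q + MvPolynomial.C ε) y
          ≤ ∫ y, (kern n s y * φ y + kern n s y * (2 * ε)) := by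
            refine integral_mono (integrable_kern_mul hs (continuous_polyFun _))
              ((integrable_kern_mul hs hφ).add ((integrable_kern hs).mul_const _)) fun y => ?_
            simp only [← mul_add]
            rcases le_or_gt ‖y‖ s with h | h
            · refine mul_le_mul_of_nonneg_left ?_ (kern_nonneg hs y)
              rw [hqC]
              linarith [(abs_lt.1 (hq y (mem_closedBall_zero_iff.2 h))).2]
            · simp [kern_eq_zero hs h.le]
        _ = (∫ y, kern n s y * φ y) + 2 * ε := by
            rw [integral_add (integrable_kern_mul hs hφ) ((integrable_kern hs).mul_const _),
              integral_mul_const, integral_kern hs, one_mul]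
  have hlim : Tendsto (fun ε : ℝ => (((∫ y, kern n s y * φ y) + 2 * ε : ℝ) : EReal))
      (𝓝[>] 0) (𝓝 ((∫ y, kern n s y * φ y : ℝ) : EReal)) := by
    have : Continuous fun ε : ℝ => (∫ y, kern n s y * φ y) + 2 * ε := by fun_prop
    have h := (continuous_coe_real_ereal.comp this).tendsto 0
    simp only [Function.comp_def, mul_zero, add_zero] at h
    exact h.mono_left nhdsWithin_le_nhds
  exact ge_of_tendsto hlim (by filter_upwards [self_mem_nhdsWithin] with ε hε using key ε hε)

end SubMean

/-! ### Approximation of lower semicontinuous functions from below -/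

section InfConvolution

variable {α : Type*} [PseudoMetricSpace α]

/-- The inf-convolution of `min g j` with `j` times the distance. -/
def infConv (g : α → ENNReal) (j : ℕ) (x : α) : ENNReal :=
  ⨅ z, (min (g z) j + j * edist x z)

theorem infConv_le (g : α → ENNReal) (j : ℕ) (x : α) : infConv g j x ≤ min (g x) j :=
  (iInf_le _ x).trans (by simp)

theorem infConv_mono (g : α → ENNReal) : Monotone (infConv g) := by
  intro i j hij x
  have : (i : ENNReal) ≤ j := by exact_mod_cast hij
  exact iInf_mono fun z => add_le_add (min_le_min le_rfl this) (by gcongr)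

theorem continuous_infConv (g : α → ENNReal) (j : ℕ) : Continuous (infConv g j) := by
  refine continuous_of_le_add_edist j (ENNReal.natCast_ne_top j) fun x y => ?_
  unfold infConv
  rw [ENNReal.iInf_add]
  refine le_iInf fun z => (iInf_le _ z).trans ?_
  rw [add_assoc, ← mul_add, add_comm (edist y z)]
  gcongr
  exact edist_triangle x y z

/-- Fix `t' < g x`. Near `x`, semicontinuity keeps `g` above `t'`; at distance at least `ε` the
penalty `j ε` exceeds `t'` once `j` is large. -/
theorem iSup_infConv {g : α → ENNReal} (hg : LowerSemicontinuous g) (x : α) :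
    ⨆ j, infConv g j x = g x := by
  refine le_antisymm (iSup_le fun j => (infConv_le g j x).trans (min_le_left _ _)) ?_
  refine le_of_forall_lt fun t ht => ?_
  obtain ⟨t', htt', ht'⟩ := exists_between ht
  obtain ⟨ε₀, hε₀, hball⟩ := Metric.mem_nhds_iff.1 (hg x t' ht')
  set ε : ENNReal := ENNReal.ofReal ε₀
  have hε : ε ≠ 0 := (ENNReal.ofReal_pos.2 hε₀).ne'
  have ht'top : t' ≠ ⊤ := (ht'.trans_le le_top).ne
  obtain ⟨j₁, hj₁⟩ := ENNReal.exists_nat_gt ht'top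
  have hdiv : t' / ε ≠ ⊤ := ENNReal.div_ne_top ht'top hε
  obtain ⟨j₂, hj₂⟩ := ENNReal.exists_nat_gt hdiv
  refine htt'.trans_le (le_iSup_of_le (max j₁ j₂) (le_iInf fun z => ?_))
  have h1 : t' ≤ ((max j₁ j₂ : ℕ) : ENNReal) :=
    hj₁.le.trans (by exact_mod_cast le_max_left j₁ j₂)
  have h2 : t' / ε ≤ ((max j₁ j₂ : ℕ) : ENNReal) :=
    hj₂.le.trans (by exact_mod_cast le_max_right j₁ j₂)
  rcases lt_or_ge (edist x z) ε with hz | hz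
  · refine le_add_right (le_min ?_ h1)
    have : z ∈ Metric.ball x ε₀ := by
      rw [Metric.mem_ball, dist_comm]
      exact edist_lt_ofReal.1 hz
    exact le_of_lt (hball this)
  · refine le_add_left ?_
    calc t' = t' / ε * ε := (ENNReal.div_mul_cancel hε ENNReal.ofReal_ne_top).symm
      _ ≤ t' / ε * edist x z := by gcongr
      _ ≤ _ := by gcongr

end InfConvolution

/-! ### The sub-mean value property -/

section SubMeanIntegral

variable {n : ℕ} {F : Set (Matrix (Fin n) (Fin n) ℝ)} {u : Eucl n → EReal} {X : Set (Eucl n)}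

theorem lowerSemicontinuousOn_toENNReal_sub {K : Set (Eucl n)} (hu : UpperSemicontinuousOn u K)
    (A : ℝ) : LowerSemicontinuousOn (fun y => ((A : EReal) - u y).toENNReal) K := by
  have h1 := hu.sub_coe (φ := fun _ => A) continuousOn_const
  have h2 : Continuous fun b : EReal => (-b).toENNReal :=
    EReal.continuous_toENNReal.comp continuous_neg
  have h3 := h2.comp_upperSemicontinuousOn_antitone h1
    (fun a b hab => EReal.toENNReal_le_toENNReal (EReal.neg_le_neg_iff.2 hab))
  have h4 : (fun y => ((A : EReal) - u y).toENNReal) =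
      (fun b : EReal => (-b).toENNReal) ∘ fun y => u y - (A : EReal) := by
    funext y
    simp only [Function.comp]
    rw [EReal.neg_sub (Or.inr (EReal.coe_ne_bot _)) (Or.inr (EReal.coe_ne_top _)), add_comm,
      sub_eq_add_neg]
  rw [h4]
  exact h3

theorem IsSubharmonicOn.translate (hu : IsSubharmonicOn F u X) (x : Eucl n) :
    IsSubharmonicOn F (fun y => u (y + x)) ((fun y => y + x) ⁻¹' X) where
  usc := by
    intro y hy c hc
    have h := hu.usc (y + x) hy c hc
    have hcont : Tendsto (fun z : Eucl n => z + x) (𝓝[(fun y => y + x) ⁻¹' X] y)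
        (𝓝[X] (y + x)) := by
      refine tendsto_nhdsWithin_iff.2 ⟨?_, ?_⟩
      · exact ((continuous_id.add continuous_const).tendsto y).mono_left nhdsWithin_le_nhds
      · filter_upwards [self_mem_nhdsWithin] with z hz using hz
    exact hcont.eventually h
  lt_top := fun y hy => hu.lt_top _ hy
  viscosity := by
    intro y hy φ hφ hle heq
    have hsub : ContinuousAt (fun z : Eucl n => z - x) (y + x) := by fun_prop
    have h1 : ContDiffAt ℝ 2 (fun z => φ (z - x)) (y + x) := by
      have hφ' : ContDiffAt ℝ 2 φ (y + x - x) := by rwa [add_sub_cancel_right]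
      exact hφ'.comp (y + x) (contDiffAt_id.sub contDiffAt_const)
    have h2 : ∀ᶠ z in 𝓝 (y + x), u z ≤ (φ (z - x) : EReal) := by
      have ht : Tendsto (fun z : Eucl n => z - x) (𝓝 (y + x)) (𝓝 y) := by
        have := hsub.tendsto
        rwa [add_sub_cancel_right] at this
      filter_upwards [ht.eventually hle] with z hz
      simpa using hz
    have h3 := hu.viscosity (y + x) hy _ h1 h2 (by simpa using heq)
    convert h3 using 1
    have hfd : fderiv ℝ (fun z => φ (z - x)) = fun z => fderiv ℝ φ (z - x) := by
      funext z
      exact fderiv_comp_sub x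
    simp only [hessian, hfd]
    ext i j
    simp only [Matrix.of_apply]
    rw [fderiv_comp_sub (f := fderiv ℝ φ) x, add_sub_cancel_right]

/-- Stated for `A - u` with values in `[0, ∞]`, the inequality makes sense before `u` is known to be
integrable, and integrability is later read off from it. It follows from the continuous case by
monotone convergence along inf-convolutions of `A - u`. -/
theorem IsSubharmonicOn.lintegral_kern_le_zero (hF : IsSubequation F) (hcone : HasConeProperty F)
    (hST : IsSTInvariant F) (hconv : Convex ℝ F) (hu : IsSubharmonicOn F u X) {s : ℝ}
    (hs : 0 < s) (hX : closedBall 0 s ⊆ X) {A : ℝ}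
    (hA : ∀ y ∈ closedBall (0 : Eucl n) s, u y ≤ (A : EReal)) :
    ∫⁻ y, ENNReal.ofReal (kern n s y) * ((A : EReal) - u y).toENNReal ≤
      ((A : EReal) - u 0).toENNReal := by
  classical
  rcases eq_or_ne (u 0) ⊥ with hbot | hbot
  · rw [hbot]; simp
  have htop : u 0 ≠ ⊤ := (hu.lt_top 0 (hX (mem_closedBall_self hs.le))).ne
  set b : ℝ := (u 0).toReal with hb
  have hub : u 0 = (b : EReal) := (EReal.coe_toReal htop hbot).symm
  set K : Set (Eucl n) := closedBall 0 s with hK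
  -- The value `⊤` off the closed ball makes `g` lower semicontinuous everywhere; it costs nothing
  -- because the kernel vanishes there.
  set g : Eucl n → ENNReal := fun y => if y ∈ K then ((A : EReal) - u y).toENNReal else ⊤ with hg
  have hglsc : LowerSemicontinuous g := by
    intro y c hc
    by_cases hy : y ∈ K
    · simp only [hg, if_pos hy] at hc
      have h := lowerSemicontinuousOn_toENNReal_sub (hu.usc.mono hX) A y hy c hc
      filter_upwards [eventually_nhdsWithin_iff.1 h] with z hz
      by_cases hzK : z ∈ K
      · simpa [hg, hzK] using hz hzK
      · simp only [hg, if_neg hzK]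
        exact hc.trans_le le_top
    · filter_upwards [isClosed_closedBall.isOpen_compl.mem_nhds hy] with z hz
      have hzK : z ∉ K := hz
      simp only [hg, if_neg hy] at hc
      simpa only [hg, if_neg hzK] using hc
  have hκm : Measurable fun y => ENNReal.ofReal (kern n s y) :=
    ENNReal.measurable_ofReal.comp (continuous_kern s).measurable
  have hbound : ∀ j, ∫⁻ y, ENNReal.ofReal (kern n s y) * infConv g j y ≤
      ((A : EReal) - u 0).toENNReal := by
    intro j
    have hfin : ∀ y, infConv g j y ≠ ⊤ := fun y =>
      ((infConv_le g j y).trans (min_le_right _ _)).trans_lt (ENNReal.natCast_lt_top j) |>.ne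
    set h : Eucl n → ℝ := fun y => (infConv g j y).toReal with hh
    have hhc : Continuous h := continuous_iff_continuousAt.2 fun y =>
      (ENNReal.tendsto_toReal (hfin y)).comp ((continuous_infConv g j).tendsto y)
    have h1 := hu.le_integral_of_continuous hF hcone hST hconv hs hX
      (φ := fun y => A - h y) (by fun_prop) (by
        intro y hy
        have h2 : infConv g j y ≤ ((A : EReal) - u y).toENNReal := by
          have := (infConv_le g j y).trans (min_le_left _ _)
          have hgy : g y = ((A : EReal) - u y).toENNReal := if_pos hy
          rwa [hgy] at this
        rcases eq_or_ne (u y) ⊥ with hyb | hyb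
        · rw [hyb]; exact bot_le
        have hyt : u y ≠ ⊤ := (hu.lt_top y (hX hy)).ne
        obtain ⟨c, hc⟩ : ∃ c : ℝ, u y = c := ⟨_, (EReal.coe_toReal hyt hyb).symm⟩
        have hcA : c ≤ A := by
          rw [← EReal.coe_le_coe_iff, ← hc]; exact hA y hy
        rw [hc, ← EReal.coe_sub, EReal.real_coe_toENNReal] at h2
        have h3 : h y ≤ A - c := ENNReal.toReal_le_of_le_ofReal (by linarith) h2
        rw [hc, EReal.coe_le_coe_iff]
        linarith)
    rw [hub, EReal.coe_le_coe_iff] at h1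
    have h4 : ∫ y, kern n s y * (A - h y) = A - ∫ y, kern n s y * h y := by
      simp only [mul_sub]
      rw [integral_sub ((integrable_kern hs).mul_const A) (integrable_kern_mul hs hhc),
        integral_mul_const, integral_kern hs, one_mul]
    rw [h4] at h1
    have h5 : ∀ y, ENNReal.ofReal (kern n s y) * infConv g j y =
        ENNReal.ofReal (kern n s y * h y) := by
      intro y
      rw [ENNReal.ofReal_mul (kern_nonneg hs y), hh, ENNReal.ofReal_toReal (hfin y)]
    simp only [h5]
    rw [← ofReal_integral_eq_lintegral_ofReal (integrable_kern_mul hs hhc)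
      (ae_of_all _ fun y => mul_nonneg (kern_nonneg hs y) ENNReal.toReal_nonneg), hub,
      ← EReal.coe_sub, EReal.real_coe_toENNReal]
    exact ENNReal.ofReal_le_ofReal (by linarith)
  calc ∫⁻ y, ENNReal.ofReal (kern n s y) * ((A : EReal) - u y).toENNReal
      = ∫⁻ y, ⨆ j, ENNReal.ofReal (kern n s y) * infConv g j y := by
        refine lintegral_congr fun y => ?_
        rw [← ENNReal.mul_iSup, iSup_infConv hglsc]
        by_cases hy : y ∈ K
        · simp only [hg, if_pos hy]
        · have : kern n s y = 0 :=
            kern_eq_zero hs (not_le.1 fun h => hy (mem_closedBall_zero_iff.2 h)).le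
          simp [this]
    _ = ⨆ j, ∫⁻ y, ENNReal.ofReal (kern n s y) * infConv g j y := by
        refine lintegral_iSup (fun j => hκm.mul (continuous_infConv g j).measurable) ?_
        intro i j hij y
        exact mul_le_mul' le_rfl (infConv_mono g hij y)
    _ ≤ _ := iSup_le hbound

/-- The sub-mean value property. -/
theorem IsSubharmonicOn.lintegral_kern_le (hF : IsSubequation F) (hcone : HasConeProperty F)
    (hST : IsSTInvariant F) (hconv : Convex ℝ F) (hu : IsSubharmonicOn F u X) {x : Eucl n} {s : ℝ}
    (hs : 0 < s) (hX : closedBall x s ⊆ X) {A : ℝ}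
    (hA : ∀ y ∈ closedBall x s, u y ≤ (A : EReal)) :
    ∫⁻ y, ENNReal.ofReal (kern n s (y - x)) * ((A : EReal) - u y).toENNReal ≤
      ((A : EReal) - u x).toENNReal := by
  have hmem : ∀ y ∈ closedBall (0 : Eucl n) s, y + x ∈ closedBall x s := by
    intro y hy
    rw [mem_closedBall_iff_norm, add_sub_cancel_right]
    exact mem_closedBall_zero_iff.1 hy
  have h := (hu.translate x).lintegral_kern_le_zero hF hcone hST hconv hs
    (fun y hy => hX (hmem y hy)) (fun y hy => hA _ (hmem y hy))
  rw [zero_add] at h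
  rw [← lintegral_add_right_eq_self _ x]
  simpa only [add_sub_cancel_right] using h

end SubMeanIntegral
end

/-! ### Local integrability and real representatives -/

noncomputable section

variable {n : ℕ}

theorem integrable_kern_sub_mul {v : Eucl n → ℝ} (hv : LocallyIntegrable v) {s : ℝ} (hs : 0 < s)
    (x : Eucl n) : Integrable fun y => kern n s (y - x) * v y := by
  have hc : Continuous fun y => kern n s (y - x) :=
    (continuous_kern s).comp (continuous_id.sub continuous_const)
  have hsupp : HasCompactSupport fun y => kern n s (y - x) := by
    refine HasCompactSupport.intro (isCompact_closedBall x s) fun y hy => ?_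
    rw [mem_closedBall_iff_norm, not_le] at hy
    exact kern_eq_zero hs hy.le
  exact hv.integrable_smul_left_of_hasCompactSupport hc hsupp

theorem integral_kern_sub {s : ℝ} (hs : 0 < s) (x : Eucl n) : ∫ y, kern n s (y - x) = 1 := by
  rw [integral_sub_right_eq_self (kern n s) x, integral_kern hs]

theorem integrable_kern_sub {s : ℝ} (hs : 0 < s) (x : Eucl n) :
    Integrable fun y => kern n s (y - x) :=
  (integrable_kern hs).comp_sub_right x

/-- The average of `w` around `x` with respect to the kernel of radius `s`. -/
def kernAvg (s : ℝ) (w : Eucl n → ℝ) (x : Eucl n) : ℝ := ∫ y, kern n s (y - x) * w y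

theorem kernAvg_comp_smul {r : ℝ} (hr : 0 < r) (s : ℝ) (w : Eucl n → ℝ) (x : Eucl n) :
    kernAvg s (fun y => w (r • y)) x = kernAvg (r * s) w (r • x) := by
  have h2 := Measure.integral_comp_smul (volume : Measure (Eucl n))
    (fun z => kern n (r * s) (z - r • x) * w z) r
  have h3 : ∀ y : Eucl n, kern n (r * s) (r • y - r • x) * w (r • y) =
      (r ^ n)⁻¹ * (kern n s (y - x) * w (r • y)) := by
    intro y
    rw [← smul_sub, kern_smul hr, mul_assoc]
  simp only [h3] at h2
  rw [integral_const_mul, finrank_euclideanSpace_fin, abs_of_pos (by positivity), smul_eq_mul] at h2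
  exact mul_left_cancel₀ (by positivity) h2

theorem kernAvg_mul_sub {w : Eucl n → ℝ} (hw : LocallyIntegrable w) {s : ℝ} (hs : 0 < s)
    (a c : ℝ) (x : Eucl n) :
    kernAvg s (fun y => a * (w y - c)) x = a * (kernAvg s w x - c) := by
  have h1 : ∀ y, kern n s (y - x) * (a * (w y - c)) =
      a * (kern n s (y - x) * w y - kern n s (y - x) * c) := fun y => by ring
  simp only [kernAvg, h1]
  rw [integral_const_mul, integral_sub (integrable_kern_sub_mul hw hs x)
    ((integrable_kern_sub hs x).mul_const c), integral_mul_const, integral_kern_sub hs, one_mul]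

/-- `u` is integrable on the ball of radius `ρ`, with real representative `v`, and has the sub-mean
value property there. -/
structure LocalSubmean (u : Eucl n → EReal) (v : Eucl n → ℝ) (ρ : ℝ) : Prop where
  pos : 0 < ρ
  integrable : Integrable v
  ae_eq : ∀ᵐ x, ‖x‖ ≤ ρ → u x = (v x : EReal)
  submean : ∀ x s, 0 < s → ‖x‖ + s ≤ ρ → u x ≤ ((∫ y, kern n s (y - x) * v y : ℝ) : EReal)
  usc : UpperSemicontinuousOn u (closedBall 0 ρ)

theorem UpperSemicontinuousOn.upperSemicontinuous_ite {α : Type*} [TopologicalSpace α]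
    {u : α → EReal} {K : Set α} [DecidablePred (· ∈ K)] (hK : IsClosed K)
    (hu : UpperSemicontinuousOn u K) :
    UpperSemicontinuous fun x => if x ∈ K then u x else ⊥ := by
  intro y c hc
  by_cases hy : y ∈ K
  · simp only [if_pos hy] at hc
    filter_upwards [eventually_nhdsWithin_iff.1 (hu y hy c hc)] with z hz
    by_cases hzK : z ∈ K
    · simpa only [if_pos hzK] using hz hzK
    · simp only [if_neg hzK]
      exact bot_le.trans_lt hc
  · filter_upwards [hK.isOpen_compl.mem_nhds hy] with z hz
    simp only [if_neg hy] at hc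
    have hzK : z ∉ K := hz
    simpa only [if_neg hzK] using hc

theorem IsSubharmonicOn.exists_bound {F : Set (Matrix (Fin n) (Fin n) ℝ)} {u : Eucl n → EReal}
    {X K : Set (Eucl n)} (hu : IsSubharmonicOn F u X) (hK : IsCompact K) (hKX : K ⊆ X) :
    ∃ A : ℝ, ∀ y ∈ K, u y ≤ (A : EReal) := by
  rcases K.eq_empty_or_nonempty with rfl | hne
  · exact ⟨0, fun y hy => absurd hy (notMem_empty y)⟩
  obtain ⟨x, hx, hmax⟩ := UpperSemicontinuousOn.exists_isMaxOn hne hK (hu.usc.mono hKX)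
  obtain ⟨A, hA, -⟩ := EReal.lt_iff_exists_real_btwn.1 (hu.lt_top x (hKX hx))
  exact ⟨A, fun y hy => (hmax hy).trans hA.le⟩

/-- The sub-mean inequality at one point `x₀` with `u x₀ > -∞` already yields integrability: the
ball of radius `ρ` lies within `2ρ` of `x₀`, where the kernel of radius `4ρ` is bounded below. The
factor `5` makes room for the ball of radius `4ρ` about `x₀`. -/
theorem IsSubharmonicOn.exists_localSubmean {F : Set (Matrix (Fin n) (Fin n) ℝ)}
    {u : Eucl n → EReal} {X : Set (Eucl n)} (hF : IsSubequation F) (hcone : HasConeProperty F)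
    (hST : IsSTInvariant F) (hconv : Convex ℝ F) (hu : IsSubharmonicOn F u X) {ρ : ℝ}
    (hρ : 0 < ρ) (hX : closedBall 0 (5 * ρ) ⊆ X) {x₀ : Eucl n} (hx₀ : ‖x₀‖ ≤ ρ)
    (hux₀ : u x₀ ≠ ⊥) : ∃ v, LocalSubmean u v ρ := by
  classical
  obtain ⟨A, hA⟩ := hu.exists_bound (isCompact_closedBall (0 : Eucl n) (5 * ρ)) hX
  set K : Set (Eucl n) := closedBall 0 ρ with hK
  have hK5 : K ⊆ closedBall 0 (5 * ρ) := closedBall_subset_closedBall (by linarith)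
  have huscK : UpperSemicontinuousOn u K := hu.usc.mono (hK5.trans hX)
  set w : Eucl n → EReal := fun y => if y ∈ K then u y else ⊥ with hw
  have hwm : Measurable w := (huscK.upperSemicontinuous_ite isClosed_closedBall).measurable
  set v : Eucl n → ℝ := fun y => (w y).toReal with hv
  have hvm : Measurable v := hwm.ereal_toReal
  have hvK : ∀ y ∈ K, v y = (u y).toReal := fun y hy => by simp [hv, hw, hy]
  have hvK' : ∀ y, y ∉ K → v y = 0 := fun y hy => by simp [hv, hw, hy]
  have hutop : ∀ y ∈ K, u y ≠ ⊤ := fun y hy => (hu.lt_top y (hX (hK5 hy))).ne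
  have hball : closedBall x₀ (4 * ρ) ⊆ closedBall 0 (5 * ρ) :=
    closedBall_subset_closedBall' (by rw [dist_zero_right]; linarith)
  have hmean := hu.lintegral_kern_le hF hcone hST hconv (by positivity : 0 < 4 * ρ)
    (hball.trans hX) (fun y hy => hA y (hball hy))
  have hfin : ((A : EReal) - u x₀).toENNReal ≠ ⊤ := by
    rw [EReal.toENNReal_ne_top_iff]
    induction h : u x₀ with
    | bot => exact absurd h hux₀
    | coe b => rw [← EReal.coe_sub]; exact EReal.coe_ne_top _
    | top => simp
  set c : ℝ := (kernMass n)⁻¹ * ((4 * ρ) ^ n)⁻¹ / 2 with hc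
  have hcpos : 0 < c := by have := kernMass_pos (n := n); positivity
  have hKint : ∫⁻ y in K, ((A : EReal) - u y).toENNReal ≠ ⊤ := by
    have h1 : ENNReal.ofReal c * ∫⁻ y in K, ((A : EReal) - u y).toENNReal ≤
        ((A : EReal) - u x₀).toENNReal := by
      rw [← lintegral_const_mul' _ _ ENNReal.ofReal_ne_top]
      refine le_trans ?_ hmean
      refine le_trans (setLIntegral_mono' measurableSet_closedBall fun y hy => ?_)
        (setLIntegral_le_lintegral K _)
      refine mul_le_mul' (ENNReal.ofReal_le_ofReal (le_kern (by positivity) ?_)) le_rfl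
      calc ‖y - x₀‖ ≤ ‖y‖ + ‖x₀‖ := norm_sub_le _ _
        _ ≤ 4 * ρ / 2 := by linarith [mem_closedBall_zero_iff.1 hy]
    intro h
    rw [h, ENNReal.mul_top (ENNReal.ofReal_pos.2 hcpos).ne', top_le_iff] at h1
    exact hfin h1
  have hae : ∀ᵐ x, ‖x‖ ≤ ρ → u x = (v x : EReal) := by
    have hmeas : AEMeasurable (fun y => ((A : EReal) - u y).toENNReal) (volume.restrict K) := by
      refine ⟨fun y => ((A : EReal) - w y).toENNReal,
        (measurable_const.sub hwm).ereal_toENNReal, ?_⟩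
      filter_upwards [ae_restrict_mem measurableSet_closedBall] with y hy
      have : y ∈ K := hy
      simp only [hw, if_pos this]
    have h1 := ae_lt_top' hmeas hKint
    filter_upwards [(ae_restrict_iff' measurableSet_closedBall).1 h1] with x hx hxρ
    have hxK : x ∈ K := mem_closedBall_zero_iff.2 hxρ
    have hxb : u x ≠ ⊥ := by
      intro h
      have := hx hxK
      rw [h] at this
      simp at this
    rw [hvK x hxK, EReal.coe_toReal (hutop x hxK) hxb]
  have hint : Integrable v := by
    refine ⟨hvm.aestronglyMeasurable, ?_⟩
    have h1 : ∫⁻ y, ‖v y‖ₑ ≤ ∫⁻ y in K, (ENNReal.ofReal |A| + ((A : EReal) - u y).toENNReal) := by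
      rw [← lintegral_indicator measurableSet_closedBall]
      refine lintegral_mono fun y => ?_
      by_cases hy : y ∈ K
      · rw [indicator_of_mem hy, hvK y hy]
        induction h : u y with
        | bot => simp
        | coe b =>
          have hbA : b ≤ A := by
            rw [← EReal.coe_le_coe_iff, ← h]; exact hA y (hK5 hy)
          rw [EReal.toReal_coe, ← EReal.coe_sub, EReal.real_coe_toENNReal,
            ← ENNReal.ofReal_add (abs_nonneg _) (by linarith), Real.enorm_eq_ofReal_abs]
          refine ENNReal.ofReal_le_ofReal ?_
          rw [abs_le]
          constructor <;> linarith [neg_abs_le A, le_abs_self A]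
        | top => exact absurd h (hutop y hy)
      · rw [hvK' y hy]; simp
    refine lt_of_le_of_lt h1 ?_
    rw [lintegral_add_left measurable_const, setLIntegral_const]
    refine ENNReal.add_lt_top.2 ⟨?_, lt_top_iff_ne_top.2 hKint⟩
    exact ENNReal.mul_lt_top ENNReal.ofReal_lt_top measure_closedBall_lt_top
  refine ⟨v, hρ, hint, hae, ?_, huscK⟩
  intro x s hs hxs
  have hsub : closedBall x s ⊆ K := closedBall_subset_closedBall' (by
    rw [dist_zero_right]; linarith)
  have hxK : x ∈ K := hsub (mem_closedBall_self hs.le)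
  rcases eq_or_ne (u x) ⊥ with hxb | hxb
  · rw [hxb]; exact bot_le
  obtain ⟨b, hb⟩ : ∃ b : ℝ, u x = b := ⟨_, (EReal.coe_toReal (hutop x hxK) hxb).symm⟩
  have hbA : b ≤ A := by
    rw [← EReal.coe_le_coe_iff, ← hb]; exact hA x (hK5 hxK)
  have h := hu.lintegral_kern_le hF hcone hST hconv hs ((hsub.trans hK5).trans hX)
    (fun y hy => hA y (hK5 (hsub hy)))
  have hpt : ∀ᵐ y, ENNReal.ofReal (kern n s (y - x)) * ((A : EReal) - u y).toENNReal =
      ENNReal.ofReal (kern n s (y - x) * (A - v y)) ∧ 0 ≤ kern n s (y - x) * (A - v y) := by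
    filter_upwards [hae] with y hy
    rcases le_or_gt s ‖y - x‖ with hd | hd
    · rw [kern_eq_zero hs hd]; simp
    · have hyK : y ∈ K := hsub (mem_closedBall_iff_norm.2 hd.le)
      have huy := hy (mem_closedBall_zero_iff.1 hyK)
      have hvA : v y ≤ A := by
        rw [← EReal.coe_le_coe_iff, ← huy]; exact hA y (hK5 hyK)
      refine ⟨?_, mul_nonneg (kern_nonneg hs _) (by linarith)⟩
      rw [huy, ← EReal.coe_sub, EReal.real_coe_toENNReal, ENNReal.ofReal_mul (kern_nonneg hs _)]
  have hi1 := (integrable_kern_sub hs x).mul_const A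
  have hi2 := integrable_kern_sub_mul hint.locallyIntegrable hs x
  have hi : Integrable fun y => kern n s (y - x) * (A - v y) := by
    simp only [mul_sub]
    exact hi1.sub hi2
  rw [lintegral_congr_ae (hpt.mono fun y hy => hy.1),
    ← ofReal_integral_eq_lintegral_ofReal hi (hpt.mono fun y hy => hy.2), hb, ← EReal.coe_sub,
    EReal.real_coe_toENNReal, ENNReal.ofReal_le_ofReal_iff (by linarith)] at h
  simp only [mul_sub] at h
  rw [integral_sub hi1 hi2, integral_mul_const, integral_kern_sub hs, one_mul] at h
  rw [hb, EReal.coe_le_coe_iff]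
  linarith

theorem exists_maxBall_eq {u : Eucl n → EReal} {r : ℝ} (hr : 0 ≤ r)
    (hu : UpperSemicontinuousOn u (closedBall 0 r)) : ∃ x, ‖x‖ ≤ r ∧ maxBall u r = u x := by
  obtain ⟨x, hx, hmax⟩ := hu.exists_isMaxOn ⟨0, mem_closedBall_self hr⟩
    (isCompact_closedBall (0 : Eucl n) r)
  refine ⟨x, mem_closedBall_zero_iff.1 hx, le_antisymm (maxBall_le fun y hy => ?_)
    (le_maxBall (mem_closedBall_zero_iff.1 hx))⟩
  exact hmax (mem_closedBall_zero_iff.2 hy)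

theorem IsSubharmonicOn.maxBall_eq_coe {F : Set (Matrix (Fin n) (Fin n) ℝ)} {u : Eucl n → EReal}
    {X : Set (Eucl n)} (hu : IsSubharmonicOn F u X)
    (hne : ¬ ∀ᶠ x in 𝓝 (0 : Eucl n), u x = ⊥) {r : ℝ} (hr : 0 < r) (hX : closedBall 0 r ⊆ X) :
    maxBall u r = ((maxBall u r).toReal : EReal) := by
  obtain ⟨x, hx, hmax⟩ := exists_maxBall_eq hr.le (hu.usc.mono hX)
  refine (EReal.coe_toReal ?_ ?_).symm
  · rw [hmax]; exact (hu.lt_top x (hX (mem_closedBall_zero_iff.2 hx))).ne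
  · intro hbot
    apply hne
    filter_upwards [closedBall_mem_nhds (0 : Eucl n) hr] with y hy
    exact le_bot_iff.1 (hbot ▸ le_maxBall (mem_closedBall_zero_iff.1 hy))
end

/-! ### Bounds for the tangential flow -/

noncomputable section

variable {n : ℕ}

/-- The germ at `0` of a function with a finite growth rate for the Riesz profile of index `p`. -/
structure FlowGerm (p : ℝ) (u : Eucl n → EReal) (v : Eucl n → ℝ) (ρ Λ : ℝ) : Prop
    extends LocalSubmean u v ρ where
  nonneg : 0 ≤ Λ
  maxBall_eq : ∀ r, 0 < r → r ≤ ρ → maxBall u r = ((maxBall u r).toReal : EReal)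
  growth : ∀ a b, 0 < a → a ≤ b → b ≤ ρ → (maxBall u b).toReal - (maxBall u a).toReal ≤
    Λ * (rieszProfile p b - rieszProfile p a)

/-- The constant subtracted in the tangential flow. -/
def flowShift (p : ℝ) (u : Eucl n → EReal) (r : ℝ) : ℝ :=
  if p = 2 then (maxBall u r).toReal else if p < 2 then (u 0).toReal else 0

/-- The tangential flow of a real representative. -/
def realFlow (p : ℝ) (u : Eucl n → EReal) (v : Eucl n → ℝ) (r : ℝ) (x : Eucl n) : ℝ :=
  r ^ (p - 2) * (v (r • x) - flowShift p u r)

theorem norm_smul_le_of_mul_le {r R c : ℝ} (hr : 0 < r) {x : Eucl n} (hx : ‖x‖ ≤ R)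
    (h : r * R ≤ c) : ‖r • x‖ ≤ c := by
  rw [norm_smul, Real.norm_eq_abs, abs_of_pos hr]
  exact (mul_le_mul_of_nonneg_left hx hr.le).trans h

theorem EReal.coe_mul_sub_le {a b c : ℝ} (ha : 0 ≤ a) {y : EReal} (hy : y ≤ (c : EReal)) :
    (a : EReal) * (y - (b : EReal)) ≤ ((a * (c - b) : ℝ) : EReal) := by
  rw [EReal.coe_mul, EReal.coe_sub]
  exact mul_le_mul_of_nonneg_left (EReal.sub_le_sub hy le_rfl) (by exact_mod_cast ha)

namespace FlowGerm

variable {p : ℝ} {u : Eucl n → EReal} {v : Eucl n → ℝ} {ρ Λ : ℝ}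

theorem le_coe_maxBall (h : FlowGerm p u v ρ Λ) {r : ℝ} (hr : 0 < r) (hrρ : r ≤ ρ) {x : Eucl n}
    (hx : ‖x‖ ≤ r) : u x ≤ ((maxBall u r).toReal : EReal) :=
  (le_maxBall hx).trans (h.maxBall_eq r hr hrρ).le

theorem maxBall_toReal_mono (h : FlowGerm p u v ρ Λ) {r s : ℝ} (hr : 0 < r) (hrs : r ≤ s)
    (hsρ : s ≤ ρ) : (maxBall u r).toReal ≤ (maxBall u s).toReal := by
  rw [← EReal.coe_le_coe_iff, ← h.maxBall_eq r hr (hrs.trans hsρ),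
    ← h.maxBall_eq s (hr.trans_le hrs) hsρ]
  exact maxBall_mono hrs

/-- Semicontinuity at `0` puts `M(u, a)` below any `c > u 0` for small `a`, and the growth from `a`
to `r` stays bounded as `a → 0` because the profile is nonnegative when `p < 2`. In particular `u 0`
is finite. -/
theorem maxBall_sub_le_zero (h : FlowGerm p u v ρ Λ) (hp : p < 2) {r : ℝ} (hr : 0 < r)
    (hrρ : r ≤ ρ) :
    (((maxBall u r).toReal - Λ / (2 - p) * r ^ (2 - p) : ℝ) : EReal) ≤ u 0 := by
  refine EReal.le_of_forall_lt_iff_le.1 fun c hc => ?_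
  have h0 : (0 : Eucl n) ∈ closedBall (0 : Eucl n) ρ := mem_closedBall_self h.pos.le
  obtain ⟨ε, hε, hball⟩ := Metric.mem_nhdsWithin_iff.1 (h.usc 0 h0 c hc)
  set a : ℝ := min (ε / 2) r with ha
  have hapos : 0 < a := lt_min (by positivity) hr
  have har : a ≤ r := min_le_right _ _
  have hma : (maxBall u a).toReal ≤ c := by
    rw [← EReal.coe_le_coe_iff, ← h.maxBall_eq a hapos (har.trans hrρ)]
    refine maxBall_le fun x hx => ?_
    have hx1 : x ∈ ball (0 : Eucl n) ε ∩ closedBall 0 ρ :=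
      ⟨mem_ball_zero_iff.2 (by linarith [min_le_left (ε / 2) r]),
        mem_closedBall_zero_iff.2 (by linarith)⟩
    exact (hball hx1).le
  have hg := h.growth a r hapos har hrρ
  simp only [rieszProfile, if_neg hp.ne] at hg
  have h1 : Λ * (r ^ (2 - p) / (2 - p) - a ^ (2 - p) / (2 - p)) ≤ Λ / (2 - p) * r ^ (2 - p) := by
    have h2 : 0 ≤ Λ * (a ^ (2 - p) / (2 - p)) :=
      mul_nonneg h.nonneg (div_nonneg (Real.rpow_nonneg hapos.le _) (by linarith))
    have h3 : Λ * (r ^ (2 - p) / (2 - p)) = Λ / (2 - p) * r ^ (2 - p) := by ring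
    linarith
  rw [EReal.coe_le_coe_iff]
  linarith

theorem apply_zero_eq (h : FlowGerm p u v ρ Λ) (hp : p < 2) : u 0 = ((u 0).toReal : EReal) := by
  refine (EReal.coe_toReal ?_ ?_).symm
  · exact ((h.le_coe_maxBall h.pos le_rfl (by rw [norm_zero]; exact h.pos.le)).trans_lt
      (EReal.coe_lt_top _)).ne
  · exact ((EReal.bot_lt_coe _).trans_le (h.maxBall_sub_le_zero hp h.pos le_rfl)).ne'

/-- The subtracted quantity is finite in all three cases, so a single formula with a real shift
serves throughout. -/
theorem tangentialFlow_eq (h : FlowGerm p u v ρ Λ) {r : ℝ} (hr : 0 < r) (hrρ : r ≤ ρ)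
    (x : Eucl n) : tangentialFlow p u r x =
      ((r ^ (p - 2) : ℝ) : EReal) * (u (r • x) - (flowShift p u r : EReal)) := by
  unfold tangentialFlow flowShift
  split_ifs with h1 h2
  · rw [h1, sub_self, Real.rpow_zero, EReal.coe_one, one_mul, ← h.maxBall_eq r hr hrρ]
  · rw [← h.apply_zero_eq h2]
  · rw [EReal.coe_zero, sub_zero]

theorem ae_tangentialFlow_eq (h : FlowGerm p u v ρ Λ) {r : ℝ} (hr : 0 < r) (hrρ : r ≤ ρ) :
    ∀ᵐ x : Eucl n, r * ‖x‖ ≤ ρ → tangentialFlow p u r x = (realFlow p u v r x : EReal) := by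
  have h1 := (Measure.quasiMeasurePreserving_smul (volume : Measure (Eucl n)) hr.ne').ae h.ae_eq
  filter_upwards [h1] with x hx hxρ
  rw [h.tangentialFlow_eq hr hrρ, hx (norm_smul_le_of_mul_le hr le_rfl hxρ), realFlow]
  norm_cast

/-- The tangential flow is uniformly bounded above on balls. -/
theorem exists_upper_bound (h : FlowGerm p u v ρ Λ) (R : ℝ) (hR : 1 ≤ R) :
    ∃ C : ℝ, ∀ r, 0 < r → r * R ≤ ρ → ∀ x : Eucl n, ‖x‖ ≤ R →
      tangentialFlow p u r x ≤ (C : EReal) := by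
  have hrρ : ∀ r, 0 < r → r * R ≤ ρ → r ≤ ρ := fun r hr hrR => by nlinarith
  have hu : ∀ r, 0 < r → r * R ≤ ρ → ∀ x : Eucl n, ‖x‖ ≤ R → tangentialFlow p u r x ≤
      ((r ^ (p - 2) * ((maxBall u (r * R)).toReal - flowShift p u r) : ℝ) : EReal) := by
    intro r hr hrR x hx
    rw [h.tangentialFlow_eq hr (hrρ r hr hrR)]
    exact EReal.coe_mul_sub_le (Real.rpow_nonneg hr.le _)
      (h.le_coe_maxBall (by positivity) hrR (norm_smul_le_of_mul_le hr hx le_rfl))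
  suffices hs : ∃ C : ℝ, ∀ r, 0 < r → r * R ≤ ρ →
      r ^ (p - 2) * ((maxBall u (r * R)).toReal - flowShift p u r) ≤ C by
    obtain ⟨C, hC⟩ := hs
    exact ⟨C, fun r hr hrR x hx => (hu r hr hrR x hx).trans (by exact_mod_cast hC r hr hrR)⟩
  -- For `p < 2`, `M(u, rR)` is compared with `u 0` and the powers of `r` cancel. For `p = 2` the
  -- growth from `r` to `rR` is at most `Λ log R`. For `p > 2` both `M(u, ·)` and `r^(p-2)` are
  -- increasing.
  rcases lt_trichotomy p 2 with hp | hp | hp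
  · refine ⟨Λ / (2 - p) * R ^ (2 - p), fun r hr hrR => ?_⟩
    have h1 := h.maxBall_sub_le_zero hp (by positivity : 0 < r * R) hrR
    rw [h.apply_zero_eq hp, EReal.coe_le_coe_iff] at h1
    simp only [flowShift, if_neg hp.ne, if_pos hp]
    have h2 : r ^ (p - 2) * (r * R) ^ (2 - p) = R ^ (2 - p) := by
      rw [Real.mul_rpow hr.le (by linarith), ← mul_assoc, ← Real.rpow_add hr]
      simp
    calc r ^ (p - 2) * ((maxBall u (r * R)).toReal - (u 0).toReal)
        ≤ r ^ (p - 2) * (Λ / (2 - p) * (r * R) ^ (2 - p)) :=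
          mul_le_mul_of_nonneg_left (by linarith) (Real.rpow_nonneg hr.le _)
      _ = Λ / (2 - p) * R ^ (2 - p) := by rw [← h2]; ring
  · refine ⟨Λ * Real.log R, fun r hr hrR => ?_⟩
    have h1 := h.growth r (r * R) hr (by nlinarith) hrR
    simp only [rieszProfile, if_pos hp] at h1
    rw [Real.log_mul hr.ne' (by linarith), add_sub_cancel_left] at h1
    simp only [flowShift, if_pos hp]
    rw [hp, sub_self, Real.rpow_zero, one_mul]
    exact h1
  · refine ⟨ρ ^ (p - 2) * |(maxBall u ρ).toReal|, fun r hr hrR => ?_⟩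
    simp only [flowShift, if_neg hp.ne', if_neg hp.not_gt, sub_zero]
    have h1 := h.maxBall_toReal_mono (by positivity : 0 < r * R) hrR le_rfl
    have h2 : r ^ (p - 2) ≤ ρ ^ (p - 2) :=
      Real.rpow_le_rpow hr.le (hrρ r hr hrR) (by linarith)
    calc r ^ (p - 2) * (maxBall u (r * R)).toReal
        ≤ r ^ (p - 2) * |(maxBall u ρ).toReal| :=
          mul_le_mul_of_nonneg_left (h1.trans (le_abs_self _)) (Real.rpow_nonneg hr.le _)
      _ ≤ _ := mul_le_mul_of_nonneg_right h2 (abs_nonneg _)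

/-- The tangential flow is bounded below at some points of the unit ball. -/
theorem exists_lower_bound (h : FlowGerm p u v ρ Λ) :
    ∃ C : ℝ, ∀ r, 0 < r → r ≤ ρ → ∃ z : Eucl n, ‖z‖ ≤ 1 ∧
      ((-C : ℝ) : EReal) ≤ tangentialFlow p u r z := by
  have hmax : ∀ r, 0 < r → r ≤ ρ → ∃ z : Eucl n, ‖z‖ ≤ 1 ∧
      u (r • z) = ((maxBall u r).toReal : EReal) := by
    intro r hr hrρ
    obtain ⟨x, hx, hxm⟩ := exists_maxBall_eq hr.le
      (h.usc.mono (closedBall_subset_closedBall hrρ))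
    refine ⟨r⁻¹ • x, ?_, ?_⟩
    · rw [norm_smul, norm_inv, Real.norm_eq_abs, abs_of_pos hr, inv_mul_le_iff₀ hr, mul_one]
      exact hx
    · rw [smul_smul, mul_inv_cancel₀ hr.ne', one_smul, ← hxm, ← h.maxBall_eq r hr hrρ]
  -- The point is the origin for `p < 2` and a rescaled maximum point otherwise. The flow vanishes
  -- there for `p ≤ 2`; for `p > 2` the growth bound from `r` to `ρ` keeps `r^(p-2) M(u, r)` bounded
  -- below.
  rcases lt_trichotomy p 2 with hp | hp | hp
  · refine ⟨0, fun r hr hrρ => ⟨0, by simp, ?_⟩⟩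
    rw [h.tangentialFlow_eq hr hrρ]
    simp only [flowShift, if_neg hp.ne, if_pos hp, smul_zero]
    rw [← h.apply_zero_eq hp, EReal.sub_self]
    · simp
    · rw [h.apply_zero_eq hp]; exact EReal.coe_ne_top _
    · rw [h.apply_zero_eq hp]; exact EReal.coe_ne_bot _
  · refine ⟨0, fun r hr hrρ => ?_⟩
    obtain ⟨z, hz, hzm⟩ := hmax r hr hrρ
    refine ⟨z, hz, ?_⟩
    rw [h.tangentialFlow_eq hr hrρ, hzm]
    simp only [flowShift, if_pos hp]
    rw [← EReal.coe_sub, sub_self]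
    simp
  · refine ⟨ρ ^ (p - 2) * |(maxBall u ρ).toReal| + Λ / (p - 2), fun r hr hrρ => ?_⟩
    obtain ⟨z, hz, hzm⟩ := hmax r hr hrρ
    refine ⟨z, hz, ?_⟩
    rw [h.tangentialFlow_eq hr hrρ, hzm]
    simp only [flowShift, if_neg hp.ne', if_neg hp.not_gt]
    rw [EReal.coe_zero, sub_zero, ← EReal.coe_mul, EReal.coe_le_coe_iff]
    have h1 := h.growth r ρ hr hrρ le_rfl
    simp only [rieszProfile, if_neg hp.ne'] at h1
    have h2 : r ^ (p - 2) ≤ ρ ^ (p - 2) := Real.rpow_le_rpow hr.le hrρ (by linarith)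
    have h3 : r ^ (p - 2) * r ^ (2 - p) = 1 := by rw [← Real.rpow_add hr]; simp
    have h0 : 0 ≤ r ^ (p - 2) := Real.rpow_nonneg hr.le _
    have hp' : 0 < p - 2 := by linarith
    have h4 : Λ * (ρ ^ (2 - p) / (2 - p) - r ^ (2 - p) / (2 - p)) ≤
        Λ / (p - 2) * r ^ (2 - p) := by
      have h5 : 0 ≤ Λ * (ρ ^ (2 - p) / (p - 2)) :=
        mul_nonneg h.nonneg (div_nonneg (Real.rpow_nonneg h.pos.le _) hp'.le)
      have h6 : Λ * (ρ ^ (2 - p) / (2 - p) - r ^ (2 - p) / (2 - p)) =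
          Λ / (p - 2) * r ^ (2 - p) - Λ * (ρ ^ (2 - p) / (p - 2)) := by
        rw [show (2 - p) = -(p - 2) by ring, div_neg, div_neg]
        ring
      linarith
    have h7 : r ^ (p - 2) * ((maxBall u ρ).toReal - Λ / (p - 2) * r ^ (2 - p)) ≤
        r ^ (p - 2) * (maxBall u r).toReal := mul_le_mul_of_nonneg_left (by linarith) h0
    have h8 : r ^ (p - 2) * ((maxBall u ρ).toReal - Λ / (p - 2) * r ^ (2 - p)) =
        r ^ (p - 2) * (maxBall u ρ).toReal - Λ / (p - 2) := by
      rw [mul_sub, mul_left_comm, h3, mul_one]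
    have h9 : -(ρ ^ (p - 2) * |(maxBall u ρ).toReal|) ≤ r ^ (p - 2) * (maxBall u ρ).toReal := by
      have := mul_le_mul h2 le_rfl (abs_nonneg (maxBall u ρ).toReal) (h0.trans h2)
      nlinarith [neg_abs_le (maxBall u ρ).toReal]
    linarith

theorem locallyIntegrable_realFlow (h : FlowGerm p u v ρ Λ) (r : ℝ) :
    LocallyIntegrable (realFlow p u v r) := by
  rcases eq_or_ne r 0 with rfl | hr
  · have : realFlow p u v 0 = fun _ : Eucl n => (0 : ℝ) ^ (p - 2) * (v 0 - flowShift p u 0) := by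
      ext x; rw [realFlow, zero_smul]
    rw [this]
    exact locallyIntegrable_const _
  · have h1 : Integrable fun x : Eucl n => v (r • x) := h.integrable.comp_smul hr
    have h2 : LocallyIntegrable fun x : Eucl n => v (r • x) - flowShift p u r :=
      h1.locallyIntegrable.sub (locallyIntegrable_const _)
    exact h2.smul (r ^ (p - 2))

/-- The sub-mean value property of the tangential flow. -/
theorem tangentialFlow_le (h : FlowGerm p u v ρ Λ) {r s : ℝ} (hr : 0 < r) (hrρ : r ≤ ρ)
    (hs : 0 < s) {x : Eucl n} (hx : r * (‖x‖ + s) ≤ ρ) :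
    tangentialFlow p u r x ≤ ((∫ y, kern n s (y - x) * realFlow p u v r y : ℝ) : EReal) := by
  have hvr : Integrable fun y : Eucl n => v (r • y) := h.integrable.comp_smul hr.ne'
  have h4 : ∫ y, kern n s (y - x) * realFlow p u v r y =
      r ^ (p - 2) * ((∫ z, kern n (r * s) (z - r • x) * v z) - flowShift p u r) := by
    refine (kernAvg_mul_sub hvr.locallyIntegrable hs _ _ x).trans ?_
    rw [kernAvg_comp_smul hr, kernAvg]
  rw [h4, h.tangentialFlow_eq hr hrρ]
  refine EReal.coe_mul_sub_le (Real.rpow_nonneg hr.le _) (h.submean _ _ (by positivity) ?_)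
  rw [norm_smul, Real.norm_eq_abs, abs_of_pos hr, ← mul_add]
  exact hx

/-- The tangential flow is bounded in `L¹` of balls. -/
theorem exists_integral_bound (h : FlowGerm p u v ρ Λ) {R : ℝ} (hR : 0 < R) :
    ∃ C : ℝ, ∀ r, 0 < r → r * (2 * R + 3) ≤ ρ →
      ∫ x in closedBall (0 : Eucl n) R, |realFlow p u v r x| ≤ C := by
  obtain ⟨A, hA⟩ := h.exists_upper_bound (2 * R + 3) (by linarith)
  obtain ⟨C', hC'⟩ := h.exists_lower_bound
  -- From any `z` in the unit ball, radius `s / 2 = R + 1` covers `B_R`, and the kernel's support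
  -- stays within `1 + s = 2R + 3` of the origin.
  set s : ℝ := 2 * (R + 1) with hs
  have hspos : 0 < s := by positivity
  set c : ℝ := (kernMass n)⁻¹ * (s ^ n)⁻¹ / 2 with hc
  have hcpos : 0 < c := by have := kernMass_pos (n := n); positivity
  set V : ℝ := (volume : Measure (Eucl n)).real (closedBall 0 R) with hV
  refine ⟨|A| * V + c⁻¹ * (A + C'), fun r hr hrR => ?_⟩
  have hrρ : r ≤ ρ := by nlinarith
  set W := realFlow p u v r with hW
  have hWl : LocallyIntegrable W := h.locallyIntegrable_realFlow r
  have hWA : ∀ᵐ x : Eucl n, ‖x‖ ≤ 2 * R + 3 → W x ≤ A := by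
    filter_upwards [h.ae_tangentialFlow_eq hr hrρ] with x hx hxR
    rw [← EReal.coe_le_coe_iff, ← hx ((mul_le_mul_of_nonneg_left hxR hr.le).trans hrR)]
    exact hA r hr hrR x hxR
  obtain ⟨z, hz, hzC⟩ := hC' r hr hrρ
  have hzs : ‖z‖ + s ≤ 2 * R + 3 := by linarith
  have h1 := hzC.trans (h.tangentialFlow_le hr hrρ hspos
    ((mul_le_mul_of_nonneg_left hzs hr.le).trans hrR))
  rw [EReal.coe_le_coe_iff] at h1
  have hi1 := (integrable_kern_sub hspos z).mul_const A
  have hi2 := integrable_kern_sub_mul hWl hspos z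
  have hi : Integrable fun y => kern n s (y - z) * (A - W y) := by
    simp only [mul_sub]
    exact hi1.sub hi2
  -- The sub-mean inequality at `z` turns the pointwise lower bound into an upper bound for the
  -- average of the nonnegative function `A - W`.
  have h2 : ∫ y, kern n s (y - z) * (A - W y) ≤ A + C' := by
    simp only [mul_sub]
    rw [integral_sub hi1 hi2, integral_mul_const, integral_kern_sub hspos, one_mul]
    linarith
  have hnn : ∀ᵐ y : Eucl n, 0 ≤ kern n s (y - z) * (A - W y) := by
    filter_upwards [hWA] with y hy
    rcases le_or_gt s ‖y - z‖ with hd | hd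
    · rw [kern_eq_zero hspos hd, zero_mul]
    · refine mul_nonneg (kern_nonneg hspos _) (sub_nonneg.2 (hy ?_))
      have := norm_le_norm_add_norm_sub' y z
      linarith
  have hWi : IntegrableOn W (closedBall 0 R) :=
    hWl.integrableOn_isCompact (isCompact_closedBall _ _)
  have hAi : IntegrableOn (fun _ : Eucl n => A) (closedBall 0 R) :=
    integrableOn_const measure_closedBall_lt_top.ne
  have hAi' : IntegrableOn (fun _ : Eucl n => |A|) (closedBall 0 R) :=
    integrableOn_const measure_closedBall_lt_top.ne
  have hAW : IntegrableOn (fun y => A - W y) (closedBall 0 R) := hAi.sub hWi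
  have h3 : c * ∫ y in closedBall (0 : Eucl n) R, (A - W y) ≤ A + C' := by
    rw [← integral_const_mul]
    refine le_trans ?_ ((setIntegral_le_integral hi hnn (s := closedBall 0 R)).trans h2)
    refine setIntegral_mono_on_ae (hAW.const_mul c) hi.integrableOn
      measurableSet_closedBall ?_
    filter_upwards [hWA] with y hy hyR
    have hyR' := mem_closedBall_zero_iff.1 hyR
    refine mul_le_mul_of_nonneg_right (le_kern hspos ?_) (sub_nonneg.2 (hy (by linarith)))
    calc ‖y - z‖ ≤ ‖y‖ + ‖z‖ := norm_sub_le _ _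
      _ ≤ s / 2 := by rw [hs]; linarith
  have h4 : ∫ y in closedBall (0 : Eucl n) R, (A - W y) ≤ c⁻¹ * (A + C') := by
    rwa [← div_eq_inv_mul, le_div_iff₀' hcpos]
  calc ∫ x in closedBall (0 : Eucl n) R, |W x|
      ≤ ∫ x in closedBall (0 : Eucl n) R, (|A| + (A - W x)) := by
        refine setIntegral_mono_on_ae hWi.abs (hAi'.add hAW) measurableSet_closedBall ?_
        filter_upwards [hWA] with y hy hyR
        have hyA := hy (by linarith [mem_closedBall_zero_iff.1 hyR])
        rw [abs_le]
        constructor <;> linarith [neg_abs_le A, le_abs_self A]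
    _ = |A| * V + ∫ x in closedBall (0 : Eucl n) R, (A - W x) := by
        rw [integral_add hAi' hAW, setIntegral_const, smul_eq_mul, mul_comm]
    _ ≤ _ := by linarith

end FlowGerm

/-- A subharmonic function which is not `-∞` near `0` defines a germ for the tangential flow of its
Riesz characteristic. -/
theorem IsSubharmonicOn.exists_flowGerm {F : Set (Matrix (Fin n) (Fin n) ℝ)} {u : Eucl n → EReal}
    {X : Set (Eucl n)} (hF : IsSubequation F) (hcone : HasConeProperty F)
    (hST : IsSTInvariant F) (hconv : Convex ℝ F) (hu : IsSubharmonicOn F u X) (hX : IsOpen X)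
    (h0 : (0 : Eucl n) ∈ X) (hne : ¬ ∀ᶠ x in 𝓝 (0 : Eucl n), u x = ⊥) :
    ∃ v ρ Λ, FlowGerm (rieszChar F) u v ρ Λ ∧ closedBall 0 ρ ⊆ X := by
  obtain ⟨ε, hε, hball⟩ := Metric.nhds_basis_closedBall.mem_iff.1 (hX.mem_nhds h0)
  -- Integrability on `B_ρ` uses `u` on `B_{5ρ}`; the growth bound uses only `B_{2ρ}`.
  set ρ : ℝ := ε / 5 with hρdef
  have hρ : 0 < ρ := by positivity
  have hX5 : closedBall (0 : Eucl n) (5 * ρ) ⊆ X := by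
    rwa [show 5 * ρ = ε by rw [hρdef]; ring]
  have hx₀ : ∃ x₀ : Eucl n, ‖x₀‖ ≤ ρ ∧ u x₀ ≠ ⊥ := by
    by_contra hcon
    push Not at hcon
    apply hne
    filter_upwards [closedBall_mem_nhds (0 : Eucl n) hρ] with y hy
    exact hcon y (mem_closedBall_zero_iff.1 hy)
  obtain ⟨x₀, hx₀, hux₀⟩ := hx₀
  obtain ⟨v, hv⟩ := hu.exists_localSubmean hF hcone hST hconv hρ hX5 hx₀ hux₀
  have hsub : ∀ r ≤ 5 * ρ, closedBall (0 : Eucl n) r ⊆ X := fun r hr =>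
    (closedBall_subset_closedBall hr).trans hX5
  have hm : ∀ r, 0 < r → r ≤ 2 * ρ → maxBall u r = ((maxBall u r).toReal : EReal) :=
    fun r hr hr2 => hu.maxBall_eq_coe hne hr (hsub r (by linarith))
  obtain ⟨Λ, hΛ, hgrowth⟩ := exists_growth_bound hF hcone hST hconv hu hρ
    (hsub _ (by linarith)) hm
  exact ⟨v, ρ, Λ, ⟨hv, hΛ, fun r hr hrρ => hm r hr (by linarith), hgrowth⟩,
    hsub _ (by linarith)⟩
end

/-! ### Compactness from the sub-mean property -/

noncomputable section

variable {n : ℕ}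

theorem kernAvg_indicator {s R : ℝ} (hs : 0 < s) (w : Eucl n → ℝ) {x : Eucl n}
    (hx : ‖x‖ + s ≤ R) : kernAvg s ((closedBall 0 R).indicator w) x = kernAvg s w x := by
  refine integral_congr_ae (ae_of_all _ fun y => ?_)
  by_cases hy : y ∈ closedBall (0 : Eucl n) R
  · simp only [indicator_of_mem hy]
  · have : s ≤ ‖y - x‖ := by
      rw [mem_closedBall_zero_iff, not_le] at hy
      have := norm_le_norm_add_norm_sub' y x
      linarith
    simp only [kern_eq_zero hs this, zero_mul]

theorem kernAvg_congr_ae {s : ℝ} {w w' : Eucl n → ℝ} (h : w =ᵐ[volume] w') (x : Eucl n) :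
    kernAvg s w x = kernAvg s w' x :=
  integral_congr_ae (h.mono fun y hy => by simp only [hy])

theorem abs_kernAvg_sub_le {s : ℝ} (hs : 0 < s) {w w' : Eucl n → ℝ} (hw : Integrable w)
    (hw' : Integrable w') (x : Eucl n) :
    |kernAvg s w x - kernAvg s w' x| ≤ (kernMass n)⁻¹ * (s ^ n)⁻¹ * ∫ y, |w y - w' y| := by
  have h1 : kernAvg s w x - kernAvg s w' x = ∫ y, kern n s (y - x) * (w y - w' y) := by
    simp only [mul_sub]
    exact (integral_sub (integrable_kern_sub_mul hw.locallyIntegrable hs x)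
      (integrable_kern_sub_mul hw'.locallyIntegrable hs x)).symm
  rw [h1, ← integral_const_mul, ← Real.norm_eq_abs]
  refine norm_integral_le_of_norm_le ((hw.sub hw').abs.const_mul _) (ae_of_all _ fun y => ?_)
  rw [norm_mul, Real.norm_eq_abs, Real.norm_eq_abs, abs_of_nonneg (kern_nonneg hs _)]
  exact mul_le_mul_of_nonneg_right (kern_le hs _) (abs_nonneg _)

theorem abs_kernAvg_le {s : ℝ} (hs : 0 < s) {w : Eucl n → ℝ} (hw : Integrable w) (x : Eucl n) :
    |kernAvg s w x| ≤ (kernMass n)⁻¹ * (s ^ n)⁻¹ * ∫ y, |w y| := by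
  have := abs_kernAvg_sub_le hs hw (integrable_zero _ _ _) x
  simpa [kernAvg] using this

/-- The uniform continuity of the kernel gives a modulus depending on `w` only through its `L¹`
norm: equicontinuity for Arzelà–Ascoli. -/
theorem exists_kernAvg_modulus {s : ℝ} (hs : 0 < s) {ε : ℝ} (hε : 0 < ε) :
    ∃ δ > 0, ∀ w : Eucl n → ℝ, Integrable w → ∀ x x', dist x x' < δ →
      |kernAvg s w x - kernAvg s w x'| ≤ ε * ∫ y, |w y| := by
  have huc := (hasCompactSupport_kern (n := n) hs).uniformContinuous_of_continuous
    (continuous_kern s)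
  obtain ⟨δ, hδ, h⟩ := Metric.uniformContinuous_iff.1 huc ε hε
  refine ⟨δ, hδ, fun w hw x x' hxx' => ?_⟩
  have h1 : kernAvg s w x - kernAvg s w x' =
      ∫ y, (kern n s (y - x) - kern n s (y - x')) * w y := by
    simp only [sub_mul]
    exact (integral_sub (integrable_kern_sub_mul hw.locallyIntegrable hs x)
      (integrable_kern_sub_mul hw.locallyIntegrable hs x')).symm
  rw [h1, ← integral_const_mul, ← Real.norm_eq_abs]
  refine norm_integral_le_of_norm_le (hw.abs.const_mul _) (ae_of_all _ fun y => ?_)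
  rw [norm_mul, Real.norm_eq_abs (w y)]
  refine mul_le_mul_of_nonneg_right ?_ (abs_nonneg _)
  rw [← dist_eq_norm]
  exact (h (by rwa [dist_sub_left])).le

theorem continuous_kernAvg {s : ℝ} (hs : 0 < s) {w : Eucl n → ℝ} (hw : LocallyIntegrable w) :
    Continuous (kernAvg s w) := by
  have hint : ∀ {w : Eucl n → ℝ}, Integrable w → Continuous (kernAvg s w) := by
    intro w hw
    refine Metric.continuous_iff.2 fun x ε hε => ?_
    set I := ∫ y, |w y| with hI
    have hI0 : 0 ≤ I := integral_nonneg fun y => abs_nonneg _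
    obtain ⟨δ, hδ, h⟩ := exists_kernAvg_modulus (n := n) hs
      (show 0 < ε / (I + 1) by positivity)
    refine ⟨δ, hδ, fun x' hx' => ?_⟩
    rw [Real.dist_eq]
    refine (h w hw x' x hx').trans_lt ?_
    rw [div_mul_eq_mul_div, div_lt_iff₀ (by positivity)]
    nlinarith
  refine continuous_iff_continuousAt.2 fun x => ?_
  set R : ℝ := ‖x‖ + 1 + s with hR
  have h1 : Integrable ((closedBall (0 : Eucl n) R).indicator w) :=
    (hw.integrableOn_isCompact (isCompact_closedBall _ _)).integrable_indicator
      measurableSet_closedBall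
  refine (hint h1).continuousAt.congr ?_
  filter_upwards [ball_mem_nhds x one_pos] with y hy
  refine kernAvg_indicator hs w ?_
  have := norm_le_norm_add_norm_sub' y x
  rw [mem_ball_iff_norm] at hy
  linarith

/-- A Lipschitz cutoff function, equal to `1` on the ball of radius `R` and supported in the ball
of radius `2R`. -/
def cutoff (R : ℝ) (x : Eucl n) : ℝ := max 0 (min 1 (2 - ‖x‖ / R))

theorem continuous_cutoff (R : ℝ) : Continuous (cutoff (n := n) R) := by
  unfold cutoff; fun_prop

theorem cutoff_nonneg (R : ℝ) (x : Eucl n) : 0 ≤ cutoff R x := le_max_left _ _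

theorem cutoff_eq_one {R : ℝ} (hR : 0 < R) {x : Eucl n} (hx : ‖x‖ ≤ R) : cutoff R x = 1 := by
  have : ‖x‖ / R ≤ 1 := (div_le_one hR).2 hx
  unfold cutoff
  rw [min_eq_left (by linarith), max_eq_right zero_le_one]

theorem cutoff_eq_zero {R : ℝ} (hR : 0 < R) {x : Eucl n} (hx : 2 * R ≤ ‖x‖) :
    cutoff R x = 0 := by
  have : 2 ≤ ‖x‖ / R := (le_div_iff₀ hR).2 hx
  unfold cutoff
  exact max_eq_left ((min_le_right _ _).trans (by linarith))

theorem abs_cutoff_sub_le {R : ℝ} (hR : 0 < R) (x y : Eucl n) :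
    |cutoff R x - cutoff R y| ≤ ‖x - y‖ / R := by
  unfold cutoff
  have h0 := abs_max_sub_max_le_max 0 (min 1 (2 - ‖x‖ / R)) 0 (min 1 (2 - ‖y‖ / R))
  rw [sub_self, abs_zero, max_eq_right (a := (0 : ℝ)) (b := |_|) (abs_nonneg _)] at h0
  refine h0.trans ?_
  have h1 := abs_min_sub_min_le_max 1 (2 - ‖x‖ / R) 1 (2 - ‖y‖ / R)
  rw [sub_self, abs_zero, max_eq_right (abs_nonneg _)] at h1
  refine h1.trans ?_
  rw [sub_sub_sub_cancel_left, ← sub_div, abs_div, abs_of_pos hR]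
  refine div_le_div_of_nonneg_right ?_ hR.le
  rw [norm_sub_rev]
  exact abs_norm_sub_norm_le y x

theorem hasCompactSupport_cutoff {R : ℝ} (hR : 0 < R) : HasCompactSupport (cutoff (n := n) R) := by
  refine HasCompactSupport.intro (isCompact_closedBall (0 : Eucl n) (2 * R)) fun y hy => ?_
  rw [mem_closedBall_zero_iff, not_le] at hy
  exact cutoff_eq_zero hR hy.le

theorem integrable_cutoff {R : ℝ} (hR : 0 < R) : Integrable (cutoff (n := n) R) :=
  (continuous_cutoff R).integrable_of_hasCompactSupport (hasCompactSupport_cutoff hR)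

/-- Averaging is self-adjoint, by Fubini and the evenness of the kernel. -/
theorem integral_cutoff_mul_kernAvg {s R : ℝ} (hs : 0 < s) (hR : 0 < R) {w : Eucl n → ℝ}
    (hw : Integrable w) :
    ∫ x, cutoff R x * kernAvg s w x = ∫ y, kernAvg s (cutoff R) y * w y := by
  have hi : Integrable (Function.uncurry fun x y : Eucl n =>
      cutoff R x * (kern n s (y - x) * w y)) (volume.prod volume) := by
    have h1 := (integrable_cutoff (n := n) hR).mul_prod hw
    have hc : Continuous fun z : Eucl n × Eucl n => kern n s (z.2 - z.1) :=
      (continuous_kern s).comp (continuous_snd.sub continuous_fst)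
    have h2 := h1.bdd_mul (c := (kernMass n)⁻¹ * (s ^ n)⁻¹) hc.aestronglyMeasurable
      (ae_of_all _ fun z => by
        rw [Real.norm_eq_abs, abs_of_nonneg (kern_nonneg hs _)]; exact kern_le hs _)
    refine h2.congr (ae_of_all _ fun z => ?_)
    simp only [Function.uncurry]
    ring
  have h := integral_integral_swap hi
  calc ∫ x, cutoff R x * kernAvg s w x
      = ∫ x, ∫ y, cutoff R x * (kern n s (y - x) * w y) := by
        refine integral_congr_ae (ae_of_all _ fun x => ?_)
        simp only [kernAvg, integral_const_mul]
    _ = ∫ y, ∫ x, cutoff R x * (kern n s (y - x) * w y) := h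
    _ = ∫ y, kernAvg s (cutoff R) y * w y := by
        refine integral_congr_ae (ae_of_all _ fun y => ?_)
        simp only [kernAvg]
        rw [← integral_mul_const]
        refine integral_congr_ae (ae_of_all _ fun x => ?_)
        simp only [kern_sub_comm s y x]
        ring

theorem abs_kernAvg_cutoff_sub_le {s R : ℝ} (hs : 0 < s) (hR : 0 < R) (y : Eucl n) :
    |kernAvg s (cutoff R) y - cutoff R y| ≤ s / R := by
  have h1 : kernAvg s (cutoff R) y - cutoff R y =
      ∫ x, kern n s (x - y) * (cutoff R x - cutoff R y) := by
    simp only [mul_sub]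
    rw [integral_sub (integrable_kern_sub_mul (integrable_cutoff hR).locallyIntegrable hs y)
      ((integrable_kern_sub hs y).mul_const _), integral_mul_const, integral_kern_sub hs, one_mul,
      kernAvg]
  have h2 : ∫ x, kern n s (x - y) * (s / R) = s / R := by
    rw [integral_mul_const, integral_kern_sub hs, one_mul]
  rw [h1, ← Real.norm_eq_abs, ← h2]
  refine norm_integral_le_of_norm_le ((integrable_kern_sub hs y).mul_const _)
    (ae_of_all _ fun x => ?_)
  rw [norm_mul, Real.norm_eq_abs, Real.norm_eq_abs, abs_of_nonneg (kern_nonneg hs _)]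
  rcases le_or_gt s ‖x - y‖ with h | h
  · rw [kern_eq_zero hs h]; simp
  · exact mul_le_mul_of_nonneg_left ((abs_cutoff_sub_le hR x y).trans
      (div_le_div_of_nonneg_right h.le hR.le)) (kern_nonneg hs _)

/-- For functions with the sub-mean value property, averaging is uniformly close to the identity
in `L¹`. -/
theorem integral_abs_kernAvg_sub_le {s R : ℝ} (hs : 0 < s) (hR : 0 < R) {w : Eucl n → ℝ}
    (hw : Integrable w) (hsub : ∀ᵐ x, ‖x‖ ≤ 2 * R → w x ≤ kernAvg s w x) :
    ∫ x in closedBall 0 R, |kernAvg s w x - w x| ≤ s / R * ∫ y, |w y| := by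
  have hc := continuous_kernAvg hs hw.locallyIntegrable
  have hi1 : Integrable fun x => cutoff R x * kernAvg s w x :=
    ((continuous_cutoff R).mul hc).integrable_of_hasCompactSupport
      (hasCompactSupport_cutoff hR).mul_right
  have hcb : ∀ x : Eucl n, ‖cutoff R x‖ ≤ 1 := fun x => by
    rw [Real.norm_eq_abs, abs_of_nonneg (cutoff_nonneg R x)]
    exact max_le zero_le_one (min_le_left _ _)
  have hi2 : Integrable fun x => cutoff R x * w x :=
    hw.bdd_mul (c := 1) (continuous_cutoff R).aestronglyMeasurable (ae_of_all _ hcb)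
  have hi : Integrable fun x => cutoff R x * (kernAvg s w x - w x) := by
    simp only [mul_sub]; exact hi1.sub hi2
  have hnn : ∀ᵐ x, 0 ≤ cutoff R x * (kernAvg s w x - w x) := by
    filter_upwards [hsub] with x hx
    rcases le_or_gt ‖x‖ (2 * R) with h | h
    · exact mul_nonneg (cutoff_nonneg R x) (sub_nonneg.2 (hx h))
    · rw [cutoff_eq_zero hR h.le, zero_mul]
  have hkc : Continuous (kernAvg s (cutoff (n := n) R)) :=
    continuous_kernAvg hs (integrable_cutoff hR).locallyIntegrable
  have hi3 : Integrable fun y => kernAvg s (cutoff R) y * w y :=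
    hw.bdd_mul (c := (kernMass n)⁻¹ * (s ^ n)⁻¹ * ∫ y : Eucl n, |cutoff R y|)
      hkc.aestronglyMeasurable
      (ae_of_all _ fun y => abs_kernAvg_le hs (integrable_cutoff hR) y)
  -- Nonnegativity of the integrand removes the absolute value and permits passing from `B_R` to the
  -- cutoff. Self-adjointness then moves the averaging onto the cutoff, which is Lipschitz with
  -- constant `1 / R`.
  calc ∫ x in closedBall 0 R, |kernAvg s w x - w x|
      = ∫ x in closedBall 0 R, cutoff R x * (kernAvg s w x - w x) := by
        refine setIntegral_congr_ae measurableSet_closedBall ?_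
        filter_upwards [hsub] with x hx hxR
        have hxR' := mem_closedBall_zero_iff.1 hxR
        rw [cutoff_eq_one hR hxR', one_mul, abs_of_nonneg (sub_nonneg.2 (hx (by linarith)))]
    _ ≤ ∫ x, cutoff R x * (kernAvg s w x - w x) := setIntegral_le_integral hi hnn
    _ = ∫ y, (kernAvg s (cutoff R) y - cutoff R y) * w y := by
        simp only [mul_sub, sub_mul]
        rw [integral_sub hi1 hi2, integral_sub hi3 hi2, integral_cutoff_mul_kernAvg hs hR hw]
    _ ≤ ∫ y, s / R * |w y| := by
        refine integral_mono_ae ?_ (hw.abs.const_mul _) (ae_of_all _ fun y => ?_)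
        · simp only [sub_mul]; exact hi3.sub hi2
        · refine (le_abs_self _).trans ?_
          rw [abs_mul]
          exact mul_le_mul_of_nonneg_right (abs_kernAvg_cutoff_sub_le hs hR y) (abs_nonneg _)
    _ = s / R * ∫ y, |w y| := integral_const_mul _ _

open BoundedContinuousFunction in
/-- The averages of an `L¹`-bounded family form a totally bounded family for the uniform norm on
balls. -/
theorem exists_finite_kernAvg_discretization {s : ℝ} (hs : 0 < s) (R C : ℝ) {δ : ℝ}
    (hδ : 0 < δ) : ∃ (β : Type) (_ : Fintype β) (Ψ : (Eucl n → ℝ) → β), ∀ w w',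
      Integrable w → Integrable w' → ∫ y, |w y| ≤ C → ∫ y, |w' y| ≤ C → Ψ w = Ψ w' →
        ∀ x : Eucl n, ‖x‖ ≤ R → |kernAvg s w x - kernAvg s w' x| ≤ δ := by
  classical
  let α := closedBall (0 : Eucl n) R
  have : CompactSpace α := isCompact_iff_compactSpace.1 (isCompact_closedBall _ _)
  let A : Set (α →ᵇ ℝ) := {f | ∃ w : Eucl n → ℝ, Integrable w ∧ ∫ y, |w y| ≤ C ∧
    ∀ x : α, f x = kernAvg s w x}
  set M := (kernMass n)⁻¹ * (s ^ n)⁻¹ with hM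
  have hM0 : 0 < M := by have := kernMass_pos (n := n); positivity
  have hA : IsCompact (closure A) := by
    refine arzela_ascoli (Icc (-(M * C)) (M * C)) isCompact_Icc A ?_ ?_
    · rintro f x ⟨w, hw, hwC, hfw⟩
      rw [hfw]
      exact abs_le.1 ((abs_kernAvg_le hs hw _).trans (mul_le_mul_of_nonneg_left hwC hM0.le))
    · refine (Metric.uniformEquicontinuous_iff.2 fun ε hε => ?_).equicontinuous
      have hC1 : 0 < |C| + 1 := by positivity
      obtain ⟨η, hη, h⟩ := exists_kernAvg_modulus (n := n) hs (div_pos hε hC1)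
      refine ⟨η, hη, ?_⟩
      rintro x y hxy ⟨f, w, hw, hwC, hfw⟩
      simp only
      rw [hfw, hfw, Real.dist_eq]
      refine (h w hw x y hxy).trans_lt ?_
      rw [div_mul_eq_mul_div, div_lt_iff₀ hC1]
      nlinarith [le_abs_self C]
  have htb := (hA.totallyBounded.subset subset_closure)
  obtain ⟨t, ht, hcov⟩ := Metric.totallyBounded_iff.1 htb (δ / 2) (by positivity)
  have : Fintype t := ht.fintype
  -- A function is labelled by the set of all net elements within `δ / 2` of its average. This set
  -- is non-empty for admissible functions, so equal labels share a net element.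
  let Ψ : (Eucl n → ℝ) → Set t := fun w => {f | ∀ x : α, |(f : α →ᵇ ℝ) x - kernAvg s w x| ≤ δ / 2}
  have : Fintype (Set t) := Fintype.ofFinite _
  let e := Fintype.equivFin (Set t)
  refine ⟨Fin (Fintype.card (Set t)), inferInstance, fun w => e (Ψ w), ?_⟩
  intro w w' hw hw' hwC hwC' heq x hx
  have heq' : Ψ w = Ψ w' := e.injective heq
  let fw : α →ᵇ ℝ := mkOfCompact ⟨fun x : α => kernAvg s w x,
    (continuous_kernAvg hs hw.locallyIntegrable).comp continuous_subtype_val⟩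
  have hfw : fw ∈ A := ⟨w, hw, hwC, fun x => rfl⟩
  obtain ⟨f, hft, hfd⟩ := mem_iUnion₂.1 (hcov hfw)
  have h1 : (⟨f, hft⟩ : t) ∈ Ψ w := by
    intro z
    have h2 := (BoundedContinuousFunction.dist_coe_le_dist (f := fw) (g := f) z).trans
      (mem_ball.1 hfd).le
    rw [dist_comm, Real.dist_eq] at h2
    exact h2
  have h3 : (⟨f, hft⟩ : t) ∈ Ψ w' := heq' ▸ h1
  have hxα : x ∈ closedBall (0 : Eucl n) R := mem_closedBall_zero_iff.2 hx
  have h4 : |f ⟨x, hxα⟩ - kernAvg s w x| ≤ δ / 2 := h1 ⟨x, hxα⟩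
  have h5 : |f ⟨x, hxα⟩ - kernAvg s w' x| ≤ δ / 2 := h3 ⟨x, hxα⟩
  rw [abs_le] at h4 h5 ⊢
  constructor <;> linarith

/-- An `L¹`-bounded family of functions with the sub-mean value property is totally bounded in
`L¹` of a smaller ball. -/
theorem totallyBounded_of_submean {R C : ℝ} (hR : 0 < R)
    {S : Set (Lp ℝ 1 ((volume : Measure (Eucl n)).restrict (closedBall 0 R)))}
    (hS : ∀ f ∈ S, ∃ w : Eucl n → ℝ, Integrable w ∧ ∫ y, |w y| ≤ C ∧
      (∀ s, 0 < s → s ≤ R → ∀ᵐ x, ‖x‖ ≤ 2 * R → w x ≤ kernAvg s w x) ∧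
      f =ᵐ[(volume : Measure (Eucl n)).restrict (closedBall 0 R)] w) : TotallyBounded S := by
  refine Metric.totallyBounded_of_finite_discretization fun ε hε => ?_
  choose! w hw hwC hsub hfw using hS
  set V : ℝ := (volume : Measure (Eucl n)).real (closedBall 0 R) with hV
  have hV0 : 0 ≤ V := measureReal_nonneg
  have hC1 : 0 < |C| + 1 := by positivity
  -- With this `s`, replacing each function by its average costs at most `ε / 8`; the uniform
  -- closeness of the averages costs at most `ε / 4`.
  set s : ℝ := min R (ε * R / (8 * (|C| + 1))) with hs
  have hspos : 0 < s := lt_min hR (by positivity)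
  have hsC : s / R * C ≤ ε / 8 := by
    have h1 : s ≤ ε * R / (8 * (|C| + 1)) := min_le_right _ _
    have h2 : s / R ≤ ε / (8 * (|C| + 1)) := by
      rw [div_le_iff₀ hR]; refine h1.trans_eq ?_; ring
    calc s / R * C ≤ s / R * (|C| + 1) :=
          mul_le_mul_of_nonneg_left (by linarith [le_abs_self C]) (by positivity)
      _ ≤ ε / (8 * (|C| + 1)) * (|C| + 1) := mul_le_mul_of_nonneg_right h2 hC1.le
      _ = ε / 8 := by field_simp
  obtain ⟨β, hβ, Ψ, hΨ⟩ := exists_finite_kernAvg_discretization (n := n) hspos R C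
    (show 0 < ε / (4 * (V + 1)) by positivity)
  refine ⟨β, hβ, fun f => Ψ (w f), ?_⟩
  rintro ⟨f, hf⟩ ⟨g, hg⟩ hfg
  simp only at hfg ⊢
  have hΨ' := hΨ (w f) (w g) (hw f hf) (hw g hg) (hwC f hf) (hwC g hg) hfg
  rw [L1.dist_eq_integral_dist]
  have hcont : ∀ h ∈ S, Continuous (kernAvg s (w h)) := fun h hh =>
    continuous_kernAvg hspos (hw h hh).locallyIntegrable
  have hclose : ∀ h ∈ S, ∫ x in closedBall 0 R, |kernAvg s (w h) x - w h x| ≤ ε / 8 := by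
    intro h hh
    refine (integral_abs_kernAvg_sub_le hspos hR (hw h hh)
      (hsub h hh s hspos (min_le_left _ _))).trans (le_trans ?_ hsC)
    exact mul_le_mul_of_nonneg_left (hwC h hh) (by positivity)
  have hki : ∀ h ∈ S, IntegrableOn (fun x => |kernAvg s (w h) x - w h x|) (closedBall 0 R) := by
    intro h hh
    have h1 : IntegrableOn (kernAvg s (w h)) (closedBall 0 R) :=
      (hcont h hh).continuousOn.integrableOn_compact (isCompact_closedBall _ _)
    exact (h1.sub (hw h hh).integrableOn).abs
  have hci : IntegrableOn (fun _ : Eucl n => ε / (4 * (V + 1))) (closedBall 0 R) :=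
    integrableOn_const measure_closedBall_lt_top.ne
  have hsum : IntegrableOn (fun x => |kernAvg s (w f) x - w f x| + |kernAvg s (w g) x - w g x|)
      (closedBall 0 R) := (hki f hf).add (hki g hg)
  calc ∫ x in closedBall 0 R, dist (f x) (g x)
      ≤ ∫ x in closedBall 0 R, (|kernAvg s (w f) x - w f x| + |kernAvg s (w g) x - w g x| +
          ε / (4 * (V + 1))) := by
        refine integral_mono_ae ?_ (hsum.add hci) ?_
        · simp only [dist_eq_norm]
          exact ((L1.integrable_coeFn f).sub (L1.integrable_coeFn g)).norm
        · filter_upwards [hfw f hf, hfw g hg, ae_restrict_mem measurableSet_closedBall] with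
            x h1 h2 hx
          rw [h1, h2, Real.dist_eq]
          have h3 := hΨ' x (mem_closedBall_zero_iff.1 hx)
          have e : w f x - w g x = -(kernAvg s (w f) x - w f x) + (kernAvg s (w g) x - w g x) +
              (kernAvg s (w f) x - kernAvg s (w g) x) := by ring
          rw [e]
          refine (abs_add_three _ _ _).trans ?_
          rw [abs_neg]
          linarith
    _ = (∫ x in closedBall 0 R, |kernAvg s (w f) x - w f x|) +
          (∫ x in closedBall 0 R, |kernAvg s (w g) x - w g x|) + V * (ε / (4 * (V + 1))) := by
        rw [integral_add hsum hci, integral_add (hki f hf) (hki g hg),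
          setIntegral_const, smul_eq_mul]
    _ < ε := by
        have h1 := hclose f hf
        have h2 := hclose g hg
        have h3 : V * (ε / (4 * (V + 1))) ≤ ε / 4 := by
          rw [mul_div_assoc', div_le_div_iff₀ (by positivity) (by positivity)]
          nlinarith
        linarith

namespace FlowGerm

variable {p : ℝ} {u : Eucl n → EReal} {v : Eucl n → ℝ} {ρ Λ : ℝ}

theorem ae_realFlow_le_kernAvg (h : FlowGerm p u v ρ Λ) {r s : ℝ} (hr : 0 < r) (hrρ : r ≤ ρ)
    (hs : 0 < s) : ∀ᵐ x : Eucl n, r * (‖x‖ + s) ≤ ρ →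
      realFlow p u v r x ≤ kernAvg s (realFlow p u v r) x := by
  filter_upwards [h.ae_tangentialFlow_eq hr hrρ] with x hx hxs
  have h1 := h.tangentialFlow_le hr hrρ hs hxs
  rw [hx (by nlinarith)] at h1
  exact EReal.coe_le_coe_iff.1 h1

/-- The tangential flow is totally bounded in `L¹` on balls. -/
theorem totallyBounded_realFlow (h : FlowGerm p u v ρ Λ) {R δ : ℝ} (hR : 0 < R)
    (hδ : δ * (8 * R + 3) ≤ ρ) :
    TotallyBounded {f : Lp ℝ 1 ((volume : Measure (Eucl n)).restrict (closedBall 0 R)) |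
      ∃ r, 0 < r ∧ r ≤ δ ∧
        f =ᵐ[(volume : Measure (Eucl n)).restrict (closedBall 0 R)] realFlow p u v r} := by
  -- The flow is truncated to `B_{4R}`: for `‖x‖ ≤ 2R` and `s ≤ R` the averages do not see the
  -- truncation. The bound on `B_{4R}` accounts for the factor `8R + 3 = 2(4R) + 3`.
  obtain ⟨C, hC⟩ := h.exists_integral_bound (show 0 < 4 * R by positivity)
  refine totallyBounded_of_submean (C := C) hR ?_
  rintro f ⟨r, hr, hrδ, hf⟩
  have hrR : r * (8 * R + 3) ≤ ρ :=
    (mul_le_mul_of_nonneg_right hrδ (by positivity)).trans hδ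
  have hrρ : r ≤ ρ := by nlinarith
  refine ⟨(closedBall 0 (4 * R)).indicator (realFlow p u v r), ?_, ?_, ?_, ?_⟩
  · exact ((h.locallyIntegrable_realFlow r).integrableOn_isCompact
      (isCompact_closedBall _ _)).integrable_indicator measurableSet_closedBall
  · have e : (fun y => |(closedBall (0 : Eucl n) (4 * R)).indicator (realFlow p u v r) y|) =
        (closedBall (0 : Eucl n) (4 * R)).indicator fun y => |realFlow p u v r y| := by
      ext y; by_cases hy : y ∈ closedBall (0 : Eucl n) (4 * R) <;> simp [hy]
    rw [e, integral_indicator measurableSet_closedBall]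
    exact hC r hr (by linarith)
  · intro s hs hsR
    filter_upwards [h.ae_realFlow_le_kernAvg hr hrρ hs] with x hx hxR
    rw [kernAvg_indicator hs _ (by linarith),
      indicator_of_mem (mem_closedBall_zero_iff.2 (by linarith))]
    exact hx (le_trans (mul_le_mul_of_nonneg_left (by linarith) hr.le) hrR)
  · filter_upwards [hf, ae_restrict_mem measurableSet_closedBall] with x hx hxR
    rw [hx, indicator_of_mem (closedBall_subset_closedBall (by linarith) hxR)]

end FlowGerm

end

/-! ### The topology of `L¹_loc` -/

noncomputable section

/-- The intersection of a directed family of compact connected sets is connected. -/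
theorem isConnected_iInter_of_directed {α ι : Type*} [TopologicalSpace α] [T2Space α] [Nonempty ι]
    {t : ι → Set α} (hd : Directed (· ⊇ ·) t) (hc : ∀ i, IsCompact (t i))
    (hconn : ∀ i, IsConnected (t i)) : IsConnected (⋂ i, t i) := by
  have hcl : ∀ i, IsClosed (t i) := fun i => (hc i).isClosed
  refine ⟨IsCompact.nonempty_iInter_of_directed_nonempty_isCompact_isClosed t hd
    (fun i => (hconn i).nonempty) hc hcl, ?_⟩
  have hK : IsClosed (⋂ i, t i) := isClosed_iInter hcl
  have hKc : IsCompact (⋂ i, t i) :=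
    (hc (Classical.arbitrary ι)).of_isClosed_subset hK (iInter_subset _ _)
  rw [isPreconnected_iff_subset_of_fully_disjoint_closed hK]
  intro A B hA hB hAB hdis0
  have hAc := hKc.inter_right hA
  have hBc := hKc.inter_right hB
  have hd' : Disjoint ((⋂ i, t i) ∩ A) ((⋂ i, t i) ∩ B) := by
    exact hdis0.mono inter_subset_right inter_subset_right
  obtain ⟨U, V, hU, hV, hAU, hBV, hUV⟩ := SeparatedNhds.of_isCompact_isCompact hAc hBc hd'
  -- By compactness some `t i` already lies in `U ∪ V`, and its connectedness puts it in one of the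
  -- two.
  obtain ⟨i, hi⟩ := exists_subset_nhds_of_isCompact' hd hc hcl (U := U ∪ V) fun x hx => by
    refine (hU.union hV).mem_nhds ?_
    rcases hAB hx with h | h
    · exact Or.inl (hAU ⟨hx, h⟩)
    · exact Or.inr (hBV ⟨hx, h⟩)
  have hKi : (⋂ i, t i) ⊆ t i := iInter_subset _ _
  rcases isPreconnected_iff_subset_of_disjoint.1 (hconn i).isPreconnected U V hU hV hi
    (by rw [hUV.inter_eq, inter_empty]) with h | h
  · refine Or.inl fun x hx => (hAB hx).resolve_right fun hxB => ?_
    exact disjoint_left.1 hUV (h (hKi hx)) (hBV ⟨hx, hxB⟩)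
  · refine Or.inr fun x hx => (hAB hx).resolve_left fun hxA => ?_
    exact disjoint_left.1 hUV (hAU ⟨hx, hxA⟩) (h (hKi hx))

variable {n : ℕ}

namespace L1loc

/-- The class of a locally integrable function. -/
def mk (w : Eucl n → ℝ) (hw : LocallyIntegrable w) : L1loc n :=
  ⟨AEEqFun.mk w hw.aestronglyMeasurable,
    hw.congr (AEEqFun.coeFn_mk w hw.aestronglyMeasurable).symm⟩

theorem coeFn_mk (w : Eucl n → ℝ) (hw : LocallyIntegrable w) : (mk w hw).1 =ᵐ[volume] w :=
  AEEqFun.coeFn_mk _ _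

theorem coeFn_restrict (R : ℝ) (f : L1loc n) :
    f.restrict R =ᵐ[(volume : Measure (Eucl n)).restrict (closedBall 0 R)] f.1 :=
  Integrable.coeFn_toL1 _

theorem integrableOn (f : L1loc n) (R : ℝ) : IntegrableOn f.1 (closedBall 0 R) :=
  f.2.integrableOn_isCompact (isCompact_closedBall _ _)

theorem dist_restrict (R : ℝ) (f g : L1loc n) :
    dist (f.restrict R) (g.restrict R) = ∫ x in closedBall 0 R, |f.1 x - g.1 x| := by
  rw [L1.dist_eq_integral_dist]
  refine integral_congr_ae ?_
  filter_upwards [coeFn_restrict R f, coeFn_restrict R g] with x h1 h2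
  rw [h1, h2, Real.dist_eq]

theorem dist_restrict_mono {R R' : ℝ} (h : R ≤ R') (f g : L1loc n) :
    dist (f.restrict R) (g.restrict R) ≤ dist (f.restrict R') (g.restrict R') := by
  rw [dist_restrict, dist_restrict]
  exact setIntegral_mono_set ((f.integrableOn R').sub (g.integrableOn R')).abs
    (ae_of_all _ fun x => abs_nonneg _) (closedBall_subset_closedBall h).eventuallyLE

theorem nhds_eq (f : L1loc n) :
    𝓝 f = ⨅ R : ℝ, comap (L1loc.restrict R) (𝓝 (f.restrict R)) := by
  rw [nhds_iInf]
  simp only [nhds_induced]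

theorem tendsto_iff {α : Type*} {l : Filter α} {Φ : α → L1loc n} {f : L1loc n} :
    Tendsto Φ l (𝓝 f) ↔ ∀ R : ℝ, 0 < R →
      Tendsto (fun a => ∫ x in closedBall 0 R, |(Φ a).1 x - f.1 x|) l (𝓝 0) := by
  have h1 : Tendsto Φ l (𝓝 f) ↔ ∀ R : ℝ,
      Tendsto (fun a => dist ((Φ a).restrict R) (f.restrict R)) l (𝓝 0) := by
    rw [nhds_eq, tendsto_iInf]
    refine forall_congr' fun R => ?_
    rw [tendsto_comap_iff, tendsto_iff_dist_tendsto_zero]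
    rfl
  rw [h1]
  simp only [← dist_restrict]
  refine ⟨fun h R _ => h R, fun h R => ?_⟩
  exact squeeze_zero (fun _ => dist_nonneg) (fun a => dist_restrict_mono (le_max_left R 1) _ _)
    (h (max R 1) (lt_max_of_lt_right one_pos))

theorem continuous_restrict (R : ℝ) : Continuous (L1loc.restrict (n := n) R) :=
  continuous_iff_le_induced.2 (iInf_le _ R)

/-- The restrictions to the balls of integer radius. -/
def restrictAll (f : L1loc n) (N : ℕ) :
    Lp ℝ 1 ((volume : Measure (Eucl n)).restrict (closedBall 0 N)) := f.restrict N

/-- Restriction to a smaller ball does not increase distances, so integer radii determine the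
topology. This places `L¹_loc` in a countable product of metric spaces. -/
theorem isInducing_restrictAll : IsInducing (restrictAll (n := n)) := by
  refine isInducing_iff_nhds.2 fun f => ?_
  refine le_antisymm ?_ ?_
  · rw [← map_le_iff_le_comap]
    exact (continuous_pi fun N : ℕ => continuous_restrict (n := n) N).tendsto f
  · rw [nhds_eq]
    refine le_iInf fun R => ?_
    rw [← map_le_iff_le_comap]
    obtain ⟨N, hN⟩ := exists_nat_ge R
    refine tendsto_iff_dist_tendsto_zero.2 ?_
    refine squeeze_zero (fun _ => dist_nonneg) (fun a => dist_restrict_mono hN _ _) ?_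
    have h1 : Tendsto (restrictAll (n := n)) (comap restrictAll (𝓝 (restrictAll f)))
      (𝓝 (restrictAll f)) := tendsto_comap
    exact tendsto_iff_dist_tendsto_zero.1 (tendsto_pi_nhds.1 h1 N)

theorem ae_of_forall_restrict {P : Eucl n → Prop}
    (h : ∀ N : ℕ, ∀ᵐ x ∂(volume : Measure (Eucl n)).restrict (closedBall 0 N), P x) :
    ∀ᵐ x : Eucl n, P x := by
  have h1 : ∀ᵐ x : Eucl n, ∀ N : ℕ, x ∈ closedBall (0 : Eucl n) N → P x :=
    ae_all_iff.2 fun N => (ae_restrict_iff' measurableSet_closedBall).1 (h N)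
  filter_upwards [h1] with x hx
  obtain ⟨N, hN⟩ := exists_nat_ge ‖x‖
  exact hx N (mem_closedBall_zero_iff.2 hN)

theorem ext {f g : L1loc n} (h : f.1 =ᵐ[volume] g.1) : f = g := Subtype.ext (AEEqFun.ext h)

theorem injective_restrictAll : Function.Injective (restrictAll (n := n)) := by
  intro f g hfg
  refine ext (ae_of_forall_restrict fun N => ?_)
  have h := congrFun hfg N
  simp only [restrictAll] at h
  filter_upwards [coeFn_restrict N f, coeFn_restrict N g] with x h1 h2
  rw [← h1, ← h2, h]

/-- Limits on the various balls agree almost everywhere on overlaps, because they are limits of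
restrictions of the same functions; so they glue. -/
theorem isClosed_range_restrictAll : IsClosed (range (restrictAll (n := n))) := by
  refine isClosed_of_closure_subset fun F hF => ?_
  obtain ⟨y, hy, hlim⟩ := mem_closure_iff_seq_limit.1 hF
  choose f hf using hy
  have hlim' : ∀ N : ℕ, Tendsto (fun j => ∫ x in closedBall (0 : Eucl n) N,
      |(f j).1 x - F N x|) atTop (𝓝 0) := by
    intro N
    have h1 := tendsto_iff_dist_tendsto_zero.1 (tendsto_pi_nhds.1 hlim N)
    refine h1.congr fun j => ?_
    rw [L1.dist_eq_integral_dist, ← hf j]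
    refine integral_congr_ae ?_
    filter_upwards [coeFn_restrict N (f j)] with x hx
    rw [Real.dist_eq, restrictAll, hx]
  have hFi : ∀ N : ℕ, IntegrableOn (F N) (closedBall 0 N) := fun N => L1.integrable_coeFn (F N)
  have hcompat : ∀ N M : ℕ, N ≤ M → ∀ᵐ x : Eucl n, ‖x‖ ≤ N → F M x = F N x := by
    intro N M hNM
    have hsub : closedBall (0 : Eucl n) N ⊆ closedBall 0 M :=
      closedBall_subset_closedBall (by exact_mod_cast hNM)
    have hMi : IntegrableOn (F M) (closedBall 0 N) := (hFi M).mono_set hsub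
    have hint : IntegrableOn (fun x => |F M x - F N x|) (closedBall 0 N) := (hMi.sub (hFi N)).abs
    have h0 : ∫ x in closedBall (0 : Eucl n) N, |F M x - F N x| = 0 := by
      refine le_antisymm ?_ (integral_nonneg fun x => abs_nonneg _)
      have hsum := (hlim' M).add (hlim' N)
      rw [add_zero] at hsum
      refine ge_of_tendsto' hsum fun j => ?_
      have hM1 : IntegrableOn (fun x => |(f j).1 x - F M x|) (closedBall 0 M) :=
        (((f j).integrableOn M).sub (hFi M)).abs
      have hN1 : IntegrableOn (fun x => |(f j).1 x - F N x|) (closedBall 0 N) :=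
        (((f j).integrableOn N).sub (hFi N)).abs
      calc ∫ x in closedBall (0 : Eucl n) N, |F M x - F N x|
          ≤ ∫ x in closedBall (0 : Eucl n) N, (|(f j).1 x - F M x| + |(f j).1 x - F N x|) := by
            refine integral_mono hint ((hM1.mono_set hsub).add hN1) fun x => ?_
            have := abs_sub_le (F M x) ((f j).1 x) (F N x)
            rwa [abs_sub_comm (F M x) ((f j).1 x)] at this
        _ = (∫ x in closedBall (0 : Eucl n) N, |(f j).1 x - F M x|) +
              ∫ x in closedBall (0 : Eucl n) N, |(f j).1 x - F N x| :=
            integral_add (hM1.mono_set hsub) hN1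
        _ ≤ _ := add_le_add_left (setIntegral_mono_set hM1 (ae_of_all _ fun x => abs_nonneg _)
              hsub.eventuallyLE) _
    have h1 := (integral_eq_zero_iff_of_nonneg (fun x => abs_nonneg _) hint).1 h0
    filter_upwards [(ae_restrict_iff' measurableSet_closedBall).1 h1] with x hx hxN
    have h2 := hx (mem_closedBall_zero_iff.2 hxN)
    simpa [sub_eq_zero] using h2
  -- At `x` the limit on the smallest integer ball containing `x` is used.
  set g : Eucl n → ℝ := fun x => F ⌈‖x‖⌉₊ x with hg
  have hgF : ∀ N : ℕ, g =ᵐ[(volume : Measure (Eucl n)).restrict (closedBall 0 N)] F N := by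
    intro N
    have h1 : ∀ᵐ x : Eucl n, ∀ K : ℕ, K ≤ N → ‖x‖ ≤ K → F N x = F K x :=
      ae_all_iff.2 fun K => by
        by_cases hK : K ≤ N
        · filter_upwards [hcompat K N hK] with x hx _ using hx
        · exact ae_of_all _ fun x h => absurd h hK
    refine (ae_restrict_iff' measurableSet_closedBall).2 ?_
    filter_upwards [h1] with x hx hxN
    exact (hx ⌈‖x‖⌉₊ (Nat.ceil_le.2 (mem_closedBall_zero_iff.1 hxN)) (Nat.le_ceil _)).symm
  have hgl : LocallyIntegrable g := by
    intro x
    obtain ⟨N, hN⟩ := exists_nat_gt ‖x‖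
    refine ⟨closedBall 0 N, closedBall_mem_nhds_of_mem (mem_ball_zero_iff.2 hN), ?_⟩
    exact (hFi N).congr (hgF N).symm
  refine ⟨mk g hgl, ?_⟩
  ext1 N
  refine Lp.ext ?_
  filter_upwards [coeFn_restrict N (mk g hgl), ae_restrict_of_ae (coeFn_mk g hgl), hgF N] with
    x h1 h2 h3
  rw [restrictAll, h1, h2, h3]

theorem isClosedEmbedding_restrictAll : IsClosedEmbedding (restrictAll (n := n)) :=
  ⟨⟨isInducing_restrictAll, injective_restrictAll⟩, isClosed_range_restrictAll⟩

instance : T2Space (L1loc n) := isClosedEmbedding_restrictAll.isEmbedding.t2Space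

instance : FirstCountableTopology (L1loc n) :=
  isInducing_restrictAll.firstCountableTopology

theorem totallyBounded_restrict_mono {R R' : ℝ} (h : R ≤ R') {S : Set (L1loc n)}
    (hS : TotallyBounded (L1loc.restrict R' '' S)) : TotallyBounded (L1loc.restrict R '' S) := by
  refine Metric.totallyBounded_iff.2 fun ε hε => ?_
  obtain ⟨t, htS, htf, hcov⟩ := Metric.finite_approx_of_totallyBounded hS ε hε
  obtain ⟨t', ht'S, ht'f, rfl⟩ := exists_subset_image_finite_and.1 ⟨t, htS, htf, rfl⟩
  refine ⟨L1loc.restrict R '' t', ht'f.image _, ?_⟩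
  rintro _ ⟨f, hf, rfl⟩
  obtain ⟨_, ⟨g, hg, rfl⟩, hfg⟩ := mem_iUnion₂.1 (hcov (mem_image_of_mem _ hf))
  exact mem_iUnion₂.2 ⟨_, mem_image_of_mem _ hg, (dist_restrict_mono h f g).trans_lt hfg⟩

/-- Tychonoff in the product of the spaces `L¹(B_N)`, pulled back along the closed embedding. -/
theorem isCompact_closure {S : Set (L1loc n)}
    (h : ∀ R : ℝ, 0 < R → TotallyBounded (L1loc.restrict R '' S)) : IsCompact (closure S) := by
  have h' : ∀ N : ℕ, TotallyBounded (L1loc.restrict (n := n) N '' S) := by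
    intro N
    -- Passing through `N + 1` covers `N = 0`, where the hypothesis says nothing.
    exact totallyBounded_restrict_mono (le_add_of_nonneg_right zero_le_one)
      (h (N + 1) (by positivity))
  have hK : IsCompact (univ.pi fun N : ℕ => closure (L1loc.restrict (n := n) N '' S)) :=
    isCompact_univ_pi fun N => (h' N).closure.isCompact_of_isClosed isClosed_closure
  refine (isClosedEmbedding_restrictAll.isCompact_preimage hK).closure_of_subset fun f hf => ?_
  exact fun N _ => subset_closure (mem_image_of_mem _ hf)

end L1loc

end

/-! ### The flow as a curve and its cluster set -/

noncomputable section

variable {n : ℕ}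

/-- Dilations act continuously in `L¹`. -/
theorem MeasureTheory.Integrable.tendsto_integral_abs_comp_smul_sub {v : Eucl n → ℝ}
    (hv : Integrable v) {a : ℝ} (ha : 0 < a) :
    Tendsto (fun r : ℝ => ∫ x, |v (r • x) - v (a • x)|) (𝓝 a) (𝓝 0) := by
  have hscale : ∀ {g : Eucl n → ℝ}, Integrable g → ∀ r, a / 2 < r →
      ∫ x, |g (r • x)| ≤ ((a / 2) ^ n)⁻¹ * ∫ x, |g x| := by
    intro g hg r hr
    have hr0 : 0 < r := (half_pos ha).trans hr
    have h1 := Measure.integral_comp_smul (volume : Measure (Eucl n)) (fun x => |g x|) r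
    rw [finrank_euclideanSpace_fin, abs_of_pos (by positivity), smul_eq_mul] at h1
    rw [h1]
    refine mul_le_mul_of_nonneg_right ?_ (integral_nonneg fun x => abs_nonneg _)
    exact inv_anti₀ (by positivity) (pow_le_pow_left₀ (by positivity) hr.le n)
  have hcont : ∀ {g : Eucl n → ℝ}, Continuous g → HasCompactSupport g →
      Tendsto (fun r : ℝ => ∫ x, |g (r • x) - g (a • x)|) (𝓝 a) (𝓝 0) := by
    intro g hg hgs
    obtain ⟨M, hM⟩ := hg.bounded_above_of_compact_support hgs
    obtain ⟨K, hK⟩ := hgs.isCompact.isBounded.exists_pos_norm_le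
    have hK0 := hK.1
    have hzero : ∀ r, a / 2 < r → ∀ x : Eucl n, x ∉ closedBall (0 : Eucl n) (2 * K / a) →
        g (r • x) = 0 := by
      intro r hr x hx
      refine image_eq_zero_of_notMem_tsupport fun h => ?_
      have h1 := hK.2 _ h
      have hr0 : 0 < r := (half_pos ha).trans hr
      rw [norm_smul, Real.norm_eq_abs, abs_of_pos hr0] at h1
      rw [mem_closedBall_zero_iff, not_le, div_lt_iff₀ ha] at hx
      nlinarith [norm_nonneg x]
    have h0 : ∫ x, |g (a • x) - g (a • x)| = 0 := by simp
    rw [← h0]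
    have hae : ∀ᶠ r in 𝓝 a, a / 2 < r := lt_mem_nhds (by linarith)
    refine tendsto_integral_filter_of_dominated_convergence
      ((closedBall (0 : Eucl n) (2 * K / a)).indicator fun _ => 2 * M) ?_ ?_ ?_ ?_
    · refine Eventually.of_forall fun r => ?_
      have : Continuous fun x : Eucl n => |g (r • x) - g (a • x)| := by fun_prop
      exact this.aestronglyMeasurable
    · filter_upwards [hae] with r hr
      refine ae_of_all _ fun x => ?_
      by_cases hx : x ∈ closedBall (0 : Eucl n) (2 * K / a)
      · rw [indicator_of_mem hx, Real.norm_eq_abs, abs_abs]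
        have h1 := hM (r • x)
        have h2 := hM (a • x)
        rw [Real.norm_eq_abs] at h1 h2
        exact (abs_sub _ _).trans (by linarith)
      · rw [indicator_of_notMem hx, hzero r hr x hx, hzero a (by linarith) x hx]
        simp
    · exact (integrableOn_const (C := 2 * M) (measure_closedBall_lt_top
        (μ := (volume : Measure (Eucl n)))).ne).integrable_indicator measurableSet_closedBall
    · refine ae_of_all _ fun x => ?_
      have : Continuous fun r : ℝ => |g (r • x) - g (a • x)| := by fun_prop
      exact this.tendsto a
  rw [Metric.tendsto_nhds]
  intro ε hε
  set c : ℝ := ((a / 2) ^ n)⁻¹ with hc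
  have hc0 : 0 < c := by positivity
  -- Density of compactly supported continuous functions; the approximation error survives dilation
  -- because `hscale` is uniform in `r > a / 2`.
  obtain ⟨g, hgs, hgv, hg, hgi⟩ :=
    hv.exists_hasCompactSupport_integral_sub_le (show 0 < ε / (4 * c) by positivity)
  filter_upwards [(hcont hg hgs).eventually (gt_mem_nhds (show 0 < ε / 4 by positivity)),
    lt_mem_nhds (show a / 2 < a by linarith)] with r hr har
  have hr0 : 0 < r := (half_pos ha).trans har
  rw [Real.dist_eq, sub_zero, abs_of_nonneg (integral_nonneg fun x => abs_nonneg _)]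
  have hvg : Integrable fun x => v x - g x := hv.sub hgi
  have h1 : ∀ r, a / 2 < r → ∫ x, |v (r • x) - g (r • x)| ≤ ε / 4 := by
    intro r hr
    refine (hscale hvg r hr).trans ?_
    calc c * ∫ x, |v x - g x| ≤ c * (ε / (4 * c)) := mul_le_mul_of_nonneg_left hgv hc0.le
      _ = ε / 4 := by field_simp
  have hi : ∀ r, a / 2 < r → Integrable fun x : Eucl n => |v (r • x) - g (r • x)| := fun r hr =>
    (hvg.comp_smul ((half_pos ha).trans hr).ne').abs
  have hgi' : Integrable fun x : Eucl n => |g (r • x) - g (a • x)| :=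
    ((hgi.comp_smul hr0.ne').sub (hgi.comp_smul ha.ne')).abs
  have hsum : Integrable fun x : Eucl n =>
      |v (r • x) - g (r • x)| + |g (r • x) - g (a • x)| := (hi r har).add hgi'
  calc ∫ x, |v (r • x) - v (a • x)|
      ≤ ∫ x, (|v (r • x) - g (r • x)| + |g (r • x) - g (a • x)| + |v (a • x) - g (a • x)|) := by
        refine integral_mono ((hv.comp_smul hr0.ne').sub (hv.comp_smul ha.ne')).abs
          (hsum.add (hi a (by linarith))) fun x => ?_
        have e : v (r • x) - v (a • x) = (v (r • x) - g (r • x)) + (g (r • x) - g (a • x)) +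
          -(v (a • x) - g (a • x)) := by ring
        simp only
        rw [e]
        refine (abs_add_three _ _ _).trans ?_
        rw [abs_neg]
    _ = (∫ x, |v (r • x) - g (r • x)|) + (∫ x, |g (r • x) - g (a • x)|) +
          ∫ x, |v (a • x) - g (a • x)| := by
        rw [integral_add hsum (hi a (by linarith)), integral_add (hi r har) hgi']
    _ < ε := by
        have h2 := h1 r har
        have h3 := h1 a (by linarith)
        linarith

namespace FlowGerm

variable {p : ℝ} {u : Eucl n → EReal} {v : Eucl n → ℝ} {ρ Λ : ℝ}

theorem abs_maxBall_sub_le (h : FlowGerm p u v ρ Λ) {a b : ℝ} (ha : 0 < a) (haρ : a ≤ ρ)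
    (hb : 0 < b) (hbρ : b ≤ ρ) : |(maxBall u b).toReal - (maxBall u a).toReal| ≤
      Λ * |rieszProfile p b - rieszProfile p a| := by
  wlog hab : a ≤ b generalizing a b
  · rw [abs_sub_comm, abs_sub_comm (rieszProfile p b)]
    exact this hb hbρ ha haρ (le_of_not_ge hab)
  rw [abs_of_nonneg (sub_nonneg.2 (h.maxBall_toReal_mono ha hab hbρ))]
  exact (h.growth a b ha hab hbρ).trans (mul_le_mul_of_nonneg_left (le_abs_self _) h.nonneg)

/-- Only `p = 2` has content: the growth bound makes `M(u, ·)` Lipschitz as a function of `log r`.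
-/
theorem continuousOn_flowShift (h : FlowGerm p u v ρ Λ) :
    ContinuousOn (flowShift p u) (Ioc 0 ρ) := by
  unfold flowShift
  split_ifs with hp
  · intro a ha
    refine tendsto_iff_dist_tendsto_zero.2 ?_
    have hlog : Tendsto (fun b => Λ * |Real.log b - Real.log a|) (𝓝[Ioc 0 ρ] a) (𝓝 0) := by
      have h1 : ContinuousAt (fun b => Λ * |Real.log b - Real.log a|) a :=
        (((Real.continuousAt_log ha.1.ne').sub continuousAt_const).abs).const_mul Λ
      have h2 := h1.tendsto.mono_left (nhdsWithin_le_nhds (s := Ioc 0 ρ))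
      simpa using h2
    refine squeeze_zero' (Eventually.of_forall fun _ => dist_nonneg) ?_ hlog
    filter_upwards [self_mem_nhdsWithin] with b hb
    have := h.abs_maxBall_sub_le ha.1 ha.2 hb.1 hb.2
    simpa only [rieszProfile, if_pos hp, Real.dist_eq] using this
  · exact continuousOn_const
  · exact continuousOn_const

/-- The tangential flow as a curve in `L¹_loc`. -/
def flowClass (h : FlowGerm p u v ρ Λ) (r : ℝ) : L1loc n :=
  L1loc.mk (realFlow p u v r) (h.locallyIntegrable_realFlow r)

theorem coeFn_flowClass (h : FlowGerm p u v ρ Λ) (r : ℝ) :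
    (h.flowClass r).1 =ᵐ[volume] realFlow p u v r := L1loc.coeFn_mk _ _

theorem continuousOn_flowClass (h : FlowGerm p u v ρ Λ) :
    ContinuousOn h.flowClass (Ioc 0 ρ) := by
  intro a ha
  refine L1loc.tendsto_iff.2 fun R hR => ?_
  set l := 𝓝[Ioc 0 ρ] a with hl
  have hpow : Tendsto (fun r : ℝ => r ^ (p - 2)) l (𝓝 (a ^ (p - 2))) :=
    (Real.continuousAt_rpow_const a _ (Or.inl ha.1.ne')).tendsto.mono_left nhdsWithin_le_nhds
  have hsh : Tendsto (flowShift p u) l (𝓝 (flowShift p u a)) := h.continuousOn_flowShift a ha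
  have hdil : Tendsto (fun r : ℝ => ∫ x, |v (r • x) - v (a • x)|) l (𝓝 0) :=
    (h.integrable.tendsto_integral_abs_comp_smul_sub ha.1).mono_left nhdsWithin_le_nhds
  set V : ℝ := (volume : Measure (Eucl n)).real (closedBall 0 R) with hV
  have hlim : Tendsto (fun r : ℝ => |r ^ (p - 2)| * (∫ x, |v (r • x) - v (a • x)|) +
      |r ^ (p - 2) - a ^ (p - 2)| * (∫ x, |v (a • x)|) +
      V * |r ^ (p - 2) * flowShift p u r - a ^ (p - 2) * flowShift p u a|) l (𝓝 0) := by
    have h1 := (hpow.abs.mul hdil).add (((hpow.sub_const (a ^ (p - 2))).abs.mul_const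
      (∫ x, |v (a • x)|)))
    have h2 := h1.add ((((hpow.mul hsh).sub_const (a ^ (p - 2) * flowShift p u a)).abs).const_mul V)
    simpa using h2
  refine squeeze_zero' (Eventually.of_forall fun _ => integral_nonneg fun x => abs_nonneg _) ?_ hlim
  filter_upwards [self_mem_nhdsWithin] with r hr
  have hva : Integrable fun x : Eucl n => v (a • x) := h.integrable.comp_smul ha.1.ne'
  have hvr : Integrable fun x : Eucl n => v (r • x) := h.integrable.comp_smul hr.1.ne'
  have hi1 : Integrable fun x : Eucl n => |r ^ (p - 2)| * |v (r • x) - v (a • x)| :=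
    (hvr.sub hva).abs.const_mul _
  have hi2 : Integrable fun x : Eucl n => |r ^ (p - 2) - a ^ (p - 2)| * |v (a • x)| :=
    hva.abs.const_mul _
  have hi3 : IntegrableOn (fun _ : Eucl n =>
      |r ^ (p - 2) * flowShift p u r - a ^ (p - 2) * flowShift p u a|) (closedBall 0 R) :=
    integrableOn_const measure_closedBall_lt_top.ne
  have hi12 : Integrable fun x : Eucl n => |r ^ (p - 2)| * |v (r • x) - v (a • x)| +
      |r ^ (p - 2) - a ^ (p - 2)| * |v (a • x)| := hi1.add hi2
  calc ∫ x in closedBall 0 R, |(h.flowClass r).1 x - (h.flowClass a).1 x|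
      ≤ ∫ x in closedBall 0 R, (|r ^ (p - 2)| * |v (r • x) - v (a • x)| +
          |r ^ (p - 2) - a ^ (p - 2)| * |v (a • x)| +
          |r ^ (p - 2) * flowShift p u r - a ^ (p - 2) * flowShift p u a|) := by
        refine integral_mono_ae (((h.flowClass r).integrableOn R).sub
          ((h.flowClass a).integrableOn R)).abs (hi12.integrableOn.add hi3) ?_
        filter_upwards [ae_restrict_of_ae (h.coeFn_flowClass r),
          ae_restrict_of_ae (h.coeFn_flowClass a)] with x h1 h2
        rw [h1, h2, realFlow, realFlow, ← abs_mul, ← abs_mul]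
        have e : r ^ (p - 2) * (v (r • x) - flowShift p u r) -
            a ^ (p - 2) * (v (a • x) - flowShift p u a) =
            r ^ (p - 2) * (v (r • x) - v (a • x)) + (r ^ (p - 2) - a ^ (p - 2)) * v (a • x) +
            -(r ^ (p - 2) * flowShift p u r - a ^ (p - 2) * flowShift p u a) := by ring
        rw [e]
        refine (abs_add_three _ _ _).trans ?_
        rw [abs_neg]
    _ = (∫ x in closedBall (0 : Eucl n) R, |r ^ (p - 2)| * |v (r • x) - v (a • x)|) +
          (∫ x in closedBall (0 : Eucl n) R, |r ^ (p - 2) - a ^ (p - 2)| * |v (a • x)|) +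
          V * |r ^ (p - 2) * flowShift p u r - a ^ (p - 2) * flowShift p u a| := by
        rw [integral_add hi12.integrableOn hi3, integral_add hi1.integrableOn hi2.integrableOn,
          setIntegral_const, smul_eq_mul]
    _ ≤ _ := by
        refine add_le_add (add_le_add ?_ ?_) le_rfl
        · rw [← integral_const_mul]
          exact setIntegral_le_integral hi1 (ae_of_all _ fun x => by positivity)
        · rw [← integral_const_mul]
          exact setIntegral_le_integral hi2 (ae_of_all _ fun x => by positivity)

/-- The sub-mean argument covers only radii up to some `δ` depending on `R`; on `[δ, ρ]` the curve
is continuous and its image compact. -/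
theorem totallyBounded_restrict_flowClass (h : FlowGerm p u v ρ Λ) {R : ℝ} (hR : 0 < R) :
    TotallyBounded (L1loc.restrict R '' (h.flowClass '' Ioc 0 ρ)) := by
  have hρ := h.pos
  set δ : ℝ := ρ / (8 * R + 3) with hδ
  have hδpos : 0 < δ := by positivity
  have h1 := h.totallyBounded_realFlow hR (δ := δ) (div_mul_cancel₀ ρ (by positivity)).le
  have h2 : IsCompact (L1loc.restrict R '' (h.flowClass '' Icc δ ρ)) :=
    (isCompact_Icc.image_of_continuousOn (h.continuousOn_flowClass.mono fun r hr =>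
      ⟨hδpos.trans_le hr.1, hr.2⟩)).image (L1loc.continuous_restrict R)
  refine (h1.union h2.totallyBounded).subset ?_
  rintro _ ⟨_, ⟨r, hr, rfl⟩, rfl⟩
  rcases le_total r δ with hrδ | hrδ
  · refine Or.inl ⟨r, hr.1, hrδ, ?_⟩
    filter_upwards [L1loc.coeFn_restrict R (h.flowClass r),
      ae_restrict_of_ae (h.coeFn_flowClass r)] with x e1 e2
    rw [e1, e2]
  · exact Or.inr ⟨_, ⟨r, ⟨hrδ, hr.2⟩, rfl⟩, rfl⟩

theorem isCompact_closure_flowClass (h : FlowGerm p u v ρ Λ) {δ : ℝ} (hδ : δ ≤ ρ) :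
    IsCompact (closure (h.flowClass '' Ioo 0 δ)) :=
  L1loc.isCompact_closure fun _ hR => (h.totallyBounded_restrict_flowClass hR).subset
    (image_mono (image_mono (Ioo_subset_Ioc_self.trans (Ioc_subset_Ioc_right hδ))))

theorem lintegral_tangentialFlow_sub (h : FlowGerm p u v ρ Λ) {r R : ℝ} (hr : 0 < r) (hrρ : r ≤ ρ)
    (hrR : r * R ≤ ρ) (f : L1loc n) :
    ∫⁻ x in closedBall (0 : Eucl n) R,
      (tangentialFlow p u r x - ((f.1 x : ℝ) : EReal)).abs =
      ENNReal.ofReal (∫ x in closedBall (0 : Eucl n) R, |(h.flowClass r).1 x - f.1 x|) := by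
  have hi : IntegrableOn (fun x => |(h.flowClass r).1 x - f.1 x|) (closedBall 0 R) :=
    (((h.flowClass r).integrableOn R).sub (f.integrableOn R)).abs
  rw [ofReal_integral_eq_lintegral_ofReal hi (ae_of_all _ fun x => abs_nonneg _)]
  refine lintegral_congr_ae ?_
  filter_upwards [ae_restrict_of_ae (h.coeFn_flowClass r),
    ae_restrict_of_ae (h.ae_tangentialFlow_eq hr hrρ),
    ae_restrict_mem measurableSet_closedBall] with x h1 h2 hx
  rw [h2 ((mul_le_mul_of_nonneg_left (mem_closedBall_zero_iff.1 hx) hr.le).trans hrR), ← h1,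
    ← EReal.coe_sub, EReal.abs_def]

theorem isL1locTangent_iff_seq (h : FlowGerm p u v ρ Λ) {f : L1loc n} :
    IsL1locTangent p u f ↔ ∃ r : ℕ → ℝ, (∀ j, 0 < r j) ∧ Tendsto r atTop (𝓝 0) ∧
      Tendsto (fun j => h.flowClass (r j)) atTop (𝓝 f) := by
  refine exists_congr fun r => and_congr_right fun hr => and_congr_right fun hr0 => ?_
  rw [L1loc.tendsto_iff]
  refine forall₂_congr fun R hR => ?_
  have hρ := h.pos
  have hev : ∀ᶠ j in atTop, r j ≤ ρ ∧ r j * R ≤ ρ := by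
    filter_upwards [hr0.eventually (gt_mem_nhds (show 0 < ρ / (R + 1) by positivity))] with j hj
    rw [lt_div_iff₀ (by positivity)] at hj
    have := hr j
    constructor <;> nlinarith
  have hcongr : (fun j => ∫⁻ x in closedBall (0 : Eucl n) R,
      (tangentialFlow p u (r j) x - ((f.1 x : ℝ) : EReal)).abs) =ᶠ[atTop] fun j =>
      ENNReal.ofReal (∫ x in closedBall (0 : Eucl n) R, |(h.flowClass (r j)).1 x - f.1 x|) := by
    filter_upwards [hev] with j hj
    exact h.lintegral_tangentialFlow_sub (hr j) hj.1 hj.2 f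
  rw [tendsto_congr' hcongr]
  constructor
  · intro ht
    have h1 := (ENNReal.tendsto_toReal ENNReal.zero_ne_top).comp ht
    refine h1.congr fun j => ?_
    exact ENNReal.toReal_ofReal (integral_nonneg fun x => abs_nonneg _)
  · intro ht
    have h1 := ENNReal.tendsto_ofReal ht
    rwa [ENNReal.ofReal_zero] at h1

/-- First countability of `L¹_loc` turns cluster points into limits of sequences. -/
theorem isL1locTangent_iff_mapClusterPt (h : FlowGerm p u v ρ Λ) {f : L1loc n} :
    IsL1locTangent p u f ↔ MapClusterPt f (𝓝[>] 0) h.flowClass := by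
  rw [h.isL1locTangent_iff_seq]
  constructor
  · rintro ⟨r, hr, hr0, hf⟩
    have h1 : Tendsto r atTop (𝓝[>] 0) :=
      tendsto_nhdsWithin_iff.2 ⟨hr0, Eventually.of_forall hr⟩
    exact MapClusterPt.of_comp h1 hf.mapClusterPt
  · intro hf
    have hne : (𝓝[>] (0 : ℝ) ⊓ comap h.flowClass (𝓝 f)).NeBot := by
      rw [← map_neBot_iff h.flowClass, Filter.push_pull, inf_comm]
      exact hf
    obtain ⟨r, hr⟩ := exists_seq_tendsto (𝓝[>] (0 : ℝ) ⊓ comap h.flowClass (𝓝 f))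
    obtain ⟨hr1, hr2⟩ := tendsto_inf.1 hr
    obtain ⟨hr0, hpos⟩ := tendsto_nhdsWithin_iff.1 hr1
    obtain ⟨N, hN⟩ := eventually_atTop.1 hpos
    -- Positivity holds only eventually along the extracted sequence, so its first terms are
    -- dropped.
    refine ⟨fun j => r (j + N), fun j => hN _ (by lia), hr0.comp (tendsto_add_atTop_nat N), ?_⟩
    exact (tendsto_comap_iff.1 hr2).comp (tendsto_add_atTop_nat N)

/-- A cluster set is the intersection of the closures of the tails; only `δ ≤ ρ` is needed, where
the curve is known to be continuous. -/
theorem setOf_isL1locTangent (h : FlowGerm p u v ρ Λ) :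
    {f : L1loc n | IsL1locTangent p u f} =
      ⋂ δ : Ioc 0 ρ, closure (h.flowClass '' Ioo 0 δ.1) := by
  ext f
  have hb := (nhdsGT_basis (0 : ℝ)).map h.flowClass
  simp only [mem_ofPred_eq, h.isL1locTangent_iff_mapClusterPt, mem_iInter]
  rw [MapClusterPt, hb.clusterPt_iff_forall_mem_closure]
  refine ⟨fun hf δ => hf δ.1 δ.2.1, fun hf δ hδ => ?_⟩
  exact closure_mono (image_mono (Ioo_subset_Ioo_right (min_le_left δ ρ)))
    (hf ⟨min δ ρ, lt_min hδ h.pos, min_le_right _ _⟩)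

theorem directed_closure_flowClass (h : FlowGerm p u v ρ Λ) :
    Directed (· ⊇ ·) fun δ : Ioc 0 ρ => closure (h.flowClass '' Ioo 0 δ.1) := by
  intro a b
  refine ⟨⟨min a.1 b.1, lt_min a.2.1 b.2.1, (min_le_left _ _).trans a.2.2⟩, ?_, ?_⟩
  · exact closure_mono (image_mono (Ioo_subset_Ioo_right (min_le_left _ _)))
  · exact closure_mono (image_mono (Ioo_subset_Ioo_right (min_le_right _ _)))

theorem isConnected_setOf_isL1locTangent (h : FlowGerm p u v ρ Λ) :
    IsConnected {f : L1loc n | IsL1locTangent p u f} := by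
  rw [h.setOf_isL1locTangent]
  have : Nonempty (Ioc 0 ρ) := ⟨⟨ρ, h.pos, le_rfl⟩⟩
  refine isConnected_iInter_of_directed h.directed_closure_flowClass
    (fun δ => h.isCompact_closure_flowClass δ.2.2) fun δ => ?_
  refine ((isConnected_Ioo δ.2.1).image _ (h.continuousOn_flowClass.mono ?_)).closure
  exact fun r hr => ⟨hr.1, hr.2.le.trans δ.2.2⟩

theorem isCompact_setOf_isL1locTangent (h : FlowGerm p u v ρ Λ) :
    IsCompact {f : L1loc n | IsL1locTangent p u f} := by
  rw [h.setOf_isL1locTangent]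
  exact (h.isCompact_closure_flowClass (le_refl ρ)).of_isClosed_subset
    (isClosed_iInter fun _ => isClosed_closure) (iInter_subset _ (⟨ρ, h.pos, le_rfl⟩ : Ioc 0 ρ))

end FlowGerm

end

/-! ### The upper representative of a sub-mean class -/

noncomputable section

variable {n : ℕ}

/-- An average is at most an almost everywhere upper bound. -/
theorem kernAvg_le_of_ae_le {w : Eucl n → ℝ} (hw : LocallyIntegrable w) {s : ℝ} (hs : 0 < s)
    {x : Eucl n} {c : ℝ} (h : ∀ᵐ y, y ∈ closedBall x s → w y ≤ c) : kernAvg s w x ≤ c := by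
  have h1 : ∫ y, kern n s (y - x) * c = c := by
    rw [integral_mul_const, integral_kern_sub hs, one_mul]
  rw [← h1]
  refine integral_mono_ae (integrable_kern_sub_mul hw hs x)
    ((integrable_kern_sub hs x).mul_const c) ?_
  filter_upwards [h] with y hy
  rcases le_or_gt s ‖y - x‖ with hsy | hsy
  · simp only [kern_eq_zero hs hsy, zero_mul, le_refl]
  · exact mul_le_mul_of_nonneg_left (hy (by rw [mem_closedBall_iff_norm]; exact hsy.le))
      (kern_nonneg hs _)

/-- At almost every point the averages converge to the value. -/
theorem ae_tendsto_kernAvg {w : Eucl n → ℝ} (hw : LocallyIntegrable w) :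
    ∀ᵐ x, Tendsto (fun s => kernAvg s w x) (𝓝[>] 0) (𝓝 (w x)) := by
  filter_upwards [IsUnifLocDoublingMeasure.ae_tendsto_average_norm_sub volume hw 1] with x hx
  have h1 := hx (l := 𝓝[>] (0 : ℝ)) (fun _ => x) (fun s => s) tendsto_id (by
    filter_upwards [self_mem_nhdsWithin] with s hs
    rw [one_mul]; exact mem_closedBall_self (le_of_lt hs))
  set V : ℝ := (volume : Measure (Eucl n)).real (closedBall 0 1) with hV
  -- The kernel is at most `V / kernMass` times the normalized indicator of its ball, so Lebesgue's
  -- differentiation theorem for plain averages suffices.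
  have h2 := h1.const_mul ((kernMass n)⁻¹ * V)
  rw [mul_zero] at h2
  refine tendsto_iff_dist_tendsto_zero.2 ?_
  refine squeeze_zero' (Eventually.of_forall fun _ => dist_nonneg) ?_ h2
  filter_upwards [self_mem_nhdsWithin] with s hs
  have hs : 0 < s := hs
  have hvol : (volume : Measure (Eucl n)).real (closedBall x s) = s ^ n * V := by
    rw [hV, measureReal_def, measureReal_def, Measure.addHaar_closedBall' _ _ hs.le,
      finrank_euclideanSpace_fin, ENNReal.toReal_mul, ENNReal.toReal_ofReal (by positivity)]
  have hVpos : 0 < V := by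
    rw [hV, measureReal_def]
    exact ENNReal.toReal_pos (measure_closedBall_pos _ _ one_pos).ne' measure_closedBall_lt_top.ne
  have hi : IntegrableOn (fun y => |w y - w x|) (closedBall x s) :=
    ((hw.integrableOn_isCompact (isCompact_closedBall _ _)).sub
      (integrableOn_const measure_closedBall_lt_top.ne)).abs
  have e : kernAvg s w x - w x = ∫ y, kern n s (y - x) * (w y - w x) := by
    simp only [mul_sub]
    rw [integral_sub (integrable_kern_sub_mul hw hs x) ((integrable_kern_sub hs x).mul_const _),
      integral_mul_const, integral_kern_sub hs, one_mul, kernAvg]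
  rw [Real.dist_eq, e, setAverage_eq, hvol, smul_eq_mul]
  simp only [Real.norm_eq_abs]
  have hrhs : (kernMass n)⁻¹ * V * ((s ^ n * V)⁻¹ * ∫ y in closedBall x s, |w y - w x|) =
      ∫ y, (closedBall x s).indicator
        (fun y => (kernMass n)⁻¹ * (s ^ n)⁻¹ * |w y - w x|) y := by
    rw [integral_indicator measurableSet_closedBall, integral_const_mul]
    field_simp
  rw [hrhs, ← Real.norm_eq_abs]
  refine norm_integral_le_of_norm_le ?_ (ae_of_all _ fun y => ?_)
  · exact IntegrableOn.integrable_indicator (hi.const_mul _) measurableSet_closedBall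
  · rw [norm_mul, Real.norm_eq_abs, Real.norm_eq_abs, abs_of_nonneg (kern_nonneg hs _)]
    by_cases hy : y ∈ closedBall x s
    · rw [indicator_of_mem hy]
      exact mul_le_mul_of_nonneg_right (kern_le hs _) (abs_nonneg _)
    · rw [indicator_of_notMem hy]
      rw [mem_closedBall_iff_norm, not_le] at hy
      rw [kern_eq_zero hs hy.le, zero_mul]

namespace L1loc

theorem abs_kernAvg_sub_le_integral {s R : ℝ} (hs : 0 < s) (f g : L1loc n) {x : Eucl n}
    (hx : ‖x‖ + s ≤ R) : |kernAvg s f.1 x - kernAvg s g.1 x| ≤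
      (kernMass n)⁻¹ * (s ^ n)⁻¹ * ∫ y in closedBall 0 R, |f.1 y - g.1 y| := by
  rw [← kernAvg_indicator hs f.1 hx, ← kernAvg_indicator hs g.1 hx]
  refine (abs_kernAvg_sub_le hs ((f.integrableOn R).integrable_indicator measurableSet_closedBall)
    ((g.integrableOn R).integrable_indicator measurableSet_closedBall) x).trans_eq ?_
  rw [← integral_indicator measurableSet_closedBall]
  congr 2
  ext y
  by_cases hy : y ∈ closedBall (0 : Eucl n) R <;> simp [hy]

/-- Averages at convergent points converge along `L¹_loc`-convergent sequences. -/
theorem tendsto_kernAvg {F : ℕ → L1loc n} {f : L1loc n} (hF : Tendsto F atTop (𝓝 f)) {s : ℝ}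
    (hs : 0 < s) {z : ℕ → Eucl n} {x : Eucl n} (hz : Tendsto z atTop (𝓝 x)) :
    Tendsto (fun j => kernAvg s (F j).1 (z j)) atTop (𝓝 (kernAvg s f.1 x)) := by
  have h1 : Tendsto (fun j => kernAvg s f.1 (z j)) atTop (𝓝 (kernAvg s f.1 x)) :=
    ((continuous_kernAvg hs f.2).tendsto x).comp hz
  have hR : 0 < ‖x‖ + 1 + s := by positivity
  have h2 := (tendsto_iff.1 hF _ hR).const_mul ((kernMass n)⁻¹ * (s ^ n)⁻¹)
  rw [mul_zero] at h2
  have h3 : Tendsto (fun j => kernAvg s (F j).1 (z j) - kernAvg s f.1 (z j)) atTop (𝓝 0) := by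
    refine squeeze_zero_norm' ?_ h2
    filter_upwards [hz.norm.eventually (gt_mem_nhds (lt_add_one ‖x‖))] with j hj
    exact abs_kernAvg_sub_le_integral hs _ _ (by linarith)
  have h4 := h3.add h1
  rw [zero_add] at h4
  exact h4.congr fun j => sub_add_cancel _ _

/-- Almost everywhere inequalities pass to `L¹_loc`-limits. -/
theorem ae_le_of_tendsto {F : ℕ → L1loc n} {f : L1loc n} (hF : Tendsto F atTop (𝓝 f)) {R : ℝ}
    {G : ℕ → Eucl n → ℝ} {g : Eucl n → ℝ}
    (hG : ∀ x, ‖x‖ ≤ R → Tendsto (fun j => G j x) atTop (𝓝 (g x)))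
    (hle : ∀ᶠ j in atTop, ∀ᵐ x, ‖x‖ ≤ R → (F j).1 x ≤ G j x) :
    ∀ᵐ x, ‖x‖ ≤ R → f.1 x ≤ g x := by
  have h1 : Tendsto (fun j => (F j).restrict R) atTop (𝓝 (f.restrict R)) :=
    ((continuous_restrict R).tendsto f).comp hF
  obtain ⟨ns, hns, hlim⟩ := (tendstoInMeasure_of_tendsto_Lp h1).exists_seq_tendsto_ae
  obtain ⟨N, hN⟩ := eventually_atTop.1 hle
  have h2 : ∀ᵐ x, ∀ j, N ≤ j → ‖x‖ ≤ R → (F j).1 x ≤ G j x := ae_all_iff.2 fun j => by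
    by_cases hj : N ≤ j
    · filter_upwards [hN j hj] with x hx _ using hx
    · exact ae_of_all _ fun x h => absurd h hj
  have h3 : ∀ᵐ x ∂(volume : Measure (Eucl n)).restrict (closedBall 0 R),
      ∀ j, (F j).restrict R x = (F j).1 x := ae_all_iff.2 fun j => coeFn_restrict R (F j)
  have h4 := (ae_restrict_iff' measurableSet_closedBall).1
    ((hlim.and h3).and (coeFn_restrict R f))
  filter_upwards [h4, h2] with x hx1 hx2 hxR
  obtain ⟨⟨ha, hb⟩, hc⟩ := hx1 (mem_closedBall_zero_iff.2 hxR)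
  rw [hc] at ha
  simp only [hb] at ha
  refine le_of_tendsto_of_tendsto ha ((hG x hxR).comp hns.tendsto_atTop) ?_
  filter_upwards [eventually_ge_atTop N] with i hi
  exact hx2 (ns i) (hi.trans hns.le_apply) hxR

/-- The sub-mean value property of a class. -/
def IsSubmean (f : L1loc n) : Prop := ∀ s, 0 < s → ∀ᵐ x, f.1 x ≤ kernAvg s f.1 x

theorem kernAvg_le_essSup (f : L1loc n) {s r : ℝ} (hs : 0 < s) (hsr : s ≤ r) (x : Eucl n) :
    ((kernAvg s f.1 x : ℝ) : EReal) ≤ essSup (fun y => ((f.1 y : ℝ) : EReal))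
      ((volume : Measure (Eucl n)).restrict (closedBall x r)) := by
  refine EReal.le_of_forall_lt_iff_le.1 fun c hc => ?_
  rw [EReal.coe_le_coe_iff]
  refine kernAvg_le_of_ae_le f.2 hs ?_
  filter_upwards [(ae_restrict_iff' measurableSet_closedBall).1 (ae_lt_of_essSup_lt hc)] with y hy hys
  exact (EReal.coe_lt_coe_iff.1 (hy (closedBall_subset_closedBall hsr hys))).le

/-- If `c` exceeds the average at `x`, then by continuity it exceeds the averages near `x`, hence
almost every value there. -/
theorem IsSubmean.upperRep_le {f : L1loc n} (hf : f.IsSubmean) {s : ℝ} (hs : 0 < s) (x : Eucl n) :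
    f.upperRep x ≤ ((kernAvg s f.1 x : ℝ) : EReal) := by
  refine EReal.le_of_forall_lt_iff_le.1 fun c hc => ?_
  rw [EReal.coe_lt_coe_iff] at hc
  obtain ⟨r, hr, hball⟩ := Metric.nhds_basis_closedBall.mem_iff.1
    (((continuous_kernAvg hs f.2).tendsto x).eventually (gt_mem_nhds hc))
  refine (iInf₂_le r hr).trans (essSup_le_of_ae_le _ ?_)
  refine (ae_restrict_iff' measurableSet_closedBall).2 ?_
  filter_upwards [hf s hs] with y hy hyr
  exact EReal.coe_le_coe_iff.2 (hy.trans (le_of_lt (hball hyr)))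

/-- Infima of averages, unlike essential suprema, behave well under dilation and under `L¹_loc`
limits. -/
theorem IsSubmean.upperRep_eq {f : L1loc n} (hf : f.IsSubmean) (x : Eucl n) :
    f.upperRep x = ⨅ s : ℝ, ⨅ _ : 0 < s, ((kernAvg s f.1 x : ℝ) : EReal) :=
  le_antisymm (le_iInf₂ fun _ hs => hf.upperRep_le hs x)
    (iInf₂_mono fun _ hs => kernAvg_le_essSup f hs le_rfl x)

/-- Almost everywhere the averages converge to the value, and the upper representative is squeezed:
below every average, and above the limit of the averages. -/
theorem IsSubmean.represents {f : L1loc n} (hf : f.IsSubmean) : f.Represents f.upperRep := by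
  filter_upwards [ae_tendsto_kernAvg f.2] with x hx
  have hx' : Tendsto (fun s => ((kernAvg s f.1 x : ℝ) : EReal)) (𝓝[>] 0)
      (𝓝 ((f.1 x : ℝ) : EReal)) := (continuous_coe_real_ereal.tendsto _).comp hx
  refine le_antisymm ?_ (le_iInf₂ fun r hr => ?_)
  · refine ge_of_tendsto hx' ?_
    filter_upwards [self_mem_nhdsWithin] with s hs using hf.upperRep_le hs x
  · refine le_of_tendsto hx' ?_
    filter_upwards [Ioo_mem_nhdsGT hr] with s hs using kernAvg_le_essSup f hs.1 hs.2.le x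

theorem Represents.eq {f g : L1loc n} {U : Eucl n → EReal} (hf : f.Represents U)
    (hg : g.Represents U) : f = g := by
  refine ext ?_
  filter_upwards [hf, hg] with x h1 h2
  exact EReal.coe_injective (h1.symm.trans h2)

theorem locallyIntegrable_comp_smul (f : L1loc n) {r : ℝ} (hr : 0 < r) :
    LocallyIntegrable fun x => f.1 (r • x) := by
  intro x
  refine ⟨closedBall 0 (‖x‖ + 1), closedBall_mem_nhds_of_mem
    (mem_ball_zero_iff.2 (lt_add_one _)), ?_⟩
  have h2 := ((f.integrableOn (r * (‖x‖ + 1))).integrable_indicator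
    measurableSet_closedBall).comp_smul hr.ne'
  refine (h2.integrableOn (s := closedBall 0 (‖x‖ + 1))).congr_fun (fun y hy => ?_)
    measurableSet_closedBall
  exact indicator_of_mem (mem_closedBall_zero_iff.2
    (norm_smul_le_of_mul_le hr (mem_closedBall_zero_iff.1 hy) le_rfl)) _

/-- The class of `x ↦ a (f (r x) - c)`. -/
def dilate (f : L1loc n) {r : ℝ} (hr : 0 < r) (a c : ℝ) : L1loc n :=
  mk (fun x => a * (f.1 (r • x) - c)) 
    (((f.locallyIntegrable_comp_smul hr).sub (locallyIntegrable_const c)).smul a)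

theorem coeFn_dilate (f : L1loc n) {r : ℝ} (hr : 0 < r) (a c : ℝ) :
    (f.dilate hr a c).1 =ᵐ[volume] fun x => a * (f.1 (r • x) - c) := coeFn_mk _ _

theorem kernAvg_dilate (f : L1loc n) {r : ℝ} (hr : 0 < r) (a c : ℝ) {s : ℝ} (hs : 0 < s)
    (x : Eucl n) :
    kernAvg s (f.dilate hr a c).1 x = a * (kernAvg (r * s) f.1 (r • x) - c) := by
  rw [kernAvg_congr_ae (f.coeFn_dilate hr a c), 
    kernAvg_mul_sub (f.locallyIntegrable_comp_smul hr) hs, kernAvg_comp_smul hr]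

end L1loc

theorem EReal.coe_mul_sub_lt_iff {a : ℝ} (ha : 0 < a) (c t : ℝ) (y : EReal) :
    (a : EReal) * (y - (c : EReal)) < (t : EReal) ↔ y < ((t / a + c : ℝ) : EReal) := by
  induction y with
  | bot =>
    rw [EReal.bot_sub, EReal.coe_mul_bot_of_pos ha]
    simp only [EReal.bot_lt_coe]
  | coe y =>
    rw [← EReal.coe_sub, ← EReal.coe_mul, EReal.coe_lt_coe_iff, EReal.coe_lt_coe_iff,
      ← sub_lt_iff_lt_add, lt_div_iff₀ ha, mul_comm]
  | top =>
    rw [EReal.top_sub_coe, EReal.coe_mul_top_of_pos ha]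
    simp only [not_top_lt]

theorem EReal.eq_of_forall_lt_coe_iff {y z : EReal} (h : ∀ t : ℝ, y < t ↔ z < t) : y = z :=
  le_antisymm (EReal.le_of_forall_lt_iff_le.1 fun t ht => ((h t).2 ht).le)
    (EReal.le_of_forall_lt_iff_le.1 fun t ht => ((h t).1 ht).le)

/-- The radius `s` for the dilated class corresponds to `r s` for `f`. Comparing strict real upper
bounds avoids distributing `EReal` arithmetic over an infimum. -/
theorem L1loc.upperRep_dilate {f : L1loc n} (hf : f.IsSubmean) {r : ℝ} (hr : 0 < r) {a : ℝ}
    (ha : 0 < a) (c : ℝ) (hg : (f.dilate hr a c).IsSubmean) (x : Eucl n) :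
    (f.dilate hr a c).upperRep x = (a : EReal) * (f.upperRep (r • x) - (c : EReal)) := by
  refine EReal.eq_of_forall_lt_coe_iff fun t => ?_
  rw [EReal.coe_mul_sub_lt_iff ha, hg.upperRep_eq, hf.upperRep_eq]
  simp only [iInf_lt_iff, EReal.coe_lt_coe_iff, exists_prop]
  have key : ∀ y : ℝ, a * (y - c) < t ↔ y < t / a + c := fun y => by
    rw [← sub_lt_iff_lt_add, lt_div_iff₀ ha, mul_comm]
  constructor
  · rintro ⟨s, hs, h⟩
    rw [f.kernAvg_dilate hr a c hs] at h
    exact ⟨r * s, by positivity, (key _).1 h⟩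
  · rintro ⟨s, hs, h⟩
    refine ⟨s / r, by positivity, ?_⟩
    rw [f.kernAvg_dilate hr a c (by positivity), mul_div_cancel₀ _ hr.ne']
    exact (key _).2 h

end

/-! ### Invariance of the tangent set -/

noncomputable section

variable {n : ℕ}

namespace FlowGerm

variable {p : ℝ} {u : Eucl n → EReal} {v : Eucl n → ℝ} {ρ Λ : ℝ}

theorem eventually_mul_le (h : FlowGerm p u v ρ Λ) {r : ℕ → ℝ} (hr : ∀ j, 0 < r j)
    (hr0 : Tendsto r atTop (𝓝 0)) (K : ℝ) : ∀ᶠ j in atTop, r j ≤ ρ ∧ r j * K ≤ ρ := by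
  have hρ := h.pos
  filter_upwards [hr0.eventually (gt_mem_nhds (show 0 < ρ / (|K| + 1) by positivity))] with j hj
  rw [lt_div_iff₀ (by positivity)] at hj
  have := hr j
  constructor <;> nlinarith [le_abs_self K, abs_nonneg K]

theorem kernAvg_flowClass (h : FlowGerm p u v ρ Λ) (r s : ℝ) (x : Eucl n) :
    kernAvg s (h.flowClass r).1 x = kernAvg s (realFlow p u v r) x :=
  kernAvg_congr_ae (h.coeFn_flowClass r) x

/-- Tangents have the sub-mean value property. -/
theorem isSubmean_of_isL1locTangent (h : FlowGerm p u v ρ Λ) {f : L1loc n}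
    (hf : IsL1locTangent p u f) : f.IsSubmean := by
  obtain ⟨r, hr, hr0, hlim⟩ := h.isL1locTangent_iff_seq.1 hf
  intro s hs
  refine L1loc.ae_of_forall_restrict fun N => ?_
  refine (ae_restrict_iff' measurableSet_closedBall).2 ?_
  have h1 := L1loc.ae_le_of_tendsto hlim (R := N)
    (G := fun j x => kernAvg s (h.flowClass (r j)).1 x) (g := fun x => kernAvg s f.1 x)
    (fun x _ => L1loc.tendsto_kernAvg hlim hs tendsto_const_nhds) ?_
  · filter_upwards [h1] with x hx hxN using hx (mem_closedBall_zero_iff.1 hxN)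
  · filter_upwards [h.eventually_mul_le hr hr0 (N + s)] with j hj
    filter_upwards [h.coeFn_flowClass (r j), h.ae_realFlow_le_kernAvg (hr j) hj.1 hs] with
      x hx1 hx2 hxN
    rw [hx1, h.kernAvg_flowClass]
    exact hx2 (le_trans (mul_le_mul_of_nonneg_left (by linarith) (hr j).le) hj.2)

/-- Each tangent is represented by its own upper representative and a function determines its class,
so the results on cluster sets carry over to the tangent set. -/
theorem classesL1loc_tangentSet (h : FlowGerm p u v ρ Λ) :
    classesL1loc (tangentSet p u) = {f : L1loc n | IsL1locTangent p u f} := by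
  ext f
  constructor
  · rintro ⟨U, ⟨g, hg, rfl⟩, hf⟩
    have hfg := hf.eq (h.isSubmean_of_isL1locTangent hg).represents
    rwa [mem_ofPred_eq, hfg]
  · intro hf
    exact ⟨f.upperRep, ⟨f, hf, rfl⟩, (h.isSubmean_of_isL1locTangent hf).represents⟩

/-- The flow is multiplicative in the radius up to the change of the shift, which is the only term
whose limit must be found. -/
theorem realFlow_mul {r a : ℝ} (hr : 0 < r) (ha : 0 < a) (x : Eucl n) :
    realFlow p u v (r * a) x = r ^ (p - 2) * (realFlow p u v a (r • x) -
      a ^ (p - 2) * (flowShift p u (r * a) - flowShift p u a)) := by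
  rw [realFlow, realFlow, Real.mul_rpow hr.le ha.le, smul_smul, mul_comm a r]
  ring

/-- The radii `r * a j` produce the dilated tangent, provided the rescaled shift differences
converge. -/
theorem isL1locTangent_dilate (h : FlowGerm p u v ρ Λ) {a : ℕ → ℝ} (ha : ∀ j, 0 < a j)
    (ha0 : Tendsto a atTop (𝓝 0)) {f : L1loc n}
    (hf : Tendsto (fun j => h.flowClass (a j)) atTop (𝓝 f)) {r : ℝ} (hr : 0 < r) {c : ℝ}
    (hc : Tendsto (fun j => a j ^ (p - 2) * (flowShift p u (r * a j) - flowShift p u (a j))) atTop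
      (𝓝 c)) : IsL1locTangent p u (f.dilate hr (r ^ (p - 2)) c) := by
  have hlim0 : Tendsto (fun j => r * a j) atTop (𝓝 0) := by
    simpa using ha0.const_mul r
  refine h.isL1locTangent_iff_seq.2
    ⟨fun j => r * a j, fun j => mul_pos hr (ha j), hlim0, L1loc.tendsto_iff.2 fun R hR => ?_⟩
  set V : ℝ := (volume : Measure (Eucl n)).real (closedBall 0 R) with hV
  set γ : ℕ → ℝ := fun j => a j ^ (p - 2) * (flowShift p u (r * a j) - flowShift p u (a j))
    with hγ
  have hbound : Tendsto (fun j => r ^ (p - 2) * ((r ^ n)⁻¹ *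
      (∫ x in closedBall 0 (r * R), |(h.flowClass (a j)).1 x - f.1 x|) + V * |γ j - c|))
      atTop (𝓝 0) := by
    have h1 := ((L1loc.tendsto_iff.1 hf (r * R) (by positivity)).const_mul (r ^ n)⁻¹).add
      ((hc.sub_const c).abs.const_mul V)
    simpa using h1.const_mul (r ^ (p - 2))
  refine squeeze_zero (fun _ => integral_nonneg fun x => abs_nonneg _) (fun j => ?_) hbound
  have hrp : 0 < r ^ (p - 2) := Real.rpow_pos_of_pos hr _
  have hi1 : IntegrableOn (fun x => |(h.flowClass (a j)).1 (r • x) - f.1 (r • x)|)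
      (closedBall 0 R) :=
    ((((h.flowClass (a j)).locallyIntegrable_comp_smul hr).sub
      (f.locallyIntegrable_comp_smul hr)).integrableOn_isCompact (isCompact_closedBall _ _)).abs
  have hi2 : IntegrableOn (fun _ : Eucl n => |γ j - c|) (closedBall 0 R) :=
    integrableOn_const measure_closedBall_lt_top.ne
  have hscale : ∫ x in closedBall 0 R, |(h.flowClass (a j)).1 (r • x) - f.1 (r • x)| =
      (r ^ n)⁻¹ * ∫ x in closedBall 0 (r * R), |(h.flowClass (a j)).1 x - f.1 x| := by
    have h1 := Measure.setIntegral_comp_smul_of_pos (volume : Measure (Eucl n))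
      (fun x => |(h.flowClass (a j)).1 x - f.1 x|) (closedBall 0 R) hr
    rw [h1, smul_closedBall _ _ hR.le, smul_zero, Real.norm_eq_abs, abs_of_pos hr,
      finrank_euclideanSpace_fin, smul_eq_mul]
  have hdil := (Measure.quasiMeasurePreserving_smul (volume : Measure (Eucl n)) hr.ne').ae
    (h.coeFn_flowClass (a j))
  calc ∫ x in closedBall 0 R, |(h.flowClass (r * a j)).1 x - (f.dilate hr (r ^ (p - 2)) c).1 x|
      ≤ ∫ x in closedBall 0 R, r ^ (p - 2) *
          (|(h.flowClass (a j)).1 (r • x) - f.1 (r • x)| + |γ j - c|) := by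
        refine integral_mono_ae (((h.flowClass (r * a j)).integrableOn R).sub
          ((f.dilate hr (r ^ (p - 2)) c).integrableOn R)).abs ((hi1.add hi2).const_mul _) ?_
        filter_upwards [ae_restrict_of_ae (h.coeFn_flowClass (r * a j)),
          ae_restrict_of_ae (f.coeFn_dilate hr (r ^ (p - 2)) c), ae_restrict_of_ae hdil] with
          x h1 h2 h3
        rw [h1, h2, realFlow_mul hr (ha j), ← h3]
        have e : r ^ (p - 2) * ((h.flowClass (a j)).1 (r • x) - γ j) -
            r ^ (p - 2) * (f.1 (r • x) - c) =
            r ^ (p - 2) * (((h.flowClass (a j)).1 (r • x) - f.1 (r • x)) - (γ j - c)) := by ring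
        rw [e, abs_mul, abs_of_pos hrp]
        exact mul_le_mul_of_nonneg_left (abs_sub _ _) hrp.le
    _ = _ := by
        rw [integral_const_mul, integral_add hi1 hi2, hscale, setIntegral_const, smul_eq_mul]

/-- For `p < 2` tangents vanish at the origin. -/
theorem upperRep_zero (h : FlowGerm p u v ρ Λ) (hp : p < 2) {f : L1loc n}
    (hf : IsL1locTangent p u f) : f.upperRep 0 = 0 := by
  have hsub := h.isSubmean_of_isL1locTangent hf
  obtain ⟨r, hr, hr0, hlim⟩ := h.isL1locTangent_iff_seq.1 hf
  have hshift : flowShift p u = fun _ => (u 0).toReal := by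
    ext r; rw [flowShift, if_neg hp.ne, if_pos hp]
  have hp2 : 0 < 2 - p := by linarith
  refine le_antisymm ?_ ?_
  -- The flow is at most `Λ/(2-p) s^(2-p)` on `B_s`, a bound that passes to the limit and tends to
  -- `0` with `s`.
  · have hle : ∀ s, 0 < s → f.upperRep 0 ≤ ((Λ / (2 - p) * s ^ (2 - p) : ℝ) : EReal) := by
      intro s hs
      refine (hsub.upperRep_le hs 0).trans (EReal.coe_le_coe_iff.2 ?_)
      refine kernAvg_le_of_ae_le f.2 hs ?_
      have h1 := L1loc.ae_le_of_tendsto hlim (R := s)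
        (G := fun _ _ => Λ / (2 - p) * s ^ (2 - p)) (g := fun _ => Λ / (2 - p) * s ^ (2 - p))
        (fun x _ => tendsto_const_nhds) ?_
      · filter_upwards [h1] with x hx hxs using hx (mem_closedBall_zero_iff.1 hxs)
      · filter_upwards [h.eventually_mul_le hr hr0 s] with j hj
        filter_upwards [h.coeFn_flowClass (r j), h.ae_tangentialFlow_eq (hr j) hj.1] with
          x hx1 hx2 hxs
        have hrj := hr j
        have h2 := hx2 ((mul_le_mul_of_nonneg_left hxs hrj.le).trans hj.2)
        have h3 : tangentialFlow p u (r j) x ≤ ((r j ^ (p - 2) *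
            ((maxBall u (r j * s)).toReal - (u 0).toReal) : ℝ) : EReal) := by
          rw [h.tangentialFlow_eq hrj hj.1, hshift]
          exact EReal.coe_mul_sub_le (Real.rpow_nonneg hrj.le _)
            (h.le_coe_maxBall (by positivity) hj.2 (norm_smul_le_of_mul_le hrj hxs le_rfl))
        have h4 := h.maxBall_sub_le_zero hp (r := r j * s) (by positivity) hj.2
        rw [h.apply_zero_eq hp, EReal.coe_le_coe_iff] at h4
        rw [h2, EReal.coe_le_coe_iff] at h3
        rw [hx1]
        refine h3.trans ?_
        have h5 : (maxBall u (r j * s)).toReal - (u 0).toReal ≤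
            Λ / (2 - p) * (r j * s) ^ (2 - p) := by linarith
        refine (mul_le_mul_of_nonneg_left h5 (Real.rpow_nonneg hrj.le _)).trans_eq ?_
        rw [Real.mul_rpow hrj.le hs.le]
        have h6 : r j ^ (p - 2) * r j ^ (2 - p) = 1 := by
          rw [← Real.rpow_add hrj]; simp
        linear_combination (Λ / (2 - p) * s ^ (2 - p)) * h6
    have ht : Tendsto (fun s : ℝ => ((Λ / (2 - p) * s ^ (2 - p) : ℝ) : EReal)) (𝓝[>] 0) (𝓝 0) := by
      have h1 : Tendsto (fun s : ℝ => Λ / (2 - p) * s ^ (2 - p)) (𝓝 0) (𝓝 0) := by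
        have h2 := ((Real.continuousAt_rpow_const 0 (2 - p) (Or.inr hp2.le)).tendsto).const_mul
          (Λ / (2 - p))
        rwa [Real.zero_rpow hp2.ne', mul_zero] at h2
      exact (continuous_coe_real_ereal.tendsto 0).comp (h1.mono_left nhdsWithin_le_nhds)
    refine ge_of_tendsto ht ?_
    filter_upwards [self_mem_nhdsWithin] with s hs using hle s hs
  -- The flow vanishes at the origin, so its averages there are nonnegative, and so are those of the
  -- limit.
  · rw [hsub.upperRep_eq]
    refine le_iInf₂ fun s hs => ?_
    rw [← EReal.coe_zero, EReal.coe_le_coe_iff]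
    refine ge_of_tendsto (L1loc.tendsto_kernAvg hlim hs (tendsto_const_nhds (x := (0 : Eucl n)))) ?_
    filter_upwards [h.eventually_mul_le hr hr0 s] with j hj
    have h1 := h.tangentialFlow_le (hr j) hj.1 hs (x := 0) (by rw [norm_zero, zero_add]; exact hj.2)
    rw [h.tangentialFlow_eq (hr j) hj.1, hshift, smul_zero, h.apply_zero_eq hp, EReal.toReal_coe,
      ← EReal.coe_sub, sub_self, ← EReal.coe_mul, mul_zero, EReal.coe_le_coe_iff] at h1
    rw [h.kernAvg_flowClass]
    exact h1

/-- For `p = 2` the maximum of a tangent over a ball is the limit of the maxima of the flow. -/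
theorem maxBall_upperRep (h : FlowGerm 2 u v ρ Λ) {a : ℕ → ℝ} (ha : ∀ j, 0 < a j)
    (ha0 : Tendsto a atTop (𝓝 0)) {f : L1loc n}
    (hf : Tendsto (fun j => h.flowClass (a j)) atTop (𝓝 f)) {r : ℝ} (hr : 0 < r) {c : ℝ}
    (hc : Tendsto (fun j => (maxBall u (r * a j)).toReal - (maxBall u (a j)).toReal) atTop
      (𝓝 c)) : maxBall f.upperRep r = (c : EReal) := by
  have hsub := h.isSubmean_of_isL1locTangent (h.isL1locTangent_iff_seq.2 ⟨a, ha, ha0, hf⟩)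
  have hflow : ∀ j, a j ≤ ρ → ∀ x, tangentialFlow 2 u (a j) x =
      ((1 : ℝ) : EReal) * (u (a j • x) - (((maxBall u (a j)).toReal : ℝ) : EReal)) := by
    intro j hj x
    rw [h.tangentialFlow_eq (ha j) hj, flowShift, if_pos rfl, sub_self, Real.rpow_zero]
  refine le_antisymm (maxBall_le fun x hx => ?_) (le_of_not_gt fun hlt => ?_)
  -- An average at `x` involves the flow on `B_{r+s}`, where it exceeds its maximum over `B_r` by at
  -- most `Λ(log(r+s) - log r)`; this vanishes as `s → 0`.
  · have hle : ∀ s, 0 < s →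
        f.upperRep x ≤ ((c + Λ * (Real.log (r + s) - Real.log r) : ℝ) : EReal) := by
      intro s hs
      refine (hsub.upperRep_le hs x).trans (EReal.coe_le_coe_iff.2 ?_)
      refine kernAvg_le_of_ae_le f.2 hs ?_
      have h1 := L1loc.ae_le_of_tendsto hf (R := r + s)
        (G := fun j _ => (maxBall u (r * a j)).toReal - (maxBall u (a j)).toReal +
          Λ * (Real.log (r + s) - Real.log r))
        (g := fun _ => c + Λ * (Real.log (r + s) - Real.log r))
        (fun x _ => hc.add_const _) ?_
      · filter_upwards [h1] with y hy hys
        refine hy ?_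
        rw [mem_closedBall_iff_norm] at hys
        have := norm_le_norm_add_norm_sub' y x
        linarith
      · filter_upwards [h.eventually_mul_le ha ha0 (r + s)] with j hj
        filter_upwards [h.coeFn_flowClass (a j), h.ae_tangentialFlow_eq (ha j) hj.1] with
          y hy1 hy2 hys
        have haj := ha j
        have h2 := hy2 ((mul_le_mul_of_nonneg_left hys haj.le).trans hj.2)
        have h3 : tangentialFlow 2 u (a j) y ≤ (((1 : ℝ) *
            ((maxBall u (a j * (r + s))).toReal - (maxBall u (a j)).toReal) : ℝ) : EReal) := by
          rw [hflow j hj.1]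
          exact EReal.coe_mul_sub_le zero_le_one
            (h.le_coe_maxBall (by positivity) hj.2 (norm_smul_le_of_mul_le haj hys le_rfl))
        rw [h2, EReal.coe_le_coe_iff] at h3
        have h4 := h.growth (r * a j) (a j * (r + s)) (by positivity) (by nlinarith) hj.2
        have h5 : rieszProfile 2 (a j * (r + s)) - rieszProfile 2 (r * a j) =
            Real.log (r + s) - Real.log r := by
          simp only [rieszProfile, if_true]
          rw [Real.log_mul haj.ne' (by positivity), Real.log_mul hr.ne' haj.ne']
          ring
        rw [h5] at h4
        rw [hy1]
        linarith
    have ht : Tendsto (fun s : ℝ => ((c + Λ * (Real.log (r + s) - Real.log r) : ℝ) : EReal))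
        (𝓝[>] 0) (𝓝 (c : EReal)) := by
      have h1 : ContinuousAt (fun s : ℝ => c + Λ * (Real.log (r + s) - Real.log r)) 0 := by
        have : ContinuousAt (fun s : ℝ => Real.log (r + s)) 0 :=
          (continuousAt_const.add continuousAt_id).log (by simpa using hr.ne')
        exact continuousAt_const.add ((this.sub continuousAt_const).const_mul Λ)
      have h2 := h1.tendsto.mono_left (nhdsWithin_le_nhds (s := Ioi 0))
      simp only [add_zero, sub_self, mul_zero] at h2
      exact (continuous_coe_real_ereal.tendsto c).comp h2
    refine ge_of_tendsto ht ?_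
    filter_upwards [self_mem_nhdsWithin] with s hs using hle s hs
  -- Maximum points of the flow on `B_r` subconverge to some `y`. The sub-mean inequality at them
  -- passes to the limit and bounds every average of `f` at `y` below by `c`, which contradicts
  -- `U(y) < b < c`.
  · obtain ⟨b, hb, hbc⟩ := EReal.lt_iff_exists_real_btwn.1 hlt
    rw [EReal.coe_lt_coe_iff] at hbc
    have hz : ∀ j, ∃ z ∈ closedBall (0 : Eucl n) r, a j ≤ ρ → r * a j ≤ ρ →
        tangentialFlow 2 u (a j) z =
          (((maxBall u (r * a j)).toReal - (maxBall u (a j)).toReal : ℝ) : EReal) := by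
      intro j
      have haj := ha j
      by_cases hj : r * a j ≤ ρ
      · obtain ⟨x, hx, hxm⟩ := exists_maxBall_eq (mul_pos hr haj).le
          (h.usc.mono (closedBall_subset_closedBall hj))
        refine ⟨(a j)⁻¹ • x, mem_closedBall_zero_iff.2 ?_, fun hj1 _ => ?_⟩
        · rw [norm_smul, norm_inv, Real.norm_eq_abs, abs_of_pos haj, inv_mul_le_iff₀ haj,
            mul_comm]
          exact hx
        · rw [hflow j hj1, smul_inv_smul₀ haj.ne', ← hxm, h.maxBall_eq _ (mul_pos hr haj) hj,
            EReal.toReal_coe, ← EReal.coe_sub, ← EReal.coe_mul, one_mul]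
      · exact ⟨0, mem_closedBall_self hr.le, fun _ h2 => absurd h2 hj⟩
    choose z hzr hz using hz
    obtain ⟨y, hy, φ, hφ, hzy⟩ := (isCompact_closedBall (0 : Eucl n) r).tendsto_subseq hzr
    have hUy : f.upperRep y < (b : EReal) :=
      (le_maxBall (mem_closedBall_zero_iff.1 hy)).trans_lt hb
    rw [hsub.upperRep_eq] at hUy
    simp only [iInf_lt_iff, EReal.coe_lt_coe_iff] at hUy
    obtain ⟨s, hs, hsb⟩ := hUy
    have h1 := L1loc.tendsto_kernAvg (hf.comp hφ.tendsto_atTop) hs hzy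
    have h2 := hc.comp hφ.tendsto_atTop
    have h3 : c ≤ kernAvg s f.1 y := by
      refine le_of_tendsto_of_tendsto h2 h1 ?_
      filter_upwards [hφ.tendsto_atTop.eventually (h.eventually_mul_le ha ha0 (r + s))] with j hj
      have haj := ha (φ j)
      simp only [Function.comp]
      have hzj := mem_closedBall_zero_iff.1 (hzr (φ j))
      have h4 := h.tangentialFlow_le haj hj.1 hs (x := z (φ j))
        (le_trans (mul_le_mul_of_nonneg_left (by linarith) haj.le) hj.2)
      rw [hz (φ j) hj.1 (by nlinarith [hj.2]), EReal.coe_le_coe_iff] at h4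
      rw [h.kernAvg_flowClass]
      exact h4
    linarith

/-- The tangent set is invariant under the tangential flow. -/
theorem tangentialFlow_mem_tangentSet (h : FlowGerm p u v ρ Λ) {U : Eucl n → EReal}
    (hU : U ∈ tangentSet p u) {r : ℝ} (hr : 0 < r) : tangentialFlow p U r ∈ tangentSet p u := by
  obtain ⟨f, hf, rfl⟩ := hU
  have hsub := h.isSubmean_of_isL1locTangent hf
  obtain ⟨a, ha, ha0, hlim⟩ := h.isL1locTangent_iff_seq.1 hf
  have hrp : 0 < r ^ (p - 2) := Real.rpow_pos_of_pos hr _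
  suffices H : ∃ c : ℝ, IsL1locTangent p u (f.dilate hr (r ^ (p - 2)) c) ∧
      ∀ x, tangentialFlow p f.upperRep r x =
        ((r ^ (p - 2) : ℝ) : EReal) * (f.upperRep (r • x) - (c : EReal)) by
    obtain ⟨c, hg, hc⟩ := H
    refine ⟨_, hg, funext fun x => ?_⟩
    rw [hc, L1loc.upperRep_dilate hsub hr hrp c (h.isSubmean_of_isL1locTangent hg)]
  by_cases hp : p = 2
  · subst hp
    have hbdd : ∀ᶠ j in atTop, (maxBall u (r * a j)).toReal - (maxBall u (a j)).toReal ∈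
        closedBall (0 : ℝ) (Λ * |Real.log r|) := by
      filter_upwards [h.eventually_mul_le ha ha0 r] with j hj
      have haj := ha j
      have h1 := h.abs_maxBall_sub_le haj hj.1 (mul_pos hr haj) (by linarith [hj.2])
      simp only [rieszProfile, if_true] at h1
      rw [Real.log_mul hr.ne' haj.ne', add_sub_cancel_right] at h1
      rwa [mem_closedBall_zero_iff, Real.norm_eq_abs]
    -- The shift differences are bounded, so a subsequence converges; `maxBall_upperRep` identifies
    -- its limit `c` with the constant that the flow subtracts from the tangent.
    obtain ⟨c, -, φ, hφ, hc⟩ := tendsto_subseq_of_frequently_bounded isBounded_closedBall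
      hbdd.frequently
    have haφ : Tendsto (fun j => a (φ j)) atTop (𝓝 0) := ha0.comp hφ.tendsto_atTop
    have hlimφ := hlim.comp hφ.tendsto_atTop
    refine ⟨c, h.isL1locTangent_dilate (fun j => ha (φ j)) haφ hlimφ hr ?_, fun x => ?_⟩
    · refine hc.congr fun j => ?_
      simp only [Function.comp, sub_self, Real.rpow_zero, one_mul, flowShift, if_true]
    · rw [tangentialFlow, if_pos rfl, h.maxBall_upperRep (fun j => ha (φ j)) haφ hlimφ hr hc,
        sub_self, Real.rpow_zero, EReal.coe_one, one_mul]
  -- For `p ≠ 2` the shift does not depend on the radius. For `p < 2` the flow of the tangent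
  -- subtracts its value at `0`, which is `0`.
  · refine ⟨0, h.isL1locTangent_dilate ha ha0 hlim hr ?_, fun x => ?_⟩
    · refine tendsto_const_nhds.congr fun j => ?_
      simp only [flowShift, if_neg hp, sub_self, mul_zero]
    · rw [tangentialFlow, if_neg hp]
      split_ifs with hp2
      · rw [h.upperRep_zero hp2 hf, EReal.coe_zero]
      · rw [EReal.coe_zero, sub_zero]

/-- Boundedness and precompactness of the tangential flow on balls. -/
theorem exists_precompact_flow (h : FlowGerm p u v ρ Λ) {R : ℝ} (hR : 0 < R) :
    ∃ δ : ℝ, 0 < δ ∧ δ * max R 1 ≤ ρ ∧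
      (∃ C : ℝ, ∀ r : ℝ, 0 < r → r ≤ δ → ∀ x ∈ closedBall (0 : Eucl n) R,
        tangentialFlow p u r x ≤ (C : EReal)) ∧
      (∀ r : ℝ, 0 < r → r ≤ δ →
        ∃ f : Lp ℝ 1 ((volume : Measure (Eucl n)).restrict (closedBall 0 R)),
          ∀ᵐ x ∂((volume : Measure (Eucl n)).restrict (closedBall 0 R)),
            tangentialFlow p u r x = ((f x : ℝ) : EReal)) ∧
      (∃ C : ℝ, ∀ f ∈ flowFamily p u R δ, ‖f‖ ≤ C) ∧
      IsCompact (closure (flowFamily p u R δ)) := by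
  have hρ := h.pos
  -- The upper bound was proved for radii at least `1`. The factor `8M + 3` in `δ` dominates every
  -- radius restriction used below.
  set M : ℝ := max R 1 with hM
  have hM1 : 1 ≤ M := le_max_right _ _
  have hRM : R ≤ M := le_max_left _ _
  set δ : ℝ := ρ / (8 * M + 3) with hδ
  have hδM : δ * (8 * M + 3) = ρ := div_mul_cancel₀ ρ (by positivity)
  have hδpos : 0 < δ := by positivity
  have hle : ∀ K, K ≤ 8 * M + 3 → ∀ r, 0 < r → r ≤ δ → r * K ≤ ρ := by
    intro K hK r hr hrδ
    rw [← hδM]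
    exact (mul_le_mul_of_nonneg_left hK hr.le).trans
      (mul_le_mul_of_nonneg_right hrδ (by positivity))
  have hrρ : ∀ r, 0 < r → r ≤ δ → r ≤ ρ := fun r hr hrδ => by
    simpa using hle 1 (by linarith) r hr hrδ
  have hae : ∀ r, 0 < r → r ≤ δ →
      ∀ᵐ x ∂((volume : Measure (Eucl n)).restrict (closedBall 0 R)),
        tangentialFlow p u r x = (realFlow p u v r x : EReal) := by
    intro r hr hrδ
    refine (ae_restrict_iff' measurableSet_closedBall).2 ?_
    filter_upwards [h.ae_tangentialFlow_eq hr (hrρ r hr hrδ)] with x hx hxR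
    exact hx (hle _ (by linarith [mem_closedBall_zero_iff.1 hxR]) r hr hrδ)
  have hfam : ∀ f ∈ flowFamily p u R δ, ∃ r, 0 < r ∧ r ≤ δ ∧
      f =ᵐ[(volume : Measure (Eucl n)).restrict (closedBall 0 R)] realFlow p u v r := by
    rintro f ⟨r, hr, hrδ, hf⟩
    refine ⟨r, hr, hrδ, ?_⟩
    filter_upwards [hf, hae r hr hrδ] with x h1 h2
    exact EReal.coe_injective (h1.symm.trans h2)
  refine ⟨δ, hδpos, hle M (by linarith) δ hδpos le_rfl, ?_, ?_, ?_, ?_⟩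
  · obtain ⟨C, hC⟩ := h.exists_upper_bound M hM1
    exact ⟨C, fun r hr hrδ x hx => hC r hr (hle M (by linarith) r hr hrδ) x
      ((mem_closedBall_zero_iff.1 hx).trans hRM)⟩
  · intro r hr hrδ
    refine ⟨(h.flowClass r).restrict R, ?_⟩
    filter_upwards [hae r hr hrδ, L1loc.coeFn_restrict R (h.flowClass r),
      ae_restrict_of_ae (h.coeFn_flowClass r)] with x h1 h2 h3
    rw [h1, h2, h3]
  · obtain ⟨C, hC⟩ := h.exists_integral_bound hR
    refine ⟨C, fun f hf => ?_⟩
    obtain ⟨r, hr, hrδ, hfr⟩ := hfam f hf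
    rw [L1.norm_eq_integral_norm]
    refine le_trans (integral_congr_ae ?_).le (hC r hr (hle _ (by linarith) r hr hrδ))
    filter_upwards [hfr] with x hx
    rw [hx, Real.norm_eq_abs]
  · refine TotallyBounded.isCompact_of_isClosed (TotallyBounded.closure ?_) isClosed_closure
    exact (h.totallyBounded_realFlow hR (hle _ (by linarith) δ hδpos le_rfl)).subset hfam

end FlowGerm

end

/-! ### The theorem -/

theorem theorem11p2 (n : ℕ) (F : Set (Matrix (Fin n) (Fin n) ℝ))
    (hF : IsSubequation F) (hcone : HasConeProperty F) (hST : IsSTInvariant F)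
    (hconv : Convex ℝ F)
    (X : Set (Eucl n)) (hX : IsOpen X) (h0 : (0 : Eucl n) ∈ X)
    (u : Eucl n → EReal) (hu : IsSubharmonicOn F u X)
    (hne : ¬ ∀ᶠ x in 𝓝 (0 : Eucl n), u x = ⊥) :
    -- the family `u_r`, `0 < r ≤ δ`, on each ball `B_R`
    (∀ R : ℝ, 0 < R → ∃ δ : ℝ, 0 < δ ∧ closedBall (0 : Eucl n) (δ * max R 1) ⊆ X ∧
      (∃ C : ℝ, ∀ r : ℝ, 0 < r → r ≤ δ → ∀ x ∈ closedBall (0 : Eucl n) R,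
        tangentialFlow (rieszChar F) u r x ≤ (C : EReal)) ∧
      (∀ r : ℝ, 0 < r → r ≤ δ →
        ∃ f : Lp ℝ 1 ((volume : Measure (Eucl n)).restrict (closedBall 0 R)),
          ∀ᵐ x ∂((volume : Measure (Eucl n)).restrict (closedBall 0 R)),
            tangentialFlow (rieszChar F) u r x = ((f x : ℝ) : EReal)) ∧
      (∃ C : ℝ, ∀ f ∈ flowFamily (rieszChar F) u R δ, ‖f‖ ≤ C) ∧
      IsCompact (closure (flowFamily (rieszChar F) u R δ))) ∧
    -- the tangent set
    (tangentSet (rieszChar F) u).Nonempty ∧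
    (∀ f : L1loc n, IsL1locTangent (rieszChar F) u f → f.Represents f.upperRep) ∧
    IsCompact (classesL1loc (tangentSet (rieszChar F) u)) ∧
    (∀ U ∈ tangentSet (rieszChar F) u, ∀ r : ℝ, 0 < r →
      tangentialFlow (rieszChar F) U r ∈ tangentSet (rieszChar F) u) ∧
    IsConnected (classesL1loc (tangentSet (rieszChar F) u)) := by
  obtain ⟨v, ρ, Λ, h, hρX⟩ := hu.exists_flowGerm hF hcone hST hconv hX h0 hne
  refine ⟨fun R hR => ?_, ?_, fun f hf => (h.isSubmean_of_isL1locTangent hf).represents, ?_,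
    fun U hU r hr => h.tangentialFlow_mem_tangentSet hU hr, ?_⟩
  · obtain ⟨δ, hδ, hδρ, h1⟩ := h.exists_precompact_flow hR
    exact ⟨δ, hδ, (closedBall_subset_closedBall hδρ).trans hρX, h1⟩
  · obtain ⟨f, hf⟩ := h.isConnected_setOf_isL1locTangent.nonempty
    exact ⟨f.upperRep, f, hf, rfl⟩
  · rw [h.classesL1loc_tangentSet]
    exact h.isCompact_setOf_isL1locTangent
  · rw [h.classesL1loc_tangentSet]
    exact h.isConnected_setOf_isL1locTangent
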